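/- Let $d\ge 2$ be fixed. An instance of the problem Trac$(d)$ (particle tracking in the positionally determined case with a Markov-type objective) consists of a number $t\ge 1$ of moments in time, finite sets $F^{(1)},\dots,F^{(t)}\subseteq\mathbb{Q}^d$ with $|F^{(1)}|=\dots=|F^{(t)}|=n$, where the points of each $F^{(\tau)}$ are numbered $g^{(\tau)}_1,\dots,g^{(\tau)}_n$, and a rational weight $w(e)=\omega^{(\tau)}_{i,j}$ for every tracking edge $e=(g^{(\tau)}_i,g^{(\tau+1)}_j)$ with $1\le\tau\le t-1$, $1\le i,j\le n$. A coupling $\pi$ consists of bijections $\pi^{(\tau)}$ from the set of particles $\{p_1,\dots,p_n\}$ to $F^{(\tau)}$, for $\tau=1,\dots,t$; the tracks of the particles are $\mathcal{P}_k=(\pi^{(1)}(p_k),\dots,\pi^{(t)}(p_k))$, and the cost is $$c(\mathcal{P}_1,\dots,\mathcal{P}_n)=\sum_{k=1}^n\sum_{\tau=1}^{t-1} w\bigl(\pi^{(\tau)}(p_k),\pi^{(\tau+1)}(p_k)\bigr).$$ The task is to find the tracks $\mathcal{P}_1,\dots,\mathcal{P}_n$ of a coupling of minimal cost. Theorem.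 (a) Trac$(d)$ decomposes into $t-1$ uncoupled minimum weight perfect bipartite matching problems. That is, for every instance and every $\tau\in\{1,\dots,t-1\}$ let $K^{(\tau)}$ be the complete bipartite graph with colour classes $F^{(\tau)}$ and $F^{(\tau+1)}$ (taken as disjoint copies) and edge weights $w$, and for a coupling $\pi$ let $M^{(\tau)}(\pi)=\{(\pi^{(\tau)}(p_k),\pi^{(\tau+1)}(p_k)): 1\le k\le n\}$. Then: 1. each $M^{(\tau)}(\pi)$ is a perfect matching of $K^{(\tau)}$; 2. every family $(M^{(1)},\dots,M^{(t-1)})$ of perfect matchings $M^{(\tau)}$ of $K^{(\tau)}$ arises in this way from a coupling, and two couplings yield the same family if and only if they differ only by a permutation of the particles; 3. the cost of $\pi$ is the sum over $\tau$ of the weights of the matchings $M^{(\tau)}(\pi)$; 4. $\pi$ has minimal cost if and only if, for every $\tau$, $M^{(\tau)}(\pi)$ is a perfect matching of minimum weight in $K^{(\tau)}$. (b) Trac$(d)$ can be solved in polynomial time: there is a (multi-stack) Turing machine which, for every instance, given as the list of the point sets $F^{(1)},\dots,F^{(t)}$ and the full list of weights with all rational numbers written in binary, outputs the tracks $\mathcal{P}_1,\dots,\mathcal{P}_n$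 of a coupling of minimal cost, in a number of steps bounded by a polynomial in the length of the input. -/

import Mathlib

/-- An instance of the tracking problem in the positionally determined case, with a Markov-type
objective: `t = steps + 1` moments in time, and at each moment `τ` a set of `n` distinct points
of `ℚ ^ d`, numbered as `point τ 0, …, point τ (n - 1)`; the tracking edge from `point τ i` (at
time `τ`) to `point (τ + 1) j` (at time `τ + 1`) carries the rational weight `weight τ i j`. -/
structure TracInstance (d : ℕ) where
  steps : ℕ
  n : ℕ
  point : Fin (steps + 1) → Fin n → (Fin d → ℚ)
  point_injective : ∀ τ, Function.Injective (point τ)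
  weight : Fin steps → Fin n → Fin n → ℚ

namespace TracInstance

variable {d : ℕ} (I : TracInstance d)

/-- The set `F^(τ)` of particle positions at time `τ`. -/
def F (τ : Fin (I.steps + 1)) : Set (Fin d → ℚ) := Set.range (I.point τ)

/-- The numbering of `F^(τ)`. -/
noncomputable def numbering (τ : Fin (I.steps + 1)) : Fin I.n ≃ I.F τ :=
  Equiv.ofInjective (I.point τ) (I.point_injective τ)

noncomputable instance (τ : Fin (I.steps + 1)) : Fintype (I.F τ) :=
  Fintype.ofEquiv (Fin I.n) (I.numbering τ)

theorem card_F (τ : Fin (I.steps + 1)) : (I.F τ).ncard = I.n := by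
  rw [← Nat.card_coe_set_eq, ← Nat.card_congr (I.numbering τ), Nat.card_fin]

/-- The weight function `w` on the tracking edges from time `τ` to time `τ + 1`. -/
noncomputable def w (τ : Fin I.steps) (p : I.F τ.castSucc) (q : I.F τ.succ) : ℚ :=
  I.weight τ ((I.numbering τ.castSucc).symm p) ((I.numbering τ.succ).symm q)

/-- A coupling: for each moment in time, a one-to-one assignment of the `n` particles to the
positions in `F^(τ)`. -/
def Coupling : Type := ∀ τ : Fin (I.steps + 1), Fin I.n ≃ I.F τ

variable {I}

/-- The particle tracks of a coupling: for each particle, the list of its positions over time,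
each position being the list of its `d` coordinates. -/
def Coupling.tracks (π : I.Coupling) : List (List (List ℚ)) :=
  List.ofFn fun k : Fin I.n => List.ofFn fun τ : Fin (I.steps + 1) =>
    List.ofFn (π τ k : Fin d → ℚ)

/-- The Markov-type cost: the sum, over all tracks, of the weights of the edges on the track. -/
noncomputable def Coupling.cost (π : I.Coupling) : ℚ :=
  ∑ k : Fin I.n, ∑ τ : Fin I.steps, I.w τ (π τ.castSucc k) (π τ.succ k)

/-- The coupling is a solution of the tracking problem. -/
def Coupling.IsOptimal (π : I.Coupling) : Prop :=
  ∀ π' : I.Coupling, π.cost ≤ π'.cost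

variable (I)

/-- The complete bipartite graph between `F^(τ)` and `F^(τ+1)`. The disjoint union keeps a
position occupied at both times as two different vertices. -/
abbrev stepGraph (τ : Fin I.steps) : SimpleGraph (I.F τ.castSucc ⊕ I.F τ.succ) :=
  completeBipartiteGraph (I.F τ.castSucc) (I.F τ.succ)

open Classical in
/-- The total weight of the edges of a subgraph of `I.stepGraph τ`. -/
noncomputable def subgraphWeight (τ : Fin I.steps) (M : (I.stepGraph τ).Subgraph) : ℚ :=
  ∑ p : I.F τ.castSucc, ∑ q : I.F τ.succ,
    if M.Adj (Sum.inl p) (Sum.inr q) then I.w τ p q else 0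

/-- `M` solves the minimum weight perfect matching problem on `I.stepGraph τ`. -/
def IsMinWeightPerfectMatching (τ : Fin I.steps) (M : (I.stepGraph τ).Subgraph) : Prop :=
  M.IsPerfectMatching ∧
    ∀ M' : (I.stepGraph τ).Subgraph, M'.IsPerfectMatching →
      I.subgraphWeight τ M ≤ I.subgraphWeight τ M'

variable {I}

/-- The subgraph of `I.stepGraph τ` formed by all vertices and by the edges that the tracks of
the coupling use between time `τ` and time `τ + 1`. -/
def Coupling.stepEdges (π : I.Coupling) (τ : Fin I.steps) : (I.stepGraph τ).Subgraph where
  verts := Set.univ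
  Adj x y := ∃ k : Fin I.n,
    (x = Sum.inl (π τ.castSucc k) ∧ y = Sum.inr (π τ.succ k)) ∨
    (x = Sum.inr (π τ.succ k) ∧ y = Sum.inl (π τ.castSucc k))
  adj_sub := by
    rintro x y ⟨k, ⟨rfl, rfl⟩ | ⟨rfl, rfl⟩⟩ <;> simp
  edge_vert := fun _ => Set.mem_univ _
  symm := ⟨by
    rintro x y ⟨k, h | h⟩
    · exact ⟨k, Or.inr h.symm⟩
    · exact ⟨k, Or.inl h.symm⟩⟩

end TracInstance

/-- The alphabet of the input and of the output of the Turing machines. -/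
inductive TracSymbol
  | bit (b : Bool)
  | minus
  | slash
  | comma
  | semicolon
  | bar
  | hash
  deriving DecidableEq

namespace TracSymbol

/-- The binary representation of a rational number: the sign, the binary digits of the numerator
(least significant digit first), a slash, the binary digits of the denominator. -/
def encodeRat (q : ℚ) : List TracSymbol :=
  (if q < 0 then [minus] else []) ++ q.num.natAbs.bits.map bit ++ slash :: q.den.bits.map bit

/-- A list of objects, each closed by the terminator `s`. -/
def encodeList {α : Type} (s : TracSymbol) (e : α → List TracSymbol) (l : List α) :
    List TracSymbol :=
  l.flatMap fun x => e x ++ [s]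

/-- A three times nested list of rationals: each rational is followed by a comma, each innermost
list is followed by a semicolon, and each list of lists by a bar. -/
def encodeLists (l : List (List (List ℚ))) : List TracSymbol :=
  encodeList bar (encodeList semicolon (encodeList comma encodeRat)) l

end TracSymbol

/-- The point sets `F^(1), …, F^(t)` as lists of points, followed by the `n × n` matrices of
weights for the steps from `τ` to `τ + 1`; all numbers are written in binary. -/
def TracInstance.encode {d : ℕ} (I : TracInstance d) : List TracSymbol :=
  TracSymbol.encodeLists (List.ofFn fun τ => List.ofFn fun i => List.ofFn (I.point τ i)) ++
    TracSymbol.hash ::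
  TracSymbol.encodeLists (List.ofFn fun τ => List.ofFn fun i => List.ofFn (I.weight τ i))

namespace TracSymbol

theorem append_terminator_inj {s : TracSymbol} : ∀ {u v u' v' : List TracSymbol}, s ∉ u → s ∉ v →
    u ++ s :: u' = v ++ s :: v' → u = v ∧ u' = v'
  | [], [], _, _, _, _, h => by simpa using h
  | [], b :: v, _, _, _, hv, h => by simp at h hv; exact absurd h.1 hv.1
  | a :: u, [], _, _, hu, _, h => by simp at h hu; exact absurd h.1.symm hu.1
  | a :: u, b :: v, _, _, hu, hv, h => by
    simp only [List.cons_append, List.cons.injEq, List.mem_cons, not_or] at h hu hv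
    obtain ⟨h1, h2⟩ := append_terminator_inj hu.2 hv.2 h.2
    exact ⟨by rw [h.1, h1], h2⟩

theorem encodeList_injective {α : Type} {s : TracSymbol} {e : α → List TracSymbol}
    (he : Function.Injective e) (hs : ∀ x, s ∉ e x) : Function.Injective (encodeList s e) := by
  intro l
  induction l with
  | nil => intro l' h; cases l' <;> simp [encodeList] at h ⊢
  | cons x l ih =>
    intro l' h
    cases l' with
    | nil => simp [encodeList] at h
    | cons y l' =>
      simp only [encodeList, List.flatMap_cons, List.append_assoc, List.singleton_append] at h
      obtain ⟨h1, h2⟩ := append_terminator_inj (hs x) (hs y) h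
      rw [he h1, ih h2]

theorem encodeRat_injective : Function.Injective encodeRat := by
  intro a b h
  have bits_inj : Function.Injective (fun n : ℕ => n.bits.map bit) := by
    intro m n hmn
    have h1 : m.bits = n.bits := List.map_injective_iff.2 (fun x y h => by simpa using h) hmn
    have h2 := congrArg (fun l => Nat.ofDigits 2 (l.map fun b => cond b 1 0)) h1
    simpa [← Nat.digits_two_eq_bits, Nat.ofDigits_digits] using h2
  have nominus : ∀ (n m : ℕ), n.bits.map bit ≠ minus :: m.bits.map bit := by
    intro n m h
    have : minus ∈ n.bits.map bit := by rw [h]; simp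
    simp at this
  unfold encodeRat at h
  obtain ⟨h1, h2⟩ :=
    append_terminator_inj (by split_ifs <;> simp) (by split_ifs <;> simp) h
  have hden := bits_inj h2
  have hnum : a.num = b.num := by
    split_ifs at h1 with ha hb hb
    · have := bits_inj (List.append_cancel_left h1)
      have ha' := Rat.num_neg.2 ha
      have hb' := Rat.num_neg.2 hb
      omega
    · exact absurd h1.symm (nominus _ _)
    · exact absurd h1 (nominus _ _)
    · have := bits_inj (List.append_cancel_left h1)
      have ha' := Rat.num_nonneg.2 (not_lt.1 ha)
      have hb' := Rat.num_nonneg.2 (not_lt.1 hb)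
      omega
  exact Rat.ext hnum hden

theorem notMem_encodeList {α : Type} {s c : TracSymbol} {e : α → List TracSymbol}
    (hsc : c ≠ s) (hs : ∀ x, c ∉ e x) (l : List α) : c ∉ encodeList s e l := by
  simp only [encodeList, List.mem_flatMap, List.mem_append, List.mem_singleton, not_exists, not_and,
    not_or]
  exact fun x _ => ⟨hs x, hsc⟩

theorem notMem_encodeRat {c : TracSymbol} (hc : c = comma ∨ c = semicolon ∨ c = bar ∨ c = hash)
    (q : ℚ) : c ∉ encodeRat q := by
  unfold encodeRat
  rcases hc with rfl | rfl | rfl | rfl <;> split_ifs <;> simp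

/-- The binary encoding of nested lists of rationals is unambiguous. -/
theorem encodeLists_injective : Function.Injective encodeLists :=
  encodeList_injective
    (encodeList_injective
      (encodeList_injective encodeRat_injective (notMem_encodeRat (by simp)))
      (notMem_encodeList (by simp) (notMem_encodeRat (by simp))))
    (notMem_encodeList (by simp) (notMem_encodeList (by simp) (notMem_encodeRat (by simp))))

end TracSymbol

/-- The binary encoding of instances is unambiguous. -/
theorem TracInstance.encode_injective {d : ℕ} :
    Function.Injective (TracInstance.encode (d := d)) := by
  intro I J h
  have h1 : ∀ l, TracSymbol.hash ∉ TracSymbol.encodeLists l := fun l =>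
    TracSymbol.notMem_encodeList (by simp) (TracSymbol.notMem_encodeList (by simp)
      (TracSymbol.notMem_encodeList (by simp) (TracSymbol.notMem_encodeRat (by simp)))) l
  unfold TracInstance.encode at h
  obtain ⟨h2, h3⟩ := TracSymbol.append_terminator_inj (h1 _) (h1 _) h
  have h2 := TracSymbol.encodeLists_injective h2
  have h3 := TracSymbol.encodeLists_injective h3
  obtain ⟨s, n, p, hp, w⟩ := I
  obtain ⟨s', n', p', hp', w'⟩ := J
  dsimp at h2 h3
  have e1 : s = s' := by simpa using congrArg List.length h2
  subst e1
  have h2 := List.ofFn_injective h2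
  have e2 : n = n' := by simpa using congrArg List.length (congrFun h2 0)
  subst e2
  have e3 : p = p' := by
    funext τ i
    exact List.ofFn_injective (congrFun (List.ofFn_injective (congrFun h2 τ)) i)
  have e4 : w = w' := by
    funext τ i
    exact List.ofFn_injective (congrFun (List.ofFn_injective
      (congrFun (List.ofFn_injective h3) τ)) i)
  subst e3 e4; rfl

/-!
**The decomposition.** The edges that a coupling uses between two consecutive moments in time form
the graph of a bijection, hence a perfect matching of the complete bipartite graph. Conversely, a
perfect matching is the graph of a bijection, and a numbering of the positions at the first moment
together with one bijection for each step determines a coupling (`TracInstance.exists_coupling`);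
the numbering is the only freedom. The cost splits into the weights of the matchings. As the
matchings of the steps can be exchanged independently of each other, the cost is minimal if and
only if each single weight is (`TracInstance.Coupling.isOptimal_iff`).

**The algorithm.** It remains to solve the assignment problem for an `n × n` matrix of weights in
polynomial time. The algorithm (`assign`) treats the leading `k × k` submatrices in turn. Given an
optimal assignment for size `k`, give the edge from `a` to `b` the change in cost that arises when
row `a` takes over the column of row `b`. Optimality says that there are no cycles of negative cost
among the first `k` vertices. The assignments for size `k + 1` differ from the given one (with `k`
assigned to `k`) by a permutation, whose cycle through `k` carries the entire gain; so it is enough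
to find a cheapest cycle through `k`. It is composed of a cheapest simple path, which the method of
Bellman and Ford finds in `k` rounds, and a closing edge. The mathematics of this is in the
namespace `Assignment`, and `assign_spec` is the result. The tracks themselves are kept as
unparsed words in the rows of the matrix, so that permuting the rows amounts to following the
particles; after each step every track is extended by its next position (`extendTracks`).

**The machine.** Mathlib has the definition of polynomial time on machines with several stacks, but
no closure properties. They are proved here for *program fragments*. All data are
binary trees in Polish notation, lying on top of each other on one main stack. A fragment is a
finite set of labelled statements with one exit, and its specification (`Exec`) speaks about every
program that contains the fragment; therefore sequences, branches and loops of fragments are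
understood without simulating one machine by another. `PT f` says that some fragment replaces the
encoding of `a` on the main stack by that of `f a`, in a time polynomial in the size of `a`, and
whatever lies below. These functions are closed under composition, pairing, case distinction and
under loops whose state stays polynomially bounded (`PT.loop`, `PT.foldl_of_inv`). This gives lists,
unary indices, binary arithmetic (`Bin`), rational numbers with unreduced numerator and denominator
(`Frac`), and in the end the complete algorithm (`PT.solve`). Numbers stay small because sums are
only formed over single paths. A stack machine results from adding a fragment that reads the input
into a tree and one that writes the resulting tree to the output (`PT.exists_machine`).
-/


/-! ### Program fragments for a machine with four stacks -/

namespace StackProgram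

open Turing

/-- Binary trees, the universal data type of the programs. -/
inductive BTree
  | nil
  | node (l r : BTree)

/-- The Polish notation of a tree. It is self-delimiting, so several trees can be stored on one
stack on top of each other. -/
def BTree.word : BTree → List TracSymbol
  | nil => [.bit false]
  | node l r => .bit true :: (l.word ++ r.word)

/-- The size of a tree is the length of its Polish notation. -/
def BTree.size (t : BTree) : ℕ := t.word.length

@[simp] theorem BTree.size_nil : BTree.nil.size = 1 := rfl

@[simp] theorem BTree.size_node (l r : BTree) : (BTree.node l r).size = l.size + r.size + 1 := by
  simp [BTree.size, BTree.word]

theorem BTree.size_pos (t : BTree) : 0 < t.size := by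
  cases t <;> simp

/-- The stacks: `main` holds the data; `aux` and `tmp` hold trees that are being moved; `cnt` is a
unary counter. Between fragments only `main` is in use. -/
inductive Stk
  | main | aux | cnt | tmp
  deriving DecidableEq

instance : Fintype Stk := ⟨{.main, .aux, .cnt, .tmp}, by rintro ⟨⟩ <;> decide⟩

/-- The contents of the stacks. -/
abbrev Store := Stk → List TracSymbol

/-- The store with the given contents of the four stacks. -/
def st (m a c t : List TracSymbol) : Store
  | .main => m
  | .aux => a
  | .cnt => c
  | .tmp => t

@[simp] theorem st_main (m a c t) : st m a c t .main = m := rfl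
@[simp] theorem st_aux (m a c t) : st m a c t .aux = a := rfl
@[simp] theorem st_cnt (m a c t) : st m a c t .cnt = c := rfl
@[simp] theorem st_tmp (m a c t) : st m a c t .tmp = t := rfl

@[simp] theorem update_main (m a c t x) :
    Function.update (st m a c t) .main x = st x a c t := by
  funext k; cases k <;> rfl

@[simp] theorem update_aux (m a c t x) :
    Function.update (st m a c t) .aux x = st m x c t := by
  funext k; cases k <;> rfl

@[simp] theorem update_tmp (m a c t x) :
    Function.update (st m a c t) .tmp x = st m a c x := by
  funext k; cases k <;> rfl

/-- Statements of the machine; the internal state is a register for the symbol popped last. -/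
abbrev Code (Λ : Type) := TM2.Stmt (fun _ : Stk => TracSymbol) Λ (Option TracSymbol)

/-- Configurations of the machine. -/
abbrev Conf (Λ : Type) := TM2.Cfg (fun _ : Stk => TracSymbol) Λ (Option TracSymbol)

/-- Renaming of the jump targets. -/
def mapLabel {Λ Λ' : Type} (g : Λ → Λ') : Code Λ → Code Λ'
  | .push k f q => .push k f (mapLabel g q)
  | .peek k f q => .peek k f (mapLabel g q)
  | .pop k f q => .pop k f (mapLabel g q)
  | .load f q => .load f (mapLabel g q)
  | .branch f q₁ q₂ => .branch f (mapLabel g q₁) (mapLabel g q₂)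
  | .goto f => .goto fun v => g (f v)
  | .halt => .halt

theorem mapLabel_mapLabel {Λ Λ' Λ'' : Type} (g : Λ' → Λ'') (f : Λ → Λ') (s : Code Λ) :
    mapLabel g (mapLabel f s) = mapLabel (fun l => g (f l)) s := by
  induction s <;> simp_all [mapLabel]

/-- The program `M` gets from `c` to `c'` in at most `k` steps. -/
def ReachIn {Λ : Type} (M : Λ → Code Λ) (k : ℕ) (c c' : Conf Λ) : Prop :=
  ∃ j ≤ k, (flip bind (TM2.step M))^[j] (some c) = some c'

namespace ReachIn

variable {Λ : Type} {M : Λ → Code Λ}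

theorem refl (k : ℕ) (c : Conf Λ) : ReachIn M k c c := ⟨0, by simp, rfl⟩

theorem trans {k k' : ℕ} {c c' c'' : Conf Λ} (h : ReachIn M k c c') (h' : ReachIn M k' c' c'') :
    ReachIn M (k + k') c c'' := by
  obtain ⟨j, hj, e⟩ := h
  obtain ⟨j', hj', e'⟩ := h'
  exact ⟨j' + j, by omega, by rw [Function.iterate_add_apply, e, e']⟩

theorem mono {k k' : ℕ} {c c' : Conf Λ} (h : ReachIn M k c c') (hk : k ≤ k') :
    ReachIn M k' c c' := by
  obtain ⟨j, hj, e⟩ := h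
  exact ⟨j, by omega, e⟩

theorem cast {k : ℕ} {l l' m m' : Option Λ} {v w : Option TracSymbol} {S S' T T' : Store}
    (h : ReachIn M k ⟨l, v, S⟩ ⟨m, w, T⟩) (hl : l = l') (hS : S = S') (hm : m = m') (hT : T = T') :
    ReachIn M k ⟨l', v, S'⟩ ⟨m', w, T'⟩ := by
  subst hl hS hm hT; exact h

theorem step {k : ℕ} {l : Λ} {v : Option TracSymbol} {S : Store} {c' : Conf Λ}
    (h : ReachIn M k (TM2.stepAux (M l) v S) c') : ReachIn M (k + 1) ⟨some l, v, S⟩ c' := by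
  obtain ⟨j, hj, e⟩ := h
  exact ⟨j + 1, by omega, by rw [Function.iterate_succ_apply]; exact e⟩

end ReachIn

/-- A program fragment: finitely many labelled statements, which jump to each other or, by the
target `none`, leave the fragment. -/
structure Frag where
  /-- the labels of the fragment -/
  L : Type
  /-- there are finitely many labels -/
  fin : Fintype L
  /-- the label at which the execution starts -/
  entry : L
  /-- the statements -/
  body : L → Code (Option L)

/-- Executed on the store `S`, the fragment leaves the store `S'` after at most `k` steps. This is
required inside every program that contains the fragment, with its exit redirected to an arbitrary
label, so that fragments can be combined without simulating one machine by another. -/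
def Exec (F : Frag) (S S' : Store) (k : ℕ) : Prop :=
  ∀ (Λ : Type) (M : Λ → Code Λ) (e : F.L → Λ) (x : Λ),
    (∀ l, M (e l) = mapLabel (fun o => o.elim x e) (F.body l)) →
    ∀ v, ∃ v', ReachIn M k ⟨some (e F.entry), v, S⟩ ⟨some x, v', S'⟩

theorem Exec.mono {F : Frag} {S S' : Store} {k k' : ℕ} (h : Exec F S S' k) (hk : k ≤ k') :
    Exec F S S' k' := fun Λ M e x hM v =>
  let ⟨v', h'⟩ := h Λ M e x hM v
  ⟨v', h'.mono hk⟩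

/-- The symbol for an inner node. -/
abbrev one : TracSymbol := .bit true

/-- The symbol for a leaf. -/
abbrev zero : TracSymbol := .bit false

/-- A fragment consisting of a single statement. -/
abbrev prim (s : Code (Option Unit)) : Frag := ⟨Unit, inferInstance, (), fun _ => s⟩

/-- Push a symbol. -/
abbrev pushF (b : TracSymbol) : Frag := prim (.push .main (fun _ => b) (.goto fun _ => none))

theorem exec_pushF (b : TracSymbol) (m a c t) :
    Exec (pushF b) (st m a c t) (st (b :: m) a c t) 1 := by
  intro Λ M e x hM v
  refine ⟨v, ReachIn.step ?_⟩
  rw [hM]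
  simp only [mapLabel, TM2.stepAux, update_main, st_main]
  exact ReachIn.refl _ _

/-- Pop a symbol. -/
abbrev popF : Frag := prim (.pop .main (fun _ o => o) (.goto fun _ => none))

theorem exec_popF (b : TracSymbol) (m a c t) :
    Exec popF (st (b :: m) a c t) (st m a c t) 1 := by
  intro Λ M e x hM v
  refine ⟨some b, ReachIn.step ?_⟩
  rw [hM]
  simp only [mapLabel, TM2.stepAux, update_main, st_main]
  exact ReachIn.refl _ _

/-- Execute `F`, then `G`. -/
abbrev seq (F G : Frag) : Frag where
  L := F.L ⊕ G.L
  fin := haveI := F.fin; haveI := G.fin; inferInstance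
  entry := .inl F.entry
  body := Sum.elim
    (fun l => mapLabel (fun o => some (o.elim (Sum.inr G.entry) Sum.inl)) (F.body l))
    (fun l => mapLabel (Option.map Sum.inr) (G.body l))

theorem Exec.seq {F G : Frag} {S S' S'' : Store} {k k' : ℕ} (hF : Exec F S S' k)
    (hG : Exec G S' S'' k') : Exec (seq F G) S S'' (k + k') := by
  intro Λ M e x hM v
  obtain ⟨v', h⟩ := hF Λ M (fun l => e (.inl l)) (e (.inr G.entry)) (fun l => by
    rw [hM]
    simp only [StackProgram.seq, Sum.elim_inl, mapLabel_mapLabel]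
    congr 1; funext o; cases o <;> rfl) v
  obtain ⟨v'', h'⟩ := hG Λ M (fun l => e (.inr l)) x (fun l => by
    rw [hM]
    simp only [StackProgram.seq, Sum.elim_inr, mapLabel_mapLabel]
    congr 1; funext o; cases o <;> rfl) v'
  exact ⟨v'', h.trans h'⟩

/-- Push the content of the register on each of the given stacks. -/
def pushAll {Λ : Type} : List Stk → Code Λ → Code Λ
  | [], s => s
  | k :: ks, s => .push k (fun v => v.getD zero) (pushAll ks s)

theorem mapLabel_pushAll {Λ Λ' : Type} (g : Λ → Λ') (ks : List Stk) (s : Code Λ) :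
    mapLabel g (pushAll ks s) = pushAll ks (mapLabel g s) := by
  induction ks <;> simp_all [pushAll, mapLabel]

theorem stepAux_pushAll {Λ : Type} (ks : List Stk) (h : ks.Nodup) (s : Code Λ) (b : TracSymbol)
    (S : Store) : TM2.stepAux (pushAll ks s) (some b) S =
      TM2.stepAux s (some b) (fun k => if k ∈ ks then b :: S k else S k) := by
  induction ks generalizing S with
  | nil => simp [pushAll]
  | cons k ks ih =>
    rw [List.nodup_cons] at h
    simp only [pushAll, TM2.stepAux, Option.getD_some]
    rw [ih h.2]
    congr 1
    funext j
    by_cases hj : j = k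
    · subst hj; simp [h.1]
    · simp [hj]

/-- Move the content of a stack to other stacks, in reversed order. -/
abbrev moveF (X : Stk) (ks : List Stk) : Frag :=
  prim (.pop X (fun _ o => o) (.branch Option.isNone (.goto fun _ => none)
    (pushAll ks (.goto fun _ => some ()))))

theorem exec_moveF (X : Stk) (ks : List Stk) (h : ks.Nodup) (hX : X ∉ ks) (S : Store) :
    Exec (moveF X ks) S
      (fun k => if k = X then [] else if k ∈ ks then (S X).reverse ++ S k else S k)
      ((S X).length + 1) := by
  intro Λ M e x hM v
  refine ⟨none, ?_⟩
  generalize hl : S X = l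
  induction l generalizing S v with
  | nil =>
    refine ReachIn.step ?_
    rw [hM]
    simp only [moveF, prim, mapLabel, TM2.stepAux, hl, List.head?_nil, Option.isNone_none,
      cond_true, Option.elim_none, List.tail_nil]
    have : Function.update S X [] = fun k => if k = X then [] else if k ∈ ks then
        List.reverse [] ++ S k else S k := by
      funext k
      by_cases hk : k = X
      · subst hk; simp
      · simp [hk]
    rw [this]
    exact ReachIn.refl _ _
  | cons b l ih =>
    refine ReachIn.step ?_
    rw [hM]
    simp only [moveF, prim, mapLabel, TM2.stepAux, hl, List.head?_cons, Option.isNone_some,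
      cond_false, List.tail_cons, mapLabel_pushAll]
    rw [stepAux_pushAll _ h]
    simp only [TM2.stepAux, Option.elim_some]
    have := ih (fun k => if k ∈ ks then b :: Function.update S X l k else Function.update S X l k)
      (some b) (by simp [hX])
    convert this using 3
    · rfl
    rename_i k
    by_cases hk : k = X
    · subst hk; simp
    · by_cases hk' : k ∈ ks <;> simp [hk, hk']

/-- Move the topmost tree of `main` to the stack `X`, in reversed order. The number of trees still
to be read is kept in unary on the stack `cnt`. -/
abbrev parseF (X : Stk) : Frag where
  L := Bool
  fin := inferInstance
  entry := false
  body
    | false => .push .cnt (fun _ => one) (.goto fun _ => some true)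
    | true => .pop .main (fun _ o => o) (.push X (fun v => v.getD zero)
        (.branch (fun v => v = some one) (.push .cnt (fun _ => one) (.goto fun _ => some true))
          (.pop .cnt (fun _ o => o) (.peek .cnt (fun _ o => o)
            (.branch Option.isNone (.goto fun _ => none) (.goto fun _ => some true))))))

theorem reachIn_parseF {X : Stk} (hX : X ≠ .main) (hX' : X ≠ .cnt) {Λ : Type} {M : Λ → Code Λ}
    {e : Bool → Λ} {x : Λ}
    (hM : ∀ l : Bool, M (e l) = mapLabel (fun o => o.elim x e) ((parseF X).body l)) (t : BTree) :
    ∀ (n : ℕ) (v : Option TracSymbol) (S : Store) (m : List TracSymbol),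
      S .main = t.word ++ m → S .cnt = List.replicate (n + 1) one →
      ∃ v', ReachIn M t.size ⟨some (e true), v, S⟩
        ⟨some (if n = 0 then x else e true), v', Function.update (Function.update
          (Function.update S .main m) X (t.word.reverse ++ S X)) .cnt (List.replicate n one)⟩ := by
  have hne : Stk.cnt ≠ X := fun h => hX' h.symm
  have hne' : Stk.main ≠ X := fun h => hX h.symm
  induction t with
  | nil =>
    intro n v S m hm hc
    refine ⟨(List.replicate n one).head?, ReachIn.step ?_⟩
    rw [hM]
    simp only [mapLabel, TM2.stepAux, hm, BTree.word, List.singleton_append,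
      List.head?_cons, List.tail_cons, Option.getD_some, Option.some.injEq, TracSymbol.bit.injEq,
      Bool.false_eq_true, decide_false, cond_false, Function.update_of_ne hne,
      Function.update_of_ne (show Stk.cnt ≠ Stk.main by decide),
      Function.update_self, hc, List.replicate_succ, Function.update_of_ne hX,
      List.reverse_singleton]
    cases n with
    | zero => exact ReachIn.refl _ _
    | succ n => exact ReachIn.refl _ _
  | node l r ihl ihr =>
    intro n v S m hm hc
    obtain ⟨v1, h1⟩ := ihl (n + 1) (some one) (Function.update (Function.update
          (Function.update S .main (l.word ++ (r.word ++ m))) X (one :: S X)) .cnt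
            (List.replicate (n + 2) one)) (r.word ++ m)
      (by simp [hne']) (by simp)
    obtain ⟨v2, h2⟩ := ihr n v1 (Function.update (Function.update (Function.update S
        .main (r.word ++ m)) X (l.word.reverse ++ (one :: S X))) .cnt (List.replicate (n + 1) one))
      m (by simp [hne']) (by simp)
    refine ⟨v2, ?_⟩
    rw [BTree.size_node]
    refine ReachIn.step (ReachIn.trans (c' := ⟨some (e true), v1, Function.update (Function.update
      (Function.update S .main (r.word ++ m)) X (l.word.reverse ++ (one :: S X))) .cnt
      (List.replicate (n + 1) one)⟩) ?_ ?_)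
    · rw [hM]
      simp only [mapLabel, TM2.stepAux, hm, BTree.word, List.cons_append, List.append_assoc,
        List.head?_cons, List.tail_cons, Option.getD_some, decide_true, cond_true,
        Function.update_of_ne hne, Function.update_of_ne (show Stk.cnt ≠ Stk.main by decide),
        Function.update_of_ne hX, hc]
      rw [show one :: List.replicate (n + 1) one = List.replicate (n + 2) one from rfl]
      refine h1.cast rfl rfl (by simp) ?_
      funext k
      cases k <;> cases X <;> simp_all
    · refine h2.cast rfl rfl rfl ?_
      funext k
      cases k <;> cases X <;> simp_all [BTree.word]

theorem exec_parseF {X : Stk} (hX : X ≠ .main) (hX' : X ≠ .cnt) (t : BTree) (S : Store)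
    (m : List TracSymbol) (hm : S .main = t.word ++ m) (hc : S .cnt = []) :
    Exec (parseF X) S
      (Function.update (Function.update S .main m) X (t.word.reverse ++ S X)) (t.size + 1) := by
  intro Λ M e x hM v
  obtain ⟨v', h⟩ := reachIn_parseF hX hX' hM t 0 v (Function.update S .cnt [one]) m
    (by simpa using hm) (by simp)
  refine ⟨v', ReachIn.step ?_⟩
  rw [hM]
  simp only [mapLabel, TM2.stepAux, hc]
  rw [if_pos rfl] at h
  refine h.cast rfl rfl rfl ?_
  funext k
  cases k <;> cases X <;> simp_all

end StackProgram

/-! ### Fragments for the operations on trees -/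

namespace StackProgram

open Turing

/-- Duplicate the topmost tree. -/
def dupF : Frag :=
  seq (parseF .aux) (seq (moveF .aux [.main, .tmp]) (seq (moveF .tmp [.aux]) (moveF .aux [.main])))

theorem exec_dupF (t : BTree) (m : List TracSymbol) :
    Exec dupF (st (t.word ++ m) [] [] []) (st (t.word ++ (t.word ++ m)) [] [] [])
      (4 * t.size + 4) := by
  have h1 : Exec (parseF .aux) (st (t.word ++ m) [] [] []) (st m t.word.reverse [] [])
      (t.size + 1) := by
    simpa using exec_parseF (X := .aux) (by decide) (by decide) t (st (t.word ++ m) [] [] []) m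
      rfl rfl
  have h2 : Exec (moveF .aux [.main, .tmp]) (st m t.word.reverse [] [])
      (st (t.word ++ m) [] [] t.word) (t.size + 1) := by
    convert exec_moveF .aux [.main, .tmp] (by decide) (by decide) (st m t.word.reverse [] [])
      using 1
    · funext k; cases k <;> simp
    · simp [BTree.size]
  have h3 : Exec (moveF .tmp [.aux]) (st (t.word ++ m) [] [] t.word)
      (st (t.word ++ m) t.word.reverse [] []) (t.size + 1) := by
    convert exec_moveF .tmp [.aux] (by decide) (by decide) (st (t.word ++ m) [] [] t.word) using 1
    · funext k; cases k <;> simp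
    · simp [BTree.size]
  have h4 : Exec (moveF .aux [.main]) (st (t.word ++ m) t.word.reverse [] [])
      (st (t.word ++ (t.word ++ m)) [] [] []) (t.size + 1) := by
    convert exec_moveF .aux [.main] (by decide) (by decide) (st (t.word ++ m) t.word.reverse [] [])
      using 1
    · funext k; cases k <;> simp
    · simp [BTree.size]
  exact (h1.seq (h2.seq (h3.seq h4))).mono (by omega)

/-- Remove the topmost tree. -/
def dropF : Frag := seq (parseF .aux) (moveF .aux [])

theorem exec_dropF (t : BTree) (m : List TracSymbol) :
    Exec dropF (st (t.word ++ m) [] [] []) (st m [] [] []) (2 * t.size + 2) := by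
  have h1 : Exec (parseF .aux) (st (t.word ++ m) [] [] []) (st m t.word.reverse [] [])
      (t.size + 1) := by
    simpa using exec_parseF (X := .aux) (by decide) (by decide) t (st (t.word ++ m) [] [] []) m
      rfl rfl
  have h2 : Exec (moveF .aux []) (st m t.word.reverse [] []) (st m [] [] []) (t.size + 1) := by
    convert exec_moveF .aux [] (by decide) (by decide) (st m t.word.reverse [] []) using 1
    · funext k; cases k <;> simp
    · simp [BTree.size]
  exact (h1.seq h2).mono (by omega)

/-- Exchange the two topmost trees. -/
def swapF : Frag :=
  seq (parseF .aux) (seq (parseF .tmp) (seq (moveF .aux [.main]) (moveF .tmp [.main])))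

theorem exec_swapF (t u : BTree) (m : List TracSymbol) :
    Exec swapF (st (t.word ++ (u.word ++ m)) [] [] []) (st (u.word ++ (t.word ++ m)) [] [] [])
      (2 * t.size + 2 * u.size + 4) := by
  have h1 : Exec (parseF .aux) (st (t.word ++ (u.word ++ m)) [] [] [])
      (st (u.word ++ m) t.word.reverse [] []) (t.size + 1) := by
    simpa using exec_parseF (X := .aux) (by decide) (by decide) t
      (st (t.word ++ (u.word ++ m)) [] [] []) _ rfl rfl
  have h2 : Exec (parseF .tmp) (st (u.word ++ m) t.word.reverse [] [])
      (st m t.word.reverse [] u.word.reverse) (u.size + 1) := by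
    simpa using exec_parseF (X := .tmp) (by decide) (by decide) u
      (st (u.word ++ m) t.word.reverse [] []) _ rfl rfl
  have h3 : Exec (moveF .aux [.main]) (st m t.word.reverse [] u.word.reverse)
      (st (t.word ++ m) [] [] u.word.reverse) (t.size + 1) := by
    convert exec_moveF .aux [.main] (by decide) (by decide)
      (st m t.word.reverse [] u.word.reverse) using 1
    · funext k; cases k <;> simp
    · simp [BTree.size]
  have h4 : Exec (moveF .tmp [.main]) (st (t.word ++ m) [] [] u.word.reverse)
      (st (u.word ++ (t.word ++ m)) [] [] []) (u.size + 1) := by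
    convert exec_moveF .tmp [.main] (by decide) (by decide)
      (st (t.word ++ m) [] [] u.word.reverse) using 1
    · funext k; cases k <;> simp
    · simp [BTree.size]
  exact (h1.seq (h2.seq (h3.seq h4))).mono (by omega)

/-- Case distinction on the left component of a pair: for `(nil, c)` execute `F` on `c`; otherwise
execute `G` on the pair. -/
abbrev caseF (F G : Frag) : Frag where
  L := Unit ⊕ (F.L ⊕ G.L)
  fin := haveI := F.fin; haveI := G.fin; inferInstance
  entry := .inl ()
  body := Sum.elim
    (fun _ => .pop .main (fun _ o => o) (.pop .main (fun _ o => o) (.branch (fun v => v = some one)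
      (.push .main (fun _ => one) (.push .main (fun _ => one)
        (.goto fun _ => some (.inr (.inr G.entry)))))
      (.goto fun _ => some (.inr (.inl F.entry))))))
    (Sum.elim (fun l => mapLabel (Option.map fun l => .inr (.inl l)) (F.body l))
      (fun l => mapLabel (Option.map fun l => .inr (.inr l)) (G.body l)))

theorem exec_caseF_nil {F G : Frag} {S' : Store} {k : ℕ} (c : BTree) (m : List TracSymbol)
    (hF : Exec F (st (c.word ++ m) [] [] []) S' k) :
    Exec (caseF F G) (st ((BTree.node .nil c).word ++ m) [] [] []) S' (k + 1) := by
  intro Λ M e x hM v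
  obtain ⟨v', h⟩ := hF Λ M (fun l => e (.inr (.inl l))) x (fun l => by
    rw [hM]
    simp only [Sum.elim_inl, Sum.elim_inr, mapLabel_mapLabel]
    congr 1; funext o; cases o <;> rfl) (some zero)
  refine ⟨v', ReachIn.step ?_⟩
  rw [hM]
  refine h.cast ?_ ?_ rfl rfl <;> simp [BTree.word]

theorem exec_caseF_node {F G : Frag} {S' : Store} {k : ℕ} (t u c : BTree) (m : List TracSymbol)
    (hG : Exec G (st ((BTree.node (.node t u) c).word ++ m) [] [] []) S' k) :
    Exec (caseF F G) (st ((BTree.node (.node t u) c).word ++ m) [] [] []) S' (k + 1) := by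
  intro Λ M e x hM v
  obtain ⟨v', h⟩ := hG Λ M (fun l => e (.inr (.inr l))) x (fun l => by
    rw [hM]
    simp only [Sum.elim_inr, mapLabel_mapLabel]
    congr 1; funext o; cases o <;> rfl) (some one)
  refine ⟨v', ReachIn.step ?_⟩
  rw [hM]
  refine h.cast rfl ?_ rfl rfl
  simp [BTree.word]

/-- Repeat `F` until the left component of the resulting pair is `nil`; then keep the right
component. -/
abbrev loopF (F : Frag) : Frag where
  L := Option F.L
  fin := haveI := F.fin; inferInstance
  entry := some F.entry
  body
    | some l => mapLabel some (F.body l)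
    | none => .pop .main (fun _ o => o) (.pop .main (fun _ o => o) (.branch (fun v => v = some one)
        (.pop .main (fun _ o => o) (.pop .main (fun _ o => o)
          (.goto fun _ => some (some F.entry))))
        (.goto fun _ => none)))

theorem exec_loopF_exit {F : Frag} {S : Store} {k : ℕ} (c : BTree) (m : List TracSymbol)
    (hF : Exec F S (st ((BTree.node .nil c).word ++ m) [] [] []) k) :
    Exec (loopF F) S (st (c.word ++ m) [] [] []) (k + 1) := by
  intro Λ M e x hM v
  obtain ⟨v', h⟩ := hF Λ M (fun l => e (some l)) (e none) (fun l => by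
    rw [hM]
    simp only [mapLabel_mapLabel]
    congr 1; funext o; cases o <;> rfl) v
  refine ⟨some zero, h.trans (ReachIn.step (k := 0) ?_)⟩
  rw [hM]
  refine (ReachIn.refl (M := M) 0 ⟨some x, some zero, st (c.word ++ m) [] [] []⟩).cast ?_ ?_ rfl rfl
  · rfl
  · simp [BTree.word]

theorem exec_loopF_continue {F : Frag} {S S' : Store} {k k' : ℕ} (c : BTree) (m : List TracSymbol)
    (hF : Exec F S (st ((BTree.node (.node .nil .nil) c).word ++ m) [] [] []) k)
    (hF' : Exec (loopF F) (st (c.word ++ m) [] [] []) S' k') :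
    Exec (loopF F) S S' (k + k' + 1) := by
  intro Λ M e x hM v
  obtain ⟨v', h⟩ := hF Λ M (fun l => e (some l)) (e none) (fun l => by
    rw [hM]
    simp only [mapLabel_mapLabel]
    congr 1; funext o; cases o <;> rfl) v
  obtain ⟨v'', h'⟩ := hF' Λ M e x hM (some zero)
  refine ⟨v'', (h.trans (ReachIn.step (k := k') ?_)).mono (by omega)⟩
  rw [hM]
  refine h'.cast rfl ?_ rfl rfl
  simp [BTree.word]

/-! ### Functions that are computable in polynomial time -/

theorem _root_.Polynomial.eval_mono_nat (p : Polynomial ℕ) : Monotone fun n => p.eval n := by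
  intro a b h
  induction p using Polynomial.induction_on' with
  | add p q hp hq => simpa using add_le_add hp hq
  | monomial n c => simpa using Nat.mul_le_mul_left c (Nat.pow_le_pow_left h n)

/-- An encoding of the elements of a type by trees. -/
class Enc (α : Type) where
  /-- the tree that encodes an element -/
  enc : α → BTree

open Enc

/-- The size of the encoding. -/
def size {α : Type} [Enc α] (a : α) : ℕ := (enc a).size

theorem size_pos {α : Type} [Enc α] (a : α) : 0 < size a := BTree.size_pos _

instance {α β : Type} [Enc α] [Enc β] : Enc (α × β) := ⟨fun x => .node (enc x.1) (enc x.2)⟩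
instance : Enc Unit := ⟨fun _ => .nil⟩
instance : Enc Bool := ⟨fun b => cond b (.node .nil .nil) .nil⟩

/-- The encoding of a list. -/
def encList {α : Type} [Enc α] : List α → BTree
  | [] => .nil
  | a :: l => .node (enc a) (encList l)

instance {α : Type} [Enc α] : Enc (List α) := ⟨encList⟩

section

variable {α β γ δ : Type} [Enc α] [Enc β] [Enc γ] [Enc δ]

@[simp] theorem enc_pair (a : α) (b : β) : enc (a, b) = .node (enc a) (enc b) := rfl
@[simp] theorem enc_nil : enc ([] : List α) = .nil := rfl
@[simp] theorem enc_cons (a : α) (l : List α) : enc (a :: l) = .node (enc a) (enc l) := rfl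
@[simp] theorem enc_true : enc true = .node .nil .nil := rfl
@[simp] theorem enc_false : enc false = .nil := rfl
@[simp] theorem size_pair (a : α) (b : β) : size (a, b) = size a + size b + 1 := by simp [size]
@[simp] theorem size_list_nil : size ([] : List α) = 1 := rfl
@[simp] theorem size_list_cons (a : α) (l : List α) : size (a :: l) = size a + size l + 1 := by
  simp [size]

/-- `f` is computed by a program fragment in polynomial time: the fragment replaces the topmost tree
`enc a` by `enc (f a)`, and the size of the result is polynomially bounded too. -/
@[fun_prop]
def PT (f : α → β) : Prop :=
  ∃ (F : Frag) (p : Polynomial ℕ), ∀ a, size (f a) ≤ p.eval (size a) ∧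
    ∀ m, Exec F (st ((enc a).word ++ m) [] [] []) (st ((enc (f a)).word ++ m) [] [] [])
      (p.eval (size a))

theorem PT.size_le {f : α → β} (hf : PT f) :
    ∃ p : Polynomial ℕ, ∀ a, size (f a) ≤ p.eval (size a) :=
  let ⟨_, p, h⟩ := hf
  ⟨p, fun a => (h a).1⟩

@[fun_prop]
theorem PT.id : PT (fun a : α => a) := by
  refine ⟨seq (pushF one) popF, .X + 2, fun a => ⟨by simp, fun m => ?_⟩⟩
  refine ((exec_pushF one _ [] [] []).seq (exec_popF one _ [] [] [])).mono (by simp)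

@[fun_prop]
theorem PT.comp {g : β → γ} {f : α → β} (hg : PT g) (hf : PT f) : PT (fun a => g (f a)) := by
  obtain ⟨F, p, hF⟩ := hf
  obtain ⟨G, q, hG⟩ := hg
  refine ⟨seq F G, p + q.comp p, fun a => ⟨?_, fun m => ?_⟩⟩
  · refine (hG (f a)).1.trans (le_trans (q.eval_mono_nat (hF a).1) ?_)
    simp [Polynomial.eval_comp]
  · refine (((hF a).2 m).seq ((hG (f a)).2 m)).mono ?_
    have := q.eval_mono_nat (hF a).1
    simpa [Polynomial.eval_comp] using this

/-- A function that does not change the encoding costs nothing. -/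
theorem PT.of_enc {f : α → β} (h : ∀ a, enc (f a) = enc a) : PT f := by
  obtain ⟨F, p, hF⟩ := PT.id (α := α)
  refine ⟨F, p, fun a => ⟨?_, fun m => ?_⟩⟩
  · simpa [size, h] using (hF a).1
  · rw [h]; exact (hF a).2 m

@[fun_prop]
theorem PT.prodMk {f : α → β} {g : α → γ} (hf : PT f) (hg : PT g) : PT (fun a => (f a, g a)) := by
  obtain ⟨F, p, hF⟩ := hf
  obtain ⟨G, q, hG⟩ := hg
  refine ⟨seq dupF (seq G (seq swapF (seq F (pushF one)))),
    6 * .X + 9 + p + 3 * q, fun a => ⟨?_, fun m => ?_⟩⟩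
  · have h1 := (hF a).1
    have h2 := (hG a).1
    simp only [size_pair, Polynomial.eval_add, Polynomial.eval_mul, Polynomial.eval_X,
      Polynomial.eval_ofNat]
    omega
  · have h1 := exec_dupF (enc a) m
    have h2 := (hG a).2 ((enc a).word ++ m)
    have h3 := exec_swapF (enc (g a)) (enc a) m
    have h4 := (hF a).2 ((enc (g a)).word ++ m)
    have h5 := exec_pushF one ((enc (f a)).word ++ ((enc (g a)).word ++ m)) [] [] []
    refine ((h1.seq (h2.seq (h3.seq (h4.seq (by simpa [BTree.word] using h5))))).mono ?_)
    have h6 := (hG a).1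
    simp only [Polynomial.eval_add, Polynomial.eval_mul, Polynomial.eval_X,
      Polynomial.eval_ofNat]
    simp only [size] at *
    omega

theorem PT.fst' : PT (fun x : α × β => x.1) := by
  refine ⟨seq popF (seq swapF dropF), 5 * .X + 8, fun x => ⟨?_, fun m => ?_⟩⟩
  · obtain ⟨a, b⟩ := x
    simp only [size_pair, Polynomial.eval_add, Polynomial.eval_mul, Polynomial.eval_X,
      Polynomial.eval_ofNat]
    omega
  · obtain ⟨a, b⟩ := x
    have h1 := exec_popF one ((enc a).word ++ ((enc b).word ++ m)) [] [] []
    have h2 := exec_swapF (enc a) (enc b) m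
    have h3 := exec_dropF (enc b) ((enc a).word ++ m)
    refine Exec.mono (k := _) (by simpa [BTree.word] using h1.seq (h2.seq h3)) ?_
    simp only [size_pair, Polynomial.eval_add, Polynomial.eval_mul, Polynomial.eval_X,
      Polynomial.eval_ofNat]
    simp only [size] at *
    omega

theorem PT.snd' : PT (fun x : α × β => x.2) := by
  refine ⟨seq popF dropF, 5 * .X + 8, fun x => ⟨?_, fun m => ?_⟩⟩
  · obtain ⟨a, b⟩ := x
    simp only [size_pair, Polynomial.eval_add, Polynomial.eval_mul, Polynomial.eval_X,
      Polynomial.eval_ofNat]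
    omega
  · obtain ⟨a, b⟩ := x
    have h1 := exec_popF one ((enc a).word ++ ((enc b).word ++ m)) [] [] []
    have h2 := exec_dropF (enc a) ((enc b).word ++ m)
    refine Exec.mono (k := _) (by simpa [BTree.word] using h1.seq h2) ?_
    simp only [size_pair, Polynomial.eval_add, Polynomial.eval_mul, Polynomial.eval_X,
      Polynomial.eval_ofNat]
    simp only [size] at *
    omega

instance : Enc BTree := ⟨fun t => t⟩

theorem PT.const_tree (t : BTree) : PT (fun _ : α => t) := by
  induction t with
  | nil =>
    refine ⟨seq dropF (pushF zero), 2 * .X + 3, fun a => ⟨?_, fun m => ?_⟩⟩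
    · simp only [Polynomial.eval_add, Polynomial.eval_mul, Polynomial.eval_X,
        Polynomial.eval_ofNat]
      have : size BTree.nil = 1 := rfl
      omega
    · refine ((exec_dropF (enc a) m).seq (exec_pushF zero m [] [] [])).mono ?_
      simp only [Polynomial.eval_add, Polynomial.eval_mul, Polynomial.eval_X,
        Polynomial.eval_ofNat]
      simp only [size]
      omega
  | node l r hl hr =>
    obtain ⟨F, p, h⟩ := hl.prodMk hr
    exact ⟨F, p, h⟩

@[fun_prop]
theorem PT.const (b : β) : PT (fun _ : α => b) := by
  obtain ⟨F, p, h⟩ := PT.const_tree (α := α) (enc b)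
  exact ⟨F, p, h⟩

@[fun_prop]
theorem PT.fst {f : α → β × γ} (hf : PT f) : PT (fun a => (f a).1) := PT.fst'.comp hf
@[fun_prop]
theorem PT.snd {f : α → β × γ} (hf : PT f) : PT (fun a => (f a).2) := PT.snd'.comp hf

/-- Case distinction on whether the encoding of a value is `nil`. Otherwise the program for the
second case is run on the pair `(l a, a)`, possibly seen as an element of another type. -/
theorem PT.case_nil {l : α → β} {f g : α → γ} {G : δ → γ} (hl : PT l) (hf : PT f) (hG : PT G)
    (h0 : ∀ a, enc (l a) = .nil → g a = f a)
    (h1 : ∀ a, enc (l a) ≠ .nil → ∃ x, enc x = enc (l a, a) ∧ g a = G x) : PT g := by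
  obtain ⟨E, r, hE⟩ := hl.prodMk PT.id
  obtain ⟨F, p, hF⟩ := hf
  obtain ⟨G', q, hG'⟩ := hG
  refine ⟨seq E (caseF F G'), r + p + q.comp r + 1, fun a => ?_⟩
  have hE1 := (hE a).1
  have hE2 := (hE a).2
  cases hla : enc (l a) with
  | nil =>
    rw [h0 a hla]
    refine ⟨(hF a).1.trans ?_, fun m => ?_⟩
    · simp only [Polynomial.eval_add, Polynomial.eval_one]
      omega
    · have h2 := hE2 m
      simp only [enc_pair, hla] at h2
      refine (h2.seq (exec_caseF_nil _ _ ((hF a).2 m))).mono ?_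
      simp only [Polynomial.eval_add, Polynomial.eval_one]
      omega
  | node t u =>
    obtain ⟨x, hx, hgx⟩ := h1 a (by rw [hla]; simp)
    rw [hgx]
    have h3 : q.eval (size x) ≤ (q.comp r).eval (size a) := by
      rw [Polynomial.eval_comp]
      refine q.eval_mono_nat (le_trans (le_of_eq ?_) hE1)
      simp only [size, hx]
    refine ⟨(hG' _).1.trans ?_, fun m => ?_⟩
    · simp only [Polynomial.eval_add, Polynomial.eval_one]
      omega
    · have h2 := hE2 m
      have h4 := (hG' x).2 m
      simp only [hx, enc_pair, hla] at h2 h4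
      refine (h2.seq (exec_caseF_node _ _ _ _ h4)).mono ?_
      simp only [Polynomial.eval_add, Polynomial.eval_one]
      omega

@[fun_prop]
theorem PT.cond {b : α → Bool} {f g : α → γ} (hb : PT b) (hf : PT f) (hg : PT g) :
    PT (fun a => bif b a then f a else g a) := by
  refine PT.case_nil hb hg (hf.comp (PT.snd' (α := Bool))) ?_ ?_
  · intro a h; cases hba : b a <;> simp_all
  · intro a h
    refine ⟨(b a, a), rfl, ?_⟩
    cases hba : b a <;> simp_all

@[fun_prop]
theorem PT.ite {P : α → Prop} [DecidablePred P] {f g : α → γ} (hb : PT (fun a => decide (P a)))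
    (hf : PT f) (hg : PT g) : PT (fun a => if P a then f a else g a) := by
  simpa [Bool.cond_decide] using PT.cond hb hf hg

@[fun_prop]
theorem PT.list_case {l : α → List β} {f : α → γ} {G : α → β → List β → γ} (hl : PT l)
    (hf : PT f) (hG : PT (fun x : α × β × List β => G x.1 x.2.1 x.2.2)) :
    PT (fun a => match l a with | [] => f a | b :: t => G a b t) := by
  have key : PT (fun x : (β × List β) × α => G x.2 x.1.1 x.1.2) :=
    hG.comp (PT.prodMk PT.snd' PT.fst')
  refine PT.case_nil hl hf key ?_ ?_
  · intro a h
    cases hla : l a <;> simp_all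
  · intro a h
    cases hla : l a with
    | nil => simp_all
    | cons b t => exact ⟨((b, t), a), by simp, rfl⟩

@[fun_prop]
theorem PT.cons {f : α → β} {g : α → List β} (hf : PT f) (hg : PT g) :
    PT (fun a => f a :: g a) :=
  (PT.of_enc (f := fun x : β × List β => x.1 :: x.2) fun _ => rfl).comp (hf.prodMk hg)

end

end StackProgram

namespace StackProgram

open Enc

section

variable {α β γ δ σ : Type} [Enc α] [Enc β] [Enc γ] [Enc δ] [Enc σ]

/-- `f a` is bounded by a polynomial in the size of `a`. -/
@[fun_prop]
def PBound (f : α → ℕ) : Prop := ∃ p : Polynomial ℕ, ∀ a, f a ≤ p.eval (size a)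

@[fun_prop]
theorem PBound.const (n : ℕ) : PBound (fun _ : α => n) := ⟨.C n, by simp⟩

@[fun_prop]
theorem PBound.add {f g : α → ℕ} (hf : PBound f) (hg : PBound g) : PBound (fun a => f a + g a) := by
  obtain ⟨p, hp⟩ := hf
  obtain ⟨q, hq⟩ := hg
  exact ⟨p + q, fun a => by simpa using add_le_add (hp a) (hq a)⟩

@[fun_prop]
theorem PBound.mul {f g : α → ℕ} (hf : PBound f) (hg : PBound g) : PBound (fun a => f a * g a) := by
  obtain ⟨p, hp⟩ := hf
  obtain ⟨q, hq⟩ := hg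
  exact ⟨p * q, fun a => by simpa using Nat.mul_le_mul (hp a) (hq a)⟩

@[fun_prop]
theorem PT.pbound {f : α → β} (hf : PT f) : PBound (fun a => size (f a)) := hf.size_le

theorem PBound.mono {f g : α → ℕ} (hg : PBound g) (h : ∀ a, f a ≤ g a) : PBound f :=
  let ⟨p, hp⟩ := hg
  ⟨p, fun a => (h a).trans (hp a)⟩

theorem PBound.size_self : PBound (fun a : α => size a) := PT.id.pbound

/-- A polynomial bound on the size of a value in terms of the size of another one. -/
theorem PT.size_le_of {f : α → β} (hf : PT f) :
    ∃ q : ℕ → ℕ, Monotone q ∧ (∀ a, size (f a) ≤ q (size a)) ∧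
      ∀ {γ : Type} [Enc γ] {g : γ → ℕ}, PBound g → PBound (fun c => q (g c)) := by
  obtain ⟨p, hp⟩ := hf.size_le
  refine ⟨fun n => p.eval n, p.eval_mono_nat, hp, ?_⟩
  intro γ _ g ⟨r, hr⟩
  exact ⟨p.comp r, fun c => by rw [Polynomial.eval_comp]; exact p.eval_mono_nat (hr c)⟩

/-- Iteration of a polynomial-time step as long as it returns the flag `true`, provided that the
number of rounds and the sizes of the intermediate values are polynomially bounded. -/
theorem PT.loop {g : σ → Bool × σ} (hg : PT g) {init f : α → σ} (hi : PT init) (N B : α → ℕ)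
    (T : α → ℕ → σ) (hN : PBound N) (hB : PBound B) (h0 : ∀ a, T a 0 = init a)
    (hT : ∀ a, ∀ i < N a, g (T a i) = (true, T a (i + 1)))
    (hf : ∀ a, g (T a (N a)) = (false, f a))
    (hs : ∀ a, ∀ i ≤ N a, size (T a i) ≤ B a) : PT f := by
  obtain ⟨E, r, hE⟩ := hi
  obtain ⟨G, q, hG⟩ := hg
  obtain ⟨pN, hpN⟩ := hN
  obtain ⟨pB, hpB⟩ := hB
  refine ⟨seq E (loopF G), r + (pN + 1) * (q.comp pB + 1), fun a => ⟨?_, fun m => ?_⟩⟩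
  · have h1 := (hG (T a (N a))).1
    rw [hf] at h1
    have h2 := q.eval_mono_nat ((hs a _ le_rfl).trans (hpB a))
    simp only [size_pair] at h1
    simp only [Polynomial.eval_add, Polynomial.eval_mul, Polynomial.eval_one, Polynomial.eval_comp]
    nlinarith [Nat.zero_le (Polynomial.eval (size a) pN),
      Nat.zero_le (Polynomial.eval (Polynomial.eval (size a) pB) q)]
  · set K := q.eval (pB.eval (size a)) + 1 with hK
    have key : ∀ j, ∀ i, i + j = N a → Exec (loopF G) (st ((enc (T a i)).word ++ m) [] [] [])
        (st ((enc (f a)).word ++ m) [] [] []) ((j + 1) * K) := by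
      intro j
      induction j with
      | zero =>
        intro i hij
        have h1 := (hG (T a i)).2 m
        rw [show i = N a from hij, hf] at h1
        rw [show i = N a from hij]
        refine (exec_loopF_exit _ _ h1).mono ?_
        rw [zero_add, one_mul, hK]
        exact Nat.add_le_add_right (q.eval_mono_nat ((hs a _ le_rfl).trans (hpB a))) 1
      | succ j ih =>
        intro i hij
        have h1 := (hG (T a i)).2 m
        rw [hT a i (by omega)] at h1
        refine (exec_loopF_continue _ _ h1 (ih (i + 1) (by omega))).mono ?_
        have h2 := q.eval_mono_nat ((hs a i (by omega)).trans (hpB a))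
        rw [show (j + 1 + 1) * K = K + (j + 1) * K by ring, hK]
        simp only at h2
        omega
    have h1 := (hE a).2 m
    rw [← h0] at h1
    refine (h1.seq (key (N a) 0 (by omega))).mono ?_
    simp only [Polynomial.eval_add, Polynomial.eval_mul, Polynomial.eval_one, Polynomial.eval_comp]
    exact Nat.add_le_add_left (Nat.mul_le_mul_right _ (by simpa using hpN a)) _

theorem length_le_size (l : List α) : l.length ≤ size l := by
  induction l with
  | nil => simp
  | cons a l ih => simp; omega

theorem size_le_of_mem {a : α} {l : List α} (h : a ∈ l) : size a ≤ size l := by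
  induction l with
  | nil => simp at h
  | cons b l ih =>
    rcases List.mem_cons.1 h with rfl | h
    · simp; omega
    · have := ih h
      simp; omega

theorem size_drop_le (l : List α) (i : ℕ) : size (l.drop i) ≤ size l := by
  induction l generalizing i with
  | nil => simp
  | cons a l ih =>
    cases i with
    | zero => simp
    | succ i => have := ih i; simp; omega

theorem size_list_le {l : List α} {b : ℕ} (h : ∀ a ∈ l, size a ≤ b) :
    size l ≤ l.length * (b + 1) + 1 := by
  induction l with
  | nil => simp
  | cons a l ih =>
    have h1 := ih fun x hx => h x (by simp [hx])
    have h2 := h a (by simp)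
    simp only [size_list_cons, List.length_cons]
    nlinarith

theorem size_append_le (l l' : List α) : size (l ++ l') ≤ size l + size l' := by
  induction l with
  | nil => simp
  | cons b l ih => simp; omega

/-- Folds over lists, for a loop invariant that bounds the size of the accumulator. -/
theorem PT.foldl_of_inv {l : α → List β} {s₀ : α → σ} {F : α → σ → β → σ} (hl : PT l) (hs : PT s₀)
    (hF : PT (fun x : α × σ × β => F x.1 x.2.1 x.2.2)) (Inv : α → ℕ → σ → Prop) (B : α → ℕ)
    (hB : PBound B) (h0 : ∀ a, Inv a 0 (s₀ a))
    (hstep : ∀ a i s b, b ∈ l a → Inv a i s → Inv a (i + 1) (F a s b))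
    (hsize : ∀ a i s, i ≤ (l a).length → Inv a i s → size s ≤ B a) :
    PT (fun a => (l a).foldl (F a) (s₀ a)) := by
  let g : α × σ × List β → Bool × α × σ × List β := fun x =>
    match x.2.2 with
    | [] => (false, x)
    | b :: t => (true, x.1, F x.1 x.2.1 b, t)
  have hg : PT g := by
    refine PT.list_case (l := fun x : α × σ × List β => x.2.2) (f := fun x => (false, x))
      (G := fun x b t => (true, x.1, F x.1 x.2.1 b, t)) (by fun_prop) (by fun_prop) ?_
    have h1 : PT (fun x : (α × σ × List β) × β × List β => F x.1.1 x.1.2.1 x.2.1) :=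
      hF.comp (f := fun x : (α × σ × List β) × β × List β => (x.1.1, x.1.2.1, x.2.1))
        (by fun_prop)
    fun_prop
  let T : α → ℕ → α × σ × List β := fun a i =>
    (a, ((l a).take i).foldl (F a) (s₀ a), (l a).drop i)
  have hinv : ∀ a, ∀ i ≤ (l a).length, Inv a i (((l a).take i).foldl (F a) (s₀ a)) := by
    intro a i
    induction i with
    | zero => intro _; simpa using h0 a
    | succ i ih =>
      intro hi
      rw [List.take_succ_eq_append_getElem (by omega), List.foldl_append]
      exact hstep a i _ _ (List.getElem_mem _) (ih (by omega))
  have : PT (fun a => (a, (l a).foldl (F a) (s₀ a), ([] : List β))) := by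
    refine PT.loop hg (init := fun a => (a, s₀ a, l a)) (by fun_prop) (fun a => (l a).length)
      (fun a => size a + (B a + size (l a) + 1) + 1) T
      (hl.pbound.mono fun a => length_le_size _) ?_ ?_ ?_ ?_ ?_
    · have := PBound.size_self (α := α)
      fun_prop
    · intro a; simp [T]
    · intro a i hi
      simp only [T, g]
      rw [List.drop_eq_getElem_cons hi]
      simp only
      rw [List.take_succ_eq_append_getElem hi, List.foldl_append]
      rfl
    · intro a
      simp [T, g]
    · intro a i hi
      have h1 := hsize a i _ hi (hinv a i hi)
      have h2 := size_drop_le (l a) i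
      simp only [T, size_pair]
      omega
  exact this.snd.fst

/-- Folds in which each step enlarges the accumulator by a polynomially bounded amount only. -/
theorem PT.foldl {l : α → List β} {s₀ : α → σ} {F : α → σ → β → σ} (hl : PT l) (hs : PT s₀)
    (hF : PT (fun x : α × σ × β => F x.1 x.2.1 x.2.2)) (C : α → ℕ) (hC : PBound C)
    (h : ∀ a s, ∀ b ∈ l a, size (F a s b) ≤ size s + C a) :
    PT (fun a => (l a).foldl (F a) (s₀ a)) := by
  refine PT.foldl_of_inv hl hs hF (fun a i s => size s ≤ size (s₀ a) + i * C a)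
    (fun a => size (s₀ a) + size (l a) * C a) (by fun_prop) (by simp) ?_ ?_
  · intro a i s b hb hi
    have := h a s b hb
    rw [add_mul]
    omega
  · intro a i s hi h1
    refine h1.trans (Nat.add_le_add_left (Nat.mul_le_mul_right _ ?_) _)
    exact hi.trans (length_le_size _)

@[fun_prop]
theorem PT.reverse {l : α → List β} (hl : PT l) : PT (fun a => (l a).reverse) := by
  have := PT.foldl (F := fun (_ : α) (s : List β) b => b :: s) hl (PT.const []) (by fun_prop)
    (fun a => size (l a) + 1) (by fun_prop) (fun a s b hb => by
      have := size_le_of_mem hb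
      simp; omega)
  simpa using this

@[fun_prop]
theorem PT.append {l l' : α → List β} (hl : PT l) (hl' : PT l') : PT (fun a => l a ++ l' a) := by
  have := PT.foldl (F := fun (_ : α) (s : List β) b => b :: s) hl.reverse hl' (by fun_prop)
    (fun a => size (l a) + 1) (by fun_prop) (fun a s b hb => by
      have := size_le_of_mem (List.mem_reverse.1 hb)
      simp; omega)
  simpa using this

/-- Folds from the right, for a loop invariant that bounds the size of the accumulator. -/
theorem PT.foldr_of_inv {l : α → List β} {s₀ : α → σ} {F : α → β → σ → σ} (hl : PT l) (hs : PT s₀)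
    (hF : PT (fun x : α × β × σ => F x.1 x.2.1 x.2.2)) (Inv : α → ℕ → σ → Prop) (B : α → ℕ)
    (hB : PBound B) (h0 : ∀ a, Inv a 0 (s₀ a))
    (hstep : ∀ a i s b, b ∈ l a → Inv a i s → Inv a (i + 1) (F a b s))
    (hsize : ∀ a i s, i ≤ (l a).length → Inv a i s → size s ≤ B a) :
    PT (fun a => (l a).foldr (F a) (s₀ a)) := by
  have h1 : PT (fun x : α × σ × β => F x.1 x.2.2 x.2.1) :=
    hF.comp (f := fun x : α × σ × β => (x.1, x.2.2, x.2.1)) (by fun_prop)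
  have := PT.foldl_of_inv (F := fun a s b => F a b s) hl.reverse hs h1 Inv B hB h0
    (fun a i s b hb => hstep a i s b (List.mem_reverse.1 hb))
    (fun a i s hi => hsize a i s (by simpa using hi))
  simpa using this

theorem PT.foldr {l : α → List β} {s₀ : α → σ} {F : α → β → σ → σ} (hl : PT l) (hs : PT s₀)
    (hF : PT (fun x : α × β × σ => F x.1 x.2.1 x.2.2)) (C : α → ℕ) (hC : PBound C)
    (h : ∀ a s, ∀ b ∈ l a, size (F a b s) ≤ size s + C a) :
    PT (fun a => (l a).foldr (F a) (s₀ a)) := by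
  have h1 : PT (fun x : α × σ × β => F x.1 x.2.2 x.2.1) :=
    hF.comp (f := fun x : α × σ × β => (x.1, x.2.2, x.2.1)) (by fun_prop)
  have := PT.foldl (F := fun a s b => F a b s) hl.reverse hs h1 C hC
    (fun a s b hb => h a s b (List.mem_reverse.1 hb))
  simpa using this

@[fun_prop]
theorem PT.flatMap {l : α → List β} {F : α → β → List γ} (hl : PT l)
    (hF : PT (fun x : α × β => F x.1 x.2)) : PT (fun a => (l a).flatMap (F a)) := by
  obtain ⟨q, hq, hq1, hq2⟩ := hF.size_le_of
  have h1 : PT (fun x : α × β × List γ => F x.1 x.2.1) :=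
    hF.comp (f := fun x : α × β × List γ => (x.1, x.2.1)) (by fun_prop)
  have := PT.foldr (F := fun a b s => F a b ++ s) hl (PT.const []) (by fun_prop)
    (fun a => q (size a + size (l a) + 1))
    (hq2 (by have := PBound.size_self (α := α); fun_prop)) (fun a s b hb => by
      have h2 := size_append_le (F a b) s
      have h3 := hq1 (a, b)
      have h4 : q (size (a, b)) ≤ q (size a + size (l a) + 1) := by
        apply hq
        have := size_le_of_mem hb
        simp; omega
      simp only at h3
      omega)
  convert this using 2 with a
  induction l a <;> simp_all

@[fun_prop]
theorem PT.map {l : α → List β} {F : α → β → γ} (hl : PT l)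
    (hF : PT (fun x : α × β => F x.1 x.2)) : PT (fun a => (l a).map (F a)) := by
  have := PT.flatMap (F := fun a b => [F a b]) hl (by fun_prop)
  convert this using 2 with a
  induction l a <;> simp_all

@[fun_prop]
theorem PT.filter {l : α → List β} {F : α → β → Bool} (hl : PT l)
    (hF : PT (fun x : α × β => F x.1 x.2)) : PT (fun a => (l a).filter (F a)) := by
  have := PT.flatMap (F := fun a b => bif F a b then [b] else []) hl (by fun_prop)
  convert this using 2 with a
  induction l a with
  | nil => simp
  | cons b l ih => cases h : F a b <;> simp_all

@[fun_prop]
theorem PT.tail {l : α → List β} (hl : PT l) : PT (fun a => (l a).tail) := by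
  have := PT.list_case (f := fun _ => []) (G := fun _ _ t => t) hl (PT.const []) (by fun_prop)
  convert this using 2 with a
  cases l a <;> rfl

@[fun_prop]
theorem PT.headD {l : α → List β} {d : α → β} (hl : PT l) (hd : PT d) :
    PT (fun a => (l a).headD (d a)) := by
  have := PT.list_case (f := d) (G := fun _ b _ => b) hl hd (by fun_prop)
  convert this using 2 with a
  cases l a <;> rfl

@[fun_prop]
theorem PT.not {f : α → Bool} (hf : PT f) : PT (fun a => !f a) := by
  have := hf.cond (PT.const false) (PT.const true)
  convert this using 2 with a
  cases f a <;> rfl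

@[fun_prop]
theorem PT.and {f g : α → Bool} (hf : PT f) (hg : PT g) : PT (fun a => f a && g a) := by
  have := hf.cond hg (PT.const false)
  convert this using 2 with a
  cases f a <;> rfl

@[fun_prop]
theorem PT.or {f g : α → Bool} (hf : PT f) (hg : PT g) : PT (fun a => f a || g a) := by
  have := hf.cond (PT.const true) hg
  convert this using 2 with a
  cases f a <;> rfl

@[fun_prop]
theorem PT.isEmpty {l : α → List β} (hl : PT l) : PT (fun a => (l a).isEmpty) := by
  have := PT.list_case (f := fun _ => true) (G := fun _ _ _ => false) hl (PT.const _) (by fun_prop)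
  convert this using 2 with a
  cases l a <;> rfl

/-- Natural numbers are encoded in unary; they serve as indices and counters. -/
instance : Enc ℕ := ⟨fun n => enc (List.replicate n ())⟩

theorem size_nat (n : ℕ) : size n = 2 * n + 1 := by
  change size (List.replicate n ()) = _
  induction n with
  | zero => rfl
  | succ n ih =>
    rw [List.replicate_succ, size_list_cons, ih]
    change 1 + _ + 1 = _
    omega

@[fun_prop]
theorem PT.replicate_unit {f : α → ℕ} (hf : PT f) : PT (fun a => List.replicate (f a) ()) :=
  (PT.of_enc (f := fun n : ℕ => List.replicate n ()) fun _ => rfl).comp hf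

@[fun_prop]
theorem PT.length {l : α → List β} (hl : PT l) : PT (fun a => (l a).length) := by
  have h1 : PT (fun l : List Unit => l.length) := PT.of_enc fun l => by
    change enc (List.replicate l.length ()) = _
    rw [List.eq_replicate_of_mem (l := l) (a := ()) (fun _ _ => rfl)]
    simp
  have h2 : PT (fun a => (l a).map fun _ => ()) := by fun_prop
  simpa using h1.comp h2

@[fun_prop]
theorem PT.succ {f : α → ℕ} (hf : PT f) : PT (fun a => f a + 1) := by
  have := (PT.cons (PT.const ()) hf.replicate_unit).length
  simpa using this

@[fun_prop]
theorem PT.drop {f : α → ℕ} {l : α → List β} (hf : PT f) (hl : PT l) :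
    PT (fun a => (l a).drop (f a)) := by
  have := PT.foldl (l := fun a => List.replicate (f a) ()) (s₀ := l)
    (F := fun _ s _ => s.tail) (by fun_prop) hl (by fun_prop) (fun _ => 0) (by fun_prop)
    (fun a s b hb => by simpa using size_drop_le s 1)
  convert this using 2 with a
  generalize f a = n
  generalize l a = s
  induction n generalizing s with
  | zero => simp
  | succ n ih => simp [List.replicate_succ, ← ih]

@[fun_prop]
theorem PT.getD {f : α → ℕ} {l : α → List β} {d : α → β} (hf : PT f) (hl : PT l) (hd : PT d) :
    PT (fun a => (l a).getD (f a) (d a)) := by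
  have : PT (fun a => ((l a).drop (f a)).headD (d a)) := by fun_prop
  convert this using 2 with a
  simp [List.headD_eq_head?_getD, List.head?_drop, List.getD_eq_getElem?_getD]

@[fun_prop]
theorem PT.sub {f g : α → ℕ} (hf : PT f) (hg : PT g) : PT (fun a => f a - g a) := by
  have : PT (fun a => ((List.replicate (f a) ()).drop (g a)).length) := by fun_prop
  simpa using this

@[fun_prop]
theorem PT.decide_nat_eq {f g : α → ℕ} (hf : PT f) (hg : PT g) :
    PT (fun a => decide (f a = g a)) := by
  have : PT (fun a => ((List.replicate (f a - g a) ()).isEmpty) &&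
    ((List.replicate (g a - f a) ()).isEmpty)) := by fun_prop
  convert this using 2 with a
  rw [Bool.eq_iff_iff]
  simp
  omega

@[fun_prop]
theorem PT.range {f : α → ℕ} (hf : PT f) : PT (fun a => List.range (f a)) := by
  have : PT (fun a => (List.replicate (f a) ()).foldl (fun s _ => s ++ [s.length]) []) := by
    refine PT.foldl_of_inv (F := fun (_ : α) (s : List ℕ) (_ : Unit) => s ++ [s.length])
      (by fun_prop) (by fun_prop) (by fun_prop)
      (fun a i s => s = List.range i) (fun a => size (f a) * (size (f a) + 1) + 1)
      (by fun_prop) (by simp) ?_ ?_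
    · rintro a i s b hb rfl
      simp [List.range_succ]
    · rintro a i s hi rfl
      simp only [List.length_replicate] at hi
      have h1 := size_list_le (l := List.range i) (b := size (f a)) (fun j hj => by
        have := List.mem_range.1 hj
        simp only [size_nat]; omega)
      refine h1.trans ?_
      have : i ≤ size (f a) := by rw [size_nat]; omega
      simp only [List.length_range]
      gcongr
  convert this using 2 with a
  generalize f a = n
  induction n with
  | zero => simp
  | succ n ih => rw [List.range_succ, List.replicate_succ', List.foldl_append, ← ih]; simp

@[fun_prop]
theorem PT.contains {f : α → ℕ} {l : α → List ℕ} (hf : PT f) (hl : PT l) :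
    PT (fun a => decide (f a ∈ l a)) := by
  have : PT (fun a => !((l a).filter fun x => decide (f a = x)).isEmpty) := by fun_prop
  convert this using 2 with a
  rw [Bool.eq_iff_iff]
  simp [List.filter_eq_nil_iff]

end

end StackProgram

/-! ### Arithmetic with binary numbers and fractions -/

namespace StackProgram

open Enc

section

variable {α β γ δ σ : Type} [Enc α] [Enc β] [Enc γ] [Enc δ] [Enc σ]

theorem PT.congr_enc {f : α → β} {g : α → γ} (hg : PT g) (h : ∀ a, enc (f a) = enc (g a)) :
    PT f := by
  obtain ⟨F, p, hF⟩ := hg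
  refine ⟨F, p, fun a => ⟨?_, fun m => ?_⟩⟩
  · simpa [size, h] using (hF a).1
  · rw [h]; exact (hF a).2 m

/-- A natural number that is encoded in binary. -/
@[ext]
structure Bin where
  /-- the number -/
  val : ℕ

instance : Enc Bin := ⟨fun x => enc x.val.bits⟩

@[fun_prop]
theorem PT.bits {f : α → Bin} (hf : PT f) : PT (fun a => (f a).val.bits) :=
  hf.congr_enc fun _ => rfl

/-- The sum of binary numbers. -/
def Bin.add (x y : Bin) : Bin := ⟨x.val + y.val⟩

/-- The product of binary numbers. -/
def Bin.mul (x y : Bin) : Bin := ⟨x.val * y.val⟩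

/-- The comparison of binary numbers. -/
def Bin.le (x y : Bin) : Bool := decide (x.val ≤ y.val)

/-- The number with the given binary digits, least significant digit first. -/
def ofBits (l : List Bool) : ℕ := l.foldr Nat.bit 0

@[simp] theorem ofBits_nil : ofBits [] = 0 := rfl

@[simp] theorem ofBits_cons (b : Bool) (l : List Bool) :
    ofBits (b :: l) = 2 * ofBits l + b.toNat := by
  simp [ofBits, Nat.bit_val]

theorem ofBits_append (l l' : List Bool) :
    ofBits (l ++ l') = ofBits l + 2 ^ l.length * ofBits l' := by
  induction l with
  | nil => simp
  | cons b l ih => simp [ih, pow_succ]; ring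

theorem ofBits_bits (n : ℕ) : ofBits n.bits = n := by
  induction n using Nat.binaryRec' with
  | zero => simp
  | bit b n h ih => rw [Nat.bits_append_bit n b h, ofBits_cons, ih, Nat.bit_val]

theorem ofBits_lt (l : List Bool) : ofBits l < 2 ^ l.length := by
  induction l with
  | nil => simp
  | cons b l ih =>
    simp only [ofBits_cons, List.length_cons, pow_succ]
    cases b <;> simp <;> omega

theorem bits_bit (b : Bool) (n : ℕ) :
    (Nat.bit b n).bits = bif !b && n.bits.isEmpty then [] else b :: n.bits := by
  by_cases h : n = 0 → b = true
  · rw [Nat.bits_append_bit n b h]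
    cases b
    · have hn : n ≠ 0 := fun h0 => by simpa using h h0
      have : n.bits ≠ [] := fun h0 => hn (by rw [← ofBits_bits n, h0]; rfl)
      cases h1 : n.bits <;> simp_all
    · simp
  · push Not at h
    obtain ⟨rfl, h⟩ := h
    cases b <;> simp_all

@[fun_prop]
theorem PT.bit {f : α → Bool} {g : α → Bin} (hf : PT f) (hg : PT g) :
    PT (fun a => Bin.mk (Nat.bit (f a) (g a).val)) := by
  have : PT (fun a => bif !(f a) && (g a).val.bits.isEmpty then [] else f a :: (g a).val.bits) := by
    fun_prop
  refine this.congr_enc fun a => ?_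
  rw [← bits_bit]
  rfl

theorem size_bits_le (l : List Bool) : size l ≤ 4 * l.length + 1 := by
  have := size_list_le (l := l) (b := 3) (fun b _ => by cases b <;> decide)
  omega

theorem size_bin_le (x : Bin) : size x ≤ 4 * x.val.size + 1 := by
  rw [← Nat.size_eq_bits_len]
  exact size_bits_le _

theorem natSize_le (x : Bin) : x.val.size ≤ size x := by
  rw [← Nat.size_eq_bits_len]
  exact length_le_size x.val.bits

theorem natSize_add_le (m n : ℕ) : (m + n).size ≤ max m.size n.size + 1 := by
  rw [Nat.size_le, pow_succ]
  have h1 := Nat.lt_size_self m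
  have h2 := Nat.lt_size_self n
  have h3 := Nat.pow_le_pow_right (show 0 < 2 by omega) (le_max_left m.size n.size)
  have h4 := Nat.pow_le_pow_right (show 0 < 2 by omega) (le_max_right m.size n.size)
  omega

theorem natSize_mul_le (m n : ℕ) : (m * n).size ≤ m.size + n.size := by
  rw [Nat.size_le, pow_add]
  exact Nat.mul_lt_mul'' (Nat.lt_size_self m) (Nat.lt_size_self n)

@[fun_prop]
theorem PT.ofBits {l : α → List Bool} (hl : PT l) : PT (fun a => Bin.mk (ofBits (l a))) := by
  have := PT.foldr_of_inv (F := fun (_ : α) b (s : Bin) => Bin.mk (Nat.bit b s.val)) hl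
    (PT.const ⟨0⟩) (by fun_prop) (fun a i s => s.val.size ≤ i) (fun a => 4 * size (l a) + 1)
    (by fun_prop) (by simp) (fun a i s b _ hi => by
      rw [Nat.size_le] at *
      simp only [Nat.bit_val, pow_succ]
      cases b <;> simp <;> omega) (fun a i s hi hs => by
      have := size_bin_le s
      have := length_le_size (l a)
      omega)
  convert this using 2 with a
  ext
  simp only [StackProgram.ofBits]
  induction l a <;> simp_all

/-- One step of the addition of binary numbers. The state consists of the remaining digits of the
second number, the carry, and the digits of the sum in reversed order. -/
def addStep (s : List Bool × Bool × List Bool) (b : Bool) : List Bool × Bool × List Bool :=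
  let y := s.1.headD false
  let c := s.2.1
  (s.1.tail, bif b then y || c else y && c,
    (bif b then (bif y then c else !c) else (bif y then !c else c)) :: s.2.2)

theorem foldl_addStep (xs ys : List Bool) (c : Bool) (out : List Bool)
    (h : ofBits xs + ofBits ys + c.toNat < 2 ^ xs.length) :
    ofBits (xs.foldl addStep (ys, c, out)).2.2.reverse =
      ofBits out.reverse + 2 ^ out.length * (ofBits xs + ofBits ys + c.toNat) := by
  induction xs generalizing ys c out with
  | nil =>
    have : ofBits ys + c.toNat = 0 := by
      simp only [ofBits_nil, List.length_nil, pow_zero] at h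
      omega
    rw [List.foldl_nil, ofBits_nil, zero_add, this, mul_zero, add_zero]
  | cons b xs ih =>
    obtain ⟨y, ys', hy, hd, ht⟩ : ∃ y ys', ofBits ys = 2 * ofBits ys' + Bool.toNat y ∧
        ys.headD false = y ∧ ys.tail = ys' := by
      cases ys with
      | nil => exact ⟨false, [], by simp⟩
      | cons y ys => exact ⟨y, ys, by simp⟩
    rw [List.foldl_cons, addStep]
    simp only [hd, ht]
    rw [hy, ofBits_cons, List.length_cons, pow_succ] at h
    rw [ih, hy, ofBits_cons, List.reverse_cons, ofBits_append, List.length_cons,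
      List.length_reverse, pow_succ]
    · cases b <;> cases y <;> cases c <;> simp <;> ring
    · cases b <;> cases y <;> cases c <;> simp at h ⊢ <;> omega

theorem ofBits_padding (xs ys : List Bool) :
    ofBits (xs ++ ys.map fun _ => false) = ofBits xs := by
  rw [ofBits_append]
  have : ofBits (ys.map fun _ => false) = 0 := by induction ys <;> simp_all
  rw [this, mul_zero, add_zero]

@[fun_prop]
theorem PT.binAdd {f g : α → Bin} (hf : PT f) (hg : PT g) :
    PT (fun a => (f a).add (g a)) := by
  have h1 : PT (fun a => ((((f a).val.bits ++ (false :: (g a).val.bits).map fun _ => false).foldl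
      addStep ((g a).val.bits, false, [])).2.2).reverse) := by
    refine (PT.snd (PT.snd ?_)).reverse
    refine PT.foldl (F := fun _ s b => addStep s b) (by fun_prop) (by fun_prop) ?_ (fun _ => 10)
      (by fun_prop) ?_
    · unfold addStep
      fun_prop
    · rintro a ⟨ys, c, out⟩ b _
      have h1 := size_drop_le ys 1
      have h2 : ∀ b : Bool, 1 ≤ size b ∧ size b ≤ 3 := by decide
      simp only [addStep, size_pair, size_list_cons, List.drop_one] at h1 ⊢
      have h3 := (h2 c).1
      have h4 := fun d => (h2 d).2
      have h5 := h4 (bif b then ys.headD false || c else ys.headD false && c)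
      have h6 := h4 (bif b then (bif ys.headD false then c else !c) else
        (bif ys.headD false then !c else c))
      omega
  refine (PT.ofBits h1).congr_enc fun a => ?_
  simp only [Bin.add]
  congr 2
  rw [foldl_addStep]
  · rw [ofBits_padding]; simp [ofBits_bits]
  · rw [ofBits_padding, ofBits_bits, ofBits_bits]
    have h1 := ofBits_lt (f a).val.bits
    have h2 := ofBits_lt (g a).val.bits
    rw [ofBits_bits] at h1 h2
    simp only [List.length_append, List.length_map, List.length_cons, Bool.toNat_false]
    generalize (f a).val.bits.length = m at *
    generalize (g a).val.bits.length = n at *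
    have h3 : 2 ^ m ≤ 2 ^ (m + n) := Nat.pow_le_pow_right (by omega) (by omega)
    have h4 : 2 ^ n ≤ 2 ^ (m + n) := Nat.pow_le_pow_right (by omega) (by omega)
    rw [← add_assoc, pow_succ]
    omega

/-- One step of the comparison of binary numbers. The state consists of the remaining digits of the
second number and the result of the comparison of the digits read so far. -/
def leStep (s : List Bool × Bool) (b : Bool) : List Bool × Bool :=
  let y := s.1.headD false
  (s.1.tail, bif b then (bif y then s.2 else false) else (bif y then true else s.2))

theorem foldl_leStep (xs ys : List Bool) (r : Bool) (h : ys.length ≤ xs.length) :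
    (xs.foldl leStep (ys, r)).2 =
      decide (ofBits xs < ofBits ys ∨ (ofBits xs = ofBits ys ∧ r = true)) := by
  induction xs generalizing ys r with
  | nil =>
    have : ys = [] := by simpa using h
    subst this
    simp
  | cons b xs ih =>
    obtain ⟨y, ys', hy, hd, ht⟩ : ∃ y ys', ofBits ys = 2 * ofBits ys' + Bool.toNat y ∧
        ys.headD false = y ∧ ys.tail = ys' := by
      cases ys with
      | nil => exact ⟨false, [], by simp⟩
      | cons y ys => exact ⟨y, ys, by simp⟩
    rw [List.foldl_cons, leStep]
    simp only [hd, ht]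
    rw [ih _ _ (by rw [← ht]; simpa using h), hy, ofBits_cons,
      decide_eq_decide]
    cases b <;> cases y <;> cases r <;> simp <;> omega

@[fun_prop]
theorem PT.binLe {f g : α → Bin} (hf : PT f) (hg : PT g) :
    PT (fun a => (f a).le (g a)) := by
  have h1 : PT (fun a => (((f a).val.bits ++ (g a).val.bits.map fun _ => false).foldl
      leStep ((g a).val.bits, true)).2) := by
    refine PT.snd ?_
    refine PT.foldl (F := fun _ s b => leStep s b) (by fun_prop) (by fun_prop) ?_ (fun _ => 10)
      (by fun_prop) ?_
    · unfold leStep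
      fun_prop
    · rintro a ⟨ys, r⟩ b _
      have h1 := size_drop_le ys 1
      have h2 : ∀ b : Bool, size b ≤ 3 := by decide
      simp only [leStep, size_pair, List.drop_one] at h1 ⊢
      have h5 := h2 (bif b then (bif ys.headD false then r else false) else
        (bif ys.headD false then true else r))
      omega
  convert h1 using 2 with a
  rw [Bin.le, foldl_leStep _ _ _ (by simp), ofBits_padding, ofBits_bits, ofBits_bits]
  rw [decide_eq_decide]
  simp
  omega

/-- One step of the multiplication of binary numbers by the Horner scheme. -/
def mulStep (y : Bin) (b : Bool) (s : Bin) : Bin :=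
  bif b then (Bin.mk (Nat.bit false s.val)).add y else Bin.mk (Nat.bit false s.val)

theorem mulStep_val (y : Bin) (b : Bool) (s : Bin) :
    (mulStep y b s).val = 2 * s.val + b.toNat * y.val := by
  cases b <;> simp [mulStep, Bin.add, Nat.bit_val]

@[fun_prop]
theorem PT.mulStep {y : α → Bin} {b : α → Bool} {s : α → Bin} (hy : PT y) (hb : PT b) (hs : PT s) :
    PT (fun a => mulStep (y a) (b a) (s a)) :=
  PT.cond hb (PT.binAdd (PT.bit (PT.const false) hs) hy) (PT.bit (PT.const false) hs)

@[fun_prop]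
theorem PT.binMul {f g : α → Bin} (hf : PT f) (hg : PT g) :
    PT (fun a => (f a).mul (g a)) := by
  have h1 : PT (fun a => ((f a).val.bits).foldr (StackProgram.mulStep (g a)) ⟨0⟩) := by
    refine PT.foldr_of_inv (F := fun a b s => StackProgram.mulStep (g a) b s) hf.bits
      (PT.const _) ?_ (fun a i s => s.val.size ≤ i * (size (g a) + 2))
      (fun a => 4 * (size (f a) * (size (g a) + 2)) + 1) (by fun_prop) (by simp) ?_ ?_
    · have hg' : PT (fun x : α × Bool × Bin => g x.1) := hg.comp (PT.fst PT.id)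
      fun_prop
    · intro a i s b _ hi
      have h0 : (2 * s.val).size ≤ s.val.size + 1 := by
        rw [Nat.size_le, pow_succ]
        have := Nat.lt_size_self s.val
        omega
      have h2 := natSize_add_le (2 * s.val) (b.toNat * (g a).val)
      have h3 := natSize_le (g a)
      have h4 : (b.toNat * (g a).val).size ≤ (g a).val.size := by cases b <;> simp
      rw [mulStep_val, add_mul]
      omega
    · intro a i s hi hs
      refine (size_bin_le s).trans ?_
      have : i ≤ size (f a) := hi.trans (length_le_size (f a).val.bits)
      have := Nat.mul_le_mul_right (size (g a) + 2) this
      omega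
  convert h1 using 2 with a
  ext
  conv_lhs => rw [Bin.mul, ← ofBits_bits (f a).val]
  simp only
  induction (f a).val.bits with
  | nil => simp
  | cons b l ih =>
    rw [List.foldr_cons, ofBits_cons, mulStep_val, ← ih]
    ring

/-- A rational number, as a fraction that need not be in lowest terms. The numerator is given as a
difference, so that no subtraction of natural numbers is needed. -/
structure Frac where
  /-- the positive part of the numerator -/
  pos : ℕ
  /-- the negative part of the numerator -/
  neg : ℕ
  /-- the denominator -/
  den : ℕ
  den_pos : 0 < den

instance : Enc Frac := ⟨fun x => enc (Bin.mk x.pos, Bin.mk x.neg, Bin.mk x.den)⟩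

namespace Frac

/-- The value of a fraction. -/
def val (x : Frac) : ℚ := ((x.pos : ℚ) - x.neg) / x.den

theorem den_ne (x : Frac) : (x.den : ℚ) ≠ 0 := Nat.cast_ne_zero.2 x.den_pos.ne'

instance : Zero Frac := ⟨⟨0, 0, 1, one_pos⟩⟩

instance : Add Frac := ⟨fun x y =>
  ⟨x.pos * y.den + y.pos * x.den, x.neg * y.den + y.neg * x.den, x.den * y.den,
    Nat.mul_pos x.den_pos y.den_pos⟩⟩

instance : Neg Frac := ⟨fun x => ⟨x.neg, x.pos, x.den, x.den_pos⟩⟩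

@[simp] theorem val_zero : (0 : Frac).val = 0 := by
  change ((0 : ℕ) - (0 : ℕ) : ℚ) / (1 : ℕ) = 0
  simp

@[simp] theorem val_add (x y : Frac) : (x + y).val = x.val + y.val := by
  have hx := x.den_ne
  have hy := y.den_ne
  change (((x.pos * y.den + y.pos * x.den : ℕ) : ℚ) - ((x.neg * y.den + y.neg * x.den : ℕ) : ℚ)) /
    ((x.den * y.den : ℕ) : ℚ) = _
  simp only [val]
  push_cast
  field_simp
  ring

@[simp] theorem val_neg (x : Frac) : (-x).val = -x.val := by
  change ((x.neg : ℚ) - x.pos) / x.den = -(((x.pos : ℚ) - x.neg) / x.den)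
  ring

/-- Comparison of fractions by cross-multiplication. -/
def lt (x y : Frac) : Bool :=
  !decide (y.pos * x.den + x.neg * y.den ≤ x.pos * y.den + y.neg * x.den)

theorem lt_iff (x y : Frac) : lt x y = true ↔ x.val < y.val := by
  have hx : (0 : ℚ) < x.den := Nat.cast_pos.2 x.den_pos
  have hy : (0 : ℚ) < y.den := Nat.cast_pos.2 y.den_pos
  simp only [lt, Bool.not_eq_true', decide_eq_false_iff_not, not_le, val]
  rw [div_lt_div_iff₀ hx hy, ← Nat.cast_lt (α := ℚ)]
  push_cast
  constructor <;> intro h <;> nlinarith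

/-- The maximal number of binary digits of the three components. -/
def len (x : Frac) : ℕ := max x.pos.size (max x.neg.size x.den.size)

theorem len_add_le (x y : Frac) : (x + y).len ≤ x.len + y.len + 1 := by
  change max (x.pos * y.den + y.pos * x.den).size
    (max (x.neg * y.den + y.neg * x.den).size (x.den * y.den).size) ≤ _
  have h1 := natSize_add_le (x.pos * y.den) (y.pos * x.den)
  have h2 := natSize_add_le (x.neg * y.den) (y.neg * x.den)
  have h3 := natSize_mul_le x.pos y.den
  have h4 := natSize_mul_le y.pos x.den
  have h5 := natSize_mul_le x.neg y.den
  have h6 := natSize_mul_le y.neg x.den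
  have h7 := natSize_mul_le x.den y.den
  simp only [len]
  omega

theorem size_le (x : Frac) : size x ≤ 12 * x.len + 5 := by
  have h1 := size_bin_le ⟨x.pos⟩
  have h2 := size_bin_le ⟨x.neg⟩
  have h3 := size_bin_le ⟨x.den⟩
  have h4 : size x = size (Bin.mk x.pos) + (size (Bin.mk x.neg) + size (Bin.mk x.den) + 1) + 1 := by
    rw [← size_pair, ← size_pair]; rfl
  simp only [len] at *
  omega

theorem len_le_size (x : Frac) : x.len ≤ size x := by
  have h1 := natSize_le ⟨x.pos⟩
  have h2 := natSize_le ⟨x.neg⟩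
  have h3 := natSize_le ⟨x.den⟩
  have h4 : size x = size (Bin.mk x.pos) + (size (Bin.mk x.neg) + size (Bin.mk x.den) + 1) + 1 := by
    rw [← size_pair, ← size_pair]; rfl
  simp only [len] at *
  omega

/-- The sum of a list of fractions. -/
def sum (l : List Frac) : Frac := l.foldr (· + ·) 0

theorem val_sum (l : List Frac) : (sum l).val = (l.map val).sum := by
  induction l with
  | nil => simp [sum]
  | cons x l ih => simp only [sum] at ih; simp [sum, ih]

end Frac

/-- The components of a fraction as binary numbers. -/
@[irreducible]
def Frac.parts (x : Frac) : Bin × Bin × Bin := (⟨x.pos⟩, ⟨x.neg⟩, ⟨x.den⟩)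

@[fun_prop]
theorem PT.frac_parts {f : α → Frac} (hf : PT f) : PT (fun a => (f a).parts) :=
  hf.congr_enc fun _ => by rw [Frac.parts]; rfl

@[fun_prop]
theorem PT.frac_add {f g : α → Frac} (hf : PT f) (hg : PT g) : PT (fun a => f a + g a) := by
  refine PT.congr_enc (g := fun a =>
    (((f a).parts.1.mul (g a).parts.2.2).add ((g a).parts.1.mul (f a).parts.2.2),
      ((f a).parts.2.1.mul (g a).parts.2.2).add ((g a).parts.2.1.mul (f a).parts.2.2),
      (f a).parts.2.2.mul (g a).parts.2.2)) (by fun_prop) fun a => ?_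
  simp only [Frac.parts]
  rfl

@[fun_prop]
theorem PT.frac_negate {f : α → Frac} (hf : PT f) : PT (fun a => -f a) :=
  PT.congr_enc (g := fun a => ((f a).parts.2.1, (f a).parts.1, (f a).parts.2.2))
    (by fun_prop) fun a => by simp only [Frac.parts]; rfl

@[fun_prop]
theorem PT.frac_lt {f g : α → Frac} (hf : PT f) (hg : PT g) :
    PT (fun a => Frac.lt (f a) (g a)) := by
  have : PT (fun a => !(((g a).parts.1.mul (f a).parts.2.2).add
    ((f a).parts.2.1.mul (g a).parts.2.2)).le
      (((f a).parts.1.mul (g a).parts.2.2).add ((g a).parts.2.1.mul (f a).parts.2.2))) := by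
    fun_prop
  simp only [Frac.parts] at this
  exact this

@[fun_prop]
theorem PT.frac_sum {l : α → List Frac} (hl : PT l) : PT (fun a => Frac.sum (l a)) := by
  refine PT.foldr_of_inv (F := fun _ x s => x + s) hl (PT.const 0) (by fun_prop)
    (fun a i s => s.len ≤ i * (size (l a) + 1) + 1)
    (fun a => 12 * (size (l a) * (size (l a) + 1) + 1) + 5) (by fun_prop) ?_ ?_ ?_
  · intro a
    rw [zero_mul]
    decide
  · intro a i s x hx hi
    have h1 := Frac.len_add_le x s
    have h2 := x.len_le_size
    have h3 := size_le_of_mem hx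
    rw [add_mul]
    omega
  · intro a i s hi hs
    have h1 := s.size_le
    have h2 := Nat.mul_le_mul_right (size (l a) + 1) (hi.trans (length_le_size (l a)))
    omega

end

end StackProgram

/-! ### Improving an assignment along a cheapest cycle -/

namespace Assignment

open Equiv

/-- `IsPath k P`: the list `P` is a path that starts at `k` and does not repeat a vertex. The path
is listed backwards, so that `k` is the last element of `P`. -/
inductive IsPath (k : ℕ) : List ℕ → Prop
  | base : IsPath k [k]
  | step {r h : ℕ} {P : List ℕ} : IsPath k (h :: P) → r ∉ h :: P → IsPath k (r :: h :: P)

namespace IsPath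

variable {k : ℕ} {P : List ℕ}

theorem mem_base (h : IsPath k P) : k ∈ P := by
  induction h with
  | base => simp
  | step _ _ ih => exact List.mem_cons_of_mem _ ih

theorem nodup (h : IsPath k P) : P.Nodup := by
  induction h with
  | base => simp
  | step _ hr ih => exact List.nodup_cons.2 ⟨hr, ih⟩

theorem cons (h : IsPath k P) {r : ℕ} (hr : r ∉ P) : IsPath k (r :: P) := by
  cases h with
  | base => exact .step .base hr
  | step h1 h2 => exact .step (.step h1 h2) hr

/-- The part of a path up to one of its vertices. -/
theorem suffix {r : ℕ} {A B : List ℕ} (h : IsPath k (B ++ r :: A)) : IsPath k (r :: A) := by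
  induction B with
  | nil => exact h
  | cons b B ih =>
    apply ih
    rw [List.cons_append] at h
    generalize hC : B ++ r :: A = C at h
    cases h with
    | base => simp at hC
    | step h1 _ => exact h1

/-- The part of a path from one of its vertices on. -/
theorem initial {r : ℕ} {A B : List ℕ} (h : IsPath k (B ++ r :: A)) : IsPath r (B ++ [r]) := by
  induction B with
  | nil => exact .base
  | cons b B ih =>
    have h1 := h.nodup
    have hC : B ++ r :: A ≠ [] := by simp
    have h2 : IsPath k (B ++ r :: A) := by
      rw [List.cons_append] at h
      generalize B ++ r :: A = C at h hC
      cases h with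
      | base => exact absurd rfl hC
      | step h1 _ => exact h1
    refine (ih h2).cons ?_
    simp only [List.cons_append, List.nodup_cons, List.mem_append, List.mem_cons, not_or] at h1
    simp [h1.1.1, h1.1.2.1]

theorem length_le (h : IsPath k P) (hk : ∀ x ∈ P, x ≤ k) : P.length ≤ k + 1 := by
  have := (List.Nodup.subperm h.nodup (l₂ := List.range (k + 1)) fun x hx => by
    have := hk x hx
    exact List.mem_range.2 (by omega)).length_le
  simpa using this

end IsPath

/-- The cost of the edge from `a` to `b`: the change of the total weight if row `a` takes over the
column of row `b`, so that row `b` becomes free. -/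
def edgeCost (w : ℕ → ℕ → ℚ) (a b : ℕ) : ℚ := w a b - w b b

/-- The cost of a path (listed backwards). -/
def pathCost (w : ℕ → ℕ → ℚ) : List ℕ → ℚ
  | [] => 0
  | [_] => 0
  | r :: h :: P => edgeCost w h r + pathCost w (h :: P)

/-- The cost of the cycle that arises from a path by returning to its first vertex. -/
def cycleCost (w : ℕ → ℕ → ℚ) (k : ℕ) (P : List ℕ) : ℚ :=
  pathCost w P + edgeCost w (P.headD k) k

theorem pathCost_append (w : ℕ → ℕ → ℚ) (B : List ℕ) (r : ℕ) (A : List ℕ) :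
    pathCost w (B ++ r :: A) = pathCost w (B ++ [r]) + pathCost w (r :: A) := by
  induction B with
  | nil => simp [pathCost]
  | cons b B ih =>
    cases B with
    | nil => simp [pathCost]
    | cons c B =>
      simp only [List.cons_append, pathCost] at ih ⊢
      rw [ih]; ring

/-- The permutation that shifts rows along the cycle through `k` given by a path: the row at each
vertex of the path moves to the column of the next vertex. -/
def cyclePerm (k : ℕ) (P : List ℕ) : Perm ℕ := P.foldr (fun r ν => ν * swap k r) 1

theorem cyclePerm_cons (k r : ℕ) (P : List ℕ) :
    cyclePerm k (r :: P) = cyclePerm k P * swap k r := rfl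

theorem cyclePerm_of_notMem {k : ℕ} {P : List ℕ} {j : ℕ} (hk : j ≠ k) (hj : j ∉ P) :
    cyclePerm k P j = j := by
  induction P with
  | nil => rfl
  | cons r P ih =>
    simp only [List.mem_cons, not_or] at hj
    rw [cyclePerm_cons, Perm.mul_apply, swap_apply_of_ne_of_ne hk hj.1, ih hj.2]

theorem cyclePerm_base {k : ℕ} {P : List ℕ} (h : IsPath k P) : cyclePerm k P k = P.headD k := by
  cases h with
  | base => simp [cyclePerm]
  | step h1 hr =>
    rw [cyclePerm_cons, Perm.mul_apply, swap_apply_left, cyclePerm_of_notMem _ hr]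
    · rfl
    · rintro rfl; exact hr h1.mem_base

theorem cyclePerm_fix {k m : ℕ} {P : List ℕ} (hk : k < m) (hP : ∀ x ∈ P, x < m) {j : ℕ}
    (hj : m ≤ j) : cyclePerm k P j = j :=
  cyclePerm_of_notMem (by omega) fun h => by have := hP j h; omega

/-- Shifting the rows along a cycle changes the total weight by the cost of the cycle. -/
theorem sum_cyclePerm (w : ℕ → ℕ → ℚ) {k m : ℕ} {P : List ℕ} (h : IsPath k P)
    (hP : ∀ x ∈ P, x < m) :
    ∑ j ∈ Finset.range m, w (cyclePerm k P j) j =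
      ∑ j ∈ Finset.range m, w j j + cycleCost w k P := by
  induction h with
  | base => simp [cyclePerm, cycleCost, pathCost, edgeCost]
  | @step r h P h1 hr ih =>
    have hkr : k ≠ r := by rintro rfl; exact hr h1.mem_base
    have hkm : k < m := hP k (List.mem_cons_of_mem _ h1.mem_base)
    have hrm : r < m := hP r (by simp)
    have ih := ih fun x hx => hP x (List.mem_cons_of_mem _ hx)
    have e1 : cyclePerm k (h :: P) k = h := cyclePerm_base h1
    have e2 : cyclePerm k (h :: P) r = r := cyclePerm_of_notMem hkr.symm hr
    have key : ∑ j ∈ Finset.range m, (w (cyclePerm k (r :: h :: P) j) j -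
        w (cyclePerm k (h :: P) j) j) = (w r k - w h k) + (w h r - w r r) := by
      rw [← Finset.sum_subset (s₁ := {k, r})]
      · rw [Finset.sum_pair hkr, cyclePerm_cons, Perm.mul_apply, Perm.mul_apply, swap_apply_left,
          swap_apply_right, e1, e2]
      · intro x hx
        simp only [Finset.mem_insert, Finset.mem_singleton] at hx
        rcases hx with rfl | rfl <;> simpa
      · intro x _ hx
        simp only [Finset.mem_insert, Finset.mem_singleton, not_or] at hx
        rw [cyclePerm_cons k r, Perm.mul_apply, swap_apply_of_ne_of_ne hx.1 hx.2, sub_self]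
    rw [Finset.sum_sub_distrib, ih] at key
    have : cycleCost w k (r :: h :: P) =
        cycleCost w k (h :: P) + ((w r k - w h k) + (w h r - w r r)) := by
      simp only [cycleCost, pathCost, edgeCost, List.headD_cons]
      ring
    rw [this]
    linarith

/-- On the first `m` rows and columns, the identity is an assignment of minimal weight. -/
def IsOpt (w : ℕ → ℕ → ℚ) (m : ℕ) : Prop :=
  ∀ τ : Perm ℕ, (∀ j, m ≤ j → τ j = j) →
    ∑ j ∈ Finset.range m, w j j ≤ ∑ j ∈ Finset.range m, w (τ j) j

theorem IsOpt.cycleCost_nonneg {w : ℕ → ℕ → ℚ} {m : ℕ} (hw : IsOpt w m) {c : ℕ} {P : List ℕ}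
    (h : IsPath c P) (hP : ∀ x ∈ P, x < m) : 0 ≤ cycleCost w c P := by
  have h1 := hw (cyclePerm c P) fun j hj => cyclePerm_fix (hP c h.mem_base) hP hj
  rw [sum_cyclePerm w h hP] at h1
  linarith

/-- If the identity is optimal on the first `k` rows, then no permutation of the first `k + 1` rows
is better than its cycle through `k`. -/
theorem exists_cycle_le {w : ℕ → ℕ → ℚ} {k : ℕ} (hw : IsOpt w k) (τ : Perm ℕ)
    (hτ : ∀ j, k + 1 ≤ j → τ j = j) :
    ∃ P, IsPath k P ∧ (∀ x ∈ P, x ≤ k) ∧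
      ∑ j ∈ Finset.range (k + 1), w j j + cycleCost w k P ≤
        ∑ j ∈ Finset.range (k + 1), w (τ j) j := by
  -- follow the cycle of `τ` backwards from `k` until it closes
  have key : ∀ f : ℕ, ∀ h P, k + 1 ≤ f + (h :: P).length → IsPath k (h :: P) →
      (∀ x ∈ h :: P, x ≤ k) → (∀ j ∈ h :: P, j ≠ k → cyclePerm k (h :: P) j = τ j) →
      ∃ P, IsPath k P ∧ (∀ x ∈ P, x ≤ k) ∧
        ∑ j ∈ Finset.range (k + 1), w j j + cycleCost w k P ≤
          ∑ j ∈ Finset.range (k + 1), w (τ j) j := by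
    intro f
    induction f with
    | zero | succ f ih =>
      intro h P hf hpath hle hagree
      have hk := cyclePerm_base hpath
      rw [List.headD_cons] at hk
      by_cases hτk : τ k = h
      · have hagree' : ∀ j ∈ h :: P, cyclePerm k (h :: P) j = τ j := by
          intro j hj
          by_cases hjk : j = k
          · subst hjk; rw [hk, hτk]
          · exact hagree j hj hjk
        refine ⟨h :: P, hpath, hle, ?_⟩
        have hfix : ∀ j, j ∉ h :: P → cyclePerm k (h :: P) j = j := fun j hj =>
          cyclePerm_of_notMem (by rintro rfl; exact hj hpath.mem_base) hj
        -- the other cycles of `τ`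
        let τ' : Perm ℕ := τ.trans (cyclePerm k (h :: P)).symm
        have h1 : ∀ j ∈ h :: P, τ' j = j := fun j hj => by
          simp only [τ', trans_apply]
          rw [← hagree' j hj, symm_apply_apply]
        have h2 : ∀ j, j ∉ h :: P → τ' j = τ j := fun j hj => by
          simp only [τ', trans_apply]
          rw [symm_apply_eq]
          refine (hfix _ fun hmem => hj ?_).symm
          have h3 : τ' (τ j) = τ j := h1 _ hmem
          have h4 : (cyclePerm k (h :: P)).symm (τ j) ∈ h :: P := by
            by_contra hc
            have := hfix _ hc
            rw [apply_symm_apply] at this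
            exact hc (this ▸ hmem)
          have h5 := hagree' _ h4
          rw [apply_symm_apply] at h5
          rw [τ.injective h5]
          exact h4
        have h3 := hw τ' fun j hj => by
          by_cases hjP : j ∈ h :: P
          · exact h1 j hjP
          · rw [h2 j hjP]
            refine hτ j ?_
            have : j ≠ k := by rintro rfl; exact hjP hpath.mem_base
            omega
        have h4 : ∑ j ∈ Finset.range k, w j j + w k k ≤
            ∑ j ∈ Finset.range k, w (τ' j) j + w (τ' k) k := by
          rw [h1 k hpath.mem_base]; linarith
        rw [← Finset.sum_range_succ, ← Finset.sum_range_succ (fun j => w (τ' j) j)] at h4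
        have h5 := sum_cyclePerm w hpath (m := k + 1) fun x hx => by
          have := hle x hx; omega
        have h6 : ∑ j ∈ Finset.range (k + 1), w (τ j) j + ∑ j ∈ Finset.range (k + 1), w j j =
            ∑ j ∈ Finset.range (k + 1), w (cyclePerm k (h :: P) j) j +
              ∑ j ∈ Finset.range (k + 1), w (τ' j) j := by
          rw [← Finset.sum_add_distrib, ← Finset.sum_add_distrib]
          refine Finset.sum_congr rfl fun j _ => ?_
          by_cases hj : j ∈ h :: P
          · rw [hagree' j hj, h1 j hj]
          · rw [hfix j hj, h2 j hj, add_comm]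
        linarith
      · have hr1 : τ (τ.symm h) = h := apply_symm_apply _ _
        have hrP : τ.symm h ∉ h :: P := by
          intro hr
          by_cases hrk : τ.symm h = k
          · rw [hrk] at hr1; exact hτk hr1
          · have := hagree _ hr hrk
            exact hrk ((cyclePerm k (h :: P)).injective (this.trans (hr1.trans hk.symm)))
        have hrk : τ.symm h ≤ k := by
          by_contra hc
          have h7 := hτ (τ.symm h) (by omega)
          rw [hr1] at h7
          have := hle h (by simp)
          omega
        have hpath' : IsPath k (τ.symm h :: h :: P) := .step hpath hrP
        have hle' : ∀ x ∈ τ.symm h :: h :: P, x ≤ k := by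
          intro x hx
          rcases List.mem_cons.1 hx with rfl | hx
          · exact hrk
          · exact hle x hx
        first
          | -- a path has at most `k + 1` vertices
            exfalso
            have := hpath'.length_le hle'
            simp only [List.length_cons] at this hf
            omega
          | refine ih _ _ (by simp only [List.length_cons] at hf ⊢; omega) hpath' hle' ?_
            intro j hj hjk
            rw [cyclePerm_cons, Perm.mul_apply]
            by_cases hjr : j = τ.symm h
            · rw [hjr, swap_apply_right, hk, hr1]
            · rw [swap_apply_of_ne_of_ne hjk hjr]
              exact hagree j ((List.mem_cons.1 hj).resolve_left hjr) hjk
  exact key k k [] (by simp) .base (by simp) (by simp)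

/-- The lists `D r` (for `r < k`) are paths from `k` to `r` with at most `l` vertices, and they are
cheapest among these. -/
structure AreShortest (w : ℕ → ℕ → ℚ) (k l : ℕ) (D : ℕ → List ℕ) : Prop where
  isPath : ∀ r < k, IsPath k (D r)
  le : ∀ r < k, ∀ x ∈ D r, x ≤ k
  head : ∀ r < k, (D r).head? = some r
  length_le : ∀ r < k, (D r).length ≤ l
  cost_le : ∀ r < k, ∀ Q, IsPath k (r :: Q) → (∀ x ∈ Q, x ≤ k) → (r :: Q).length ≤ l →
    pathCost w (D r) ≤ pathCost w (r :: Q)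

theorem areShortest_edges (w : ℕ → ℕ → ℚ) (k : ℕ) : AreShortest w k 2 fun r => [r, k] where
  isPath r hr := .step .base (by simp; omega)
  le r hr x hx := by simp at hx; omega
  head r hr := rfl
  length_le r hr := by simp
  cost_le r hr Q hQ _ hl := by
    cases hQ with
    | base => omega
    | @step _ h P h1 h2 =>
      have hP : P = [] := by
        cases P with
        | nil => rfl
        | cons => simp at hl
      subst hP
      have : k = h := by simpa using h1.mem_base
      subst this
      exact le_rfl

/-- One round of the Bellman-Ford method. An extended path that runs into itself may be discarded:
the cycle that it closes avoids `k`, so its cost is nonnegative. -/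
theorem AreShortest.round {w : ℕ → ℕ → ℚ} {k l : ℕ} {D D' : ℕ → List ℕ} (hw : IsOpt w k)
    (hl : 2 ≤ l) (hD : AreShortest w k l D)
    (hmem : ∀ r < k, D' r = D r ∨ ∃ h < k, r ∉ D h ∧ D' r = r :: D h)
    (hmin : ∀ r < k, pathCost w (D' r) ≤ pathCost w (D r))
    (hmin' : ∀ r < k, ∀ h < k, r ∉ D h → pathCost w (D' r) ≤ pathCost w (r :: D h)) :
    AreShortest w k (l + 1) D' where
  isPath r hr := by
    rcases hmem r hr with h | ⟨h, hh, hrh, e⟩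
    · rw [h]; exact hD.isPath r hr
    · rw [e]; exact (hD.isPath h hh).cons hrh
  le r hr x hx := by
    rcases hmem r hr with h | ⟨h, hh, hrh, e⟩
    · rw [h] at hx; exact hD.le r hr x hx
    · rw [e] at hx
      rcases List.mem_cons.1 hx with rfl | hx
      · omega
      · exact hD.le h hh x hx
  head r hr := by
    rcases hmem r hr with h | ⟨h, hh, hrh, e⟩
    · rw [h]; exact hD.head r hr
    · rw [e]; rfl
  length_le r hr := by
    rcases hmem r hr with h | ⟨h, hh, hrh, e⟩
    · rw [h]; have := hD.length_le r hr; omega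
    · rw [e]; have := hD.length_le h hh; simp; omega
  cost_le r hr Q hQ hQk hQl := by
    cases hQ with
    | base => omega
    | @step _ h P h1 h2 =>
      rcases eq_or_ne h k with rfl | hhk
      · have hP : P = [] := by
          cases h1 with
          | base => rfl
          | step h3 h4 => exact absurd h3.mem_base h4
        subst hP
        exact (hmin r hr).trans (hD.cost_le r hr [h] (.step h1 h2) hQk (by simpa using hl))
      · have hh : h < k := lt_of_le_of_ne (hQk h (by simp)) hhk
        have h3 := hD.cost_le h hh P h1 (fun x hx => hQk x (by simp [hx])) (by simpa using hQl)
        obtain ⟨T, hT⟩ : ∃ T, D h = h :: T := by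
          have := hD.head h hh
          cases hDh : D h with
          | nil => simp [hDh] at this
          | cons a T => simp [hDh] at this; exact ⟨T, by rw [this]⟩
        by_cases hrD : r ∈ D h
        · obtain ⟨B, A, hBA⟩ := List.append_of_mem hrD
          have hp := hD.isPath h hh
          have hle := hD.le h hh
          have hlen := hD.length_le h hh
          rw [hBA] at hp hle hlen
          have h4 := hD.cost_le r hr A hp.suffix (fun x hx => hle x (by simp [hx]))
            (by simp only [List.length_append, List.length_cons] at hlen ⊢; omega)
          have hkA : k ∈ A := by
            have := hp.suffix.mem_base
            rcases List.mem_cons.1 this with rfl | h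
            · omega
            · exact h
          have h5 := hw.cycleCost_nonneg hp.initial fun x hx => by
            refine lt_of_le_of_ne (hle x (by simp at hx ⊢; tauto)) ?_
            rintro rfl
            have hnd := hp.nodup
            rw [List.nodup_append] at hnd
            rcases List.mem_append.1 hx with hx | hx
            · exact hnd.2.2 _ hx _ (List.mem_cons_of_mem _ hkA) rfl
            · simp at hx; omega
          have h6 : (B ++ [r]).headD r = h := by
            have : (B ++ r :: A).headD r = h := by rw [← hBA, hT]; rfl
            cases B with
            | nil => simpa using this
            | cons => simpa using this
          rw [cycleCost, h6] at h5
          have h7 := pathCost_append w B r A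
          rw [← hBA] at h7
          have h8 := hmin r hr
          simp only [pathCost]
          linarith
        · have h4 := hmin' r hr h hh hrD
          rw [hT] at h3 h4
          simp only [pathCost] at h4 ⊢
          linarith

/-- If the identity is optimal on the first `k` rows, then it becomes optimal on the first `k + 1`
rows by a shift along a cheapest cycle through `k`. -/
theorem IsOpt.succ {w : ℕ → ℕ → ℚ} {k : ℕ} (hw : IsOpt w k) {P : List ℕ} (hP : IsPath k P)
    (hPk : ∀ x ∈ P, x ≤ k)
    (hmin : ∀ Q, IsPath k Q → (∀ x ∈ Q, x ≤ k) → cycleCost w k P ≤ cycleCost w k Q) :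
    IsOpt (fun a b => w (cyclePerm k P a) b) (k + 1) := by
  intro τ hτ
  have hPk' : ∀ x ∈ P, x < k + 1 := fun x hx => Nat.lt_succ_of_le (hPk x hx)
  obtain ⟨Q, hQ, hQk, h⟩ := exists_cycle_le hw (cyclePerm k P * τ) fun j hj => by
    rw [Perm.mul_apply, hτ j hj, cyclePerm_fix (by omega) hPk' hj]
  have h1 := hmin Q hQ hQk
  have h2 := sum_cyclePerm w hP hPk'
  simp only [Perm.mul_apply] at h
  linarith

end Assignment

/-! ### The algorithm for the assignment problem -/

namespace StackProgram

open Enc Assignment Equiv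

section

variable {β : Type}

/-- The element of `b :: l` with the smallest value of `f`. -/
def argmin (f : β → Frac) (l : List β) (b : β) : β :=
  l.foldl (fun b x => bif Frac.lt (f x) (f b) then x else b) b

theorem argmin_mem (f : β → Frac) (l : List β) (b : β) : argmin f l b ∈ b :: l := by
  induction l generalizing b with
  | nil => simp [argmin]
  | cons x l ih =>
    have := ih (bif Frac.lt (f x) (f b) then x else b)
    have h2 : argmin f (x :: l) b = argmin f l (bif Frac.lt (f x) (f b) then x else b) := rfl
    rw [h2]
    cases h : Frac.lt (f x) (f b) <;> rw [h] at this <;> simp at this ⊢ <;> tauto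

theorem argmin_le (f : β → Frac) (l : List β) (b : β) :
    ∀ x ∈ b :: l, (f (argmin f l b)).val ≤ (f x).val := by
  induction l generalizing b with
  | nil => simp [argmin]
  | cons y l ih =>
    intro x hx
    have h1 := ih (bif Frac.lt (f y) (f b) then y else b)
    have h2 : argmin f (y :: l) b = argmin f l (bif Frac.lt (f y) (f b) then y else b) := rfl
    rw [h2]
    have h3 := Frac.lt_iff (f y) (f b)
    cases hlt : Frac.lt (f y) (f b) with
    | true =>
      rw [hlt] at h1 h3
      have h4 := h3.1 rfl
      rcases List.mem_cons.1 hx with rfl | hx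
      · exact (h1 _ (by simp)).trans h4.le
      · exact h1 x (by simpa using hx)
    | false =>
      rw [hlt] at h1 h3
      have h4 : (f b).val ≤ (f y).val := by
        by_contra hc
        exact absurd (h3.2 (not_le.1 hc)) (by simp)
      rcases List.mem_cons.1 hx with rfl | hx
      · exact h1 _ (by simp)
      rcases List.mem_cons.1 hx with rfl | hx
      · exact (h1 _ (by simp)).trans h4
      · exact h1 x (by simp [hx])

@[fun_prop]
theorem PT.argmin {α : Type} [Enc α] [Enc β] {f : α → β → Frac} {l : α → List β} {b : α → β}
    (hf : PT (fun x : α × β => f x.1 x.2)) (hl : PT l) (hb : PT b) :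
    PT (fun a => argmin (f a) (l a) (b a)) := by
  refine PT.foldl_of_inv (F := fun a b x => bif Frac.lt (f a x) (f a b) then x else b) hl hb ?_
    (fun a _ s => size s ≤ size (b a) + size (l a)) (fun a => size (b a) + size (l a))
    (by fun_prop) (by simp) ?_ (by simp)
  · have h1 : PT (fun x : α × β × β => f x.1 x.2.2) :=
      hf.comp (f := fun x : α × β × β => (x.1, x.2.2)) (by fun_prop)
    have h2 : PT (fun x : α × β × β => f x.1 x.2.1) :=
      hf.comp (f := fun x : α × β × β => (x.1, x.2.1)) (by fun_prop)
    fun_prop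
  · intro a i s x hx hi
    have := size_le_of_mem hx
    cases Frac.lt (f a x) (f a s)
    · simpa using hi
    · simp only [cond_true]; omega

/-- A row of an assignment problem: a label and the list of the weights. The algorithm keeps a list
of rows and, by permuting it, changes which row is assigned to which column. -/
abbrev Row := List TracSymbol × List Frac

end

/-- The eight symbols are encoded by three Boolean values. -/
def symbolBits : TracSymbol → Bool × Bool × Bool
  | .bit b => (false, false, b)
  | .minus => (false, true, false)
  | .slash => (false, true, true)
  | .comma => (true, false, false)
  | .semicolon => (true, false, true)
  | .bar => (true, true, false)
  | .hash => (true, true, true)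

instance : Enc TracSymbol := ⟨fun x => enc (symbolBits x)⟩

section

variable {α : Type} [Enc α]

/-- The weight of row `a` in column `b`. -/
def weight (R : List Row) (a b : ℕ) : Frac := (R.getD a ([], [])).2.getD b 0

/-- The weight of row `a` in column `b` as a rational number. -/
def weightVal (R : List Row) (a b : ℕ) : ℚ := (weight R a b).val

@[fun_prop]
theorem PT.weight {R : α → List Row} {a b : α → ℕ} (hR : PT R) (ha : PT a) (hb : PT b) :
    PT (fun c => weight (R c) (a c) (b c)) := by
  unfold StackProgram.weight
  fun_prop

/-- The cost of an edge as a fraction. -/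
def edgeFrac (R : List Row) (a b : ℕ) : Frac := weight R a b + -weight R b b

theorem edgeFrac_val (R : List Row) (a b : ℕ) :
    (edgeFrac R a b).val = edgeCost (weightVal R) a b := by
  simp [edgeFrac, edgeCost, weightVal, sub_eq_add_neg]

@[fun_prop]
theorem PT.edgeFrac {R : α → List Row} {a b : α → ℕ} (hR : PT R) (ha : PT a) (hb : PT b) :
    PT (fun c => edgeFrac (R c) (a c) (b c)) := by
  unfold StackProgram.edgeFrac
  fun_prop

/-- The cost of a path as a fraction. -/
def pathFrac (R : List Row) (P : List ℕ) : Frac :=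
  Frac.sum ((List.range P.tail.length).map fun i => edgeFrac R (P.tail.getD i 0) (P.getD i 0))

theorem pathFrac_val (R : List Row) (P : List ℕ) :
    (pathFrac R P).val = pathCost (weightVal R) P := by
  induction P with
  | nil => simp [pathFrac, pathCost, Frac.sum]
  | cons r P ih =>
    cases P with
    | nil => simp [pathFrac, pathCost, Frac.sum]
    | cons h P =>
      simp only [pathFrac, Frac.val_sum, List.map_map] at ih ⊢
      rw [pathCost, ← ih]
      simp only [List.tail_cons, List.length_cons, List.range_succ_eq_map, List.map_cons,
        List.map_map, List.sum_cons, Function.comp_apply, List.getD_cons_zero, edgeFrac_val]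
      rfl

@[fun_prop]
theorem PT.pathFrac {R : α → List Row} {P : α → List ℕ} (hR : PT R) (hP : PT P) :
    PT (fun c => pathFrac (R c) (P c)) := by
  unfold StackProgram.pathFrac
  have h1 : PT (fun x : α × ℕ => R x.1) := hR.comp (PT.fst PT.id)
  have h2 : PT (fun x : α × ℕ => P x.1) := hP.comp (PT.fst PT.id)
  fun_prop

/-- The cost of a cycle as a fraction. -/
def cycleFrac (R : List Row) (k : ℕ) (P : List ℕ) : Frac :=
  pathFrac R P + edgeFrac R (P.headD k) k

theorem cycleFrac_val (R : List Row) (k : ℕ) (P : List ℕ) :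
    (cycleFrac R k P).val = cycleCost (weightVal R) k P := by
  simp [cycleFrac, cycleCost, pathFrac_val, edgeFrac_val]

@[fun_prop]
theorem PT.cycleFrac {R : α → List Row} {k : α → ℕ} {P : α → List ℕ} (hR : PT R) (hk : PT k)
    (hP : PT P) : PT (fun c => cycleFrac (R c) (k c) (P c)) := by
  unfold StackProgram.cycleFrac
  fun_prop

/-- The extensions to `r` of the paths in `D`. -/
def extensions (k r : ℕ) (D : List (List ℕ)) : List (List ℕ) :=
  ((List.range k).filter fun h => !decide (r ∈ D.getD h [])).map fun h => r :: D.getD h []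

@[fun_prop]
theorem PT.extensions {k r : α → ℕ} {D : α → List (List ℕ)} (hk : PT k) (hr : PT r) (hD : PT D) :
    PT (fun c => extensions (k c) (r c) (D c)) := by
  unfold StackProgram.extensions
  have h1 : PT (fun x : α × ℕ => r x.1) := hr.comp (PT.fst PT.id)
  have h2 : PT (fun x : α × ℕ => D x.1) := hD.comp (PT.fst PT.id)
  fun_prop

/-- One round of the Bellman-Ford method. -/
def relax (R : List Row) (k : ℕ) (D : List (List ℕ)) : List (List ℕ) :=
  (List.range k).map fun r => argmin (pathFrac R) (extensions k r D) (D.getD r [])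

@[fun_prop]
theorem PT.relax {R : α → List Row} {k : α → ℕ} {D : α → List (List ℕ)} (hR : PT R) (hk : PT k)
    (hD : PT D) : PT (fun c => relax (R c) (k c) (D c)) := by
  unfold StackProgram.relax
  have h1 : PT (fun x : α × ℕ => R x.1) := hR.comp (PT.fst PT.id)
  have h2 : PT (fun x : α × ℕ => D x.1) := hD.comp (PT.fst PT.id)
  have h3 : PT (fun x : α × ℕ => k x.1) := hk.comp (PT.fst PT.id)
  have h4 : PT (fun x : (α × ℕ) × List ℕ => R x.1.1) := hR.comp (PT.fst (PT.fst PT.id))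
  fun_prop

/-- The cheapest paths from `k` to the smaller vertices. -/
def shortestPaths (R : List Row) (k : ℕ) : List (List ℕ) :=
  (List.range k).foldl (fun D _ => relax R k D) ((List.range k).map fun r => [r, k])

theorem size_getD_le {β : Type} [Enc β] {l : List β} {i b : ℕ} {d : β} (hd : size d ≤ b)
    (h : ∀ x ∈ l, size x ≤ b) : size (l.getD i d) ≤ b := by
  rw [List.getD_eq_getElem?_getD]
  rcases lt_or_ge i l.length with hi | hi
  · simpa [hi] using h _ (List.getElem_mem hi)
  · simpa [hi] using hd

theorem size_relax {R : List Row} {k b : ℕ} {D : List (List ℕ)} (hb : 1 ≤ b)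
    (h : ∀ P ∈ D, size P ≤ b) : ∀ P ∈ relax R k D, size P ≤ b + (2 * k + 1) := by
  intro P hP
  simp only [relax, List.mem_map, List.mem_range] at hP
  obtain ⟨r, hr, rfl⟩ := hP
  have h1 := argmin_mem (pathFrac R) (extensions k r D) (D.getD r [])
  rcases List.mem_cons.1 h1 with h1 | h1
  · rw [h1]
    exact (size_getD_le (by simpa using hb) h).trans (by omega)
  · rw [extensions, List.mem_map, ← extensions] at h1
    obtain ⟨i, hi, h1⟩ := h1
    rw [← h1, size_list_cons, size_nat]
    have := size_getD_le (l := D) (i := i) (d := []) (by simpa using hb) h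
    omega

@[fun_prop]
theorem PT.shortestPaths {R : α → List Row} {k : α → ℕ} (hR : PT R) (hk : PT k) :
    PT (fun c => shortestPaths (R c) (k c)) := by
  unfold StackProgram.shortestPaths
  have h3 : PT (fun x : α × ℕ => k x.1) := hk.comp (PT.fst PT.id)
  refine PT.foldl_of_inv (F := fun c (D : List (List ℕ)) _ => StackProgram.relax (R c) (k c) D)
    (by fun_prop) (by fun_prop) ?_
    (fun c i D => D.length = k c ∧ ∀ P ∈ D, size P ≤ (i + 2) * (2 * size (k c) + 3))
    (fun c => size (k c) * ((size (k c) + 2) * (2 * size (k c) + 3) + 1) + 1) (by fun_prop)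
    ?_ ?_ ?_
  · have h1 : PT (fun x : α × List (List ℕ) × ℕ => R x.1) := hR.comp (PT.fst PT.id)
    have h2 : PT (fun x : α × List (List ℕ) × ℕ => k x.1) := hk.comp (PT.fst PT.id)
    fun_prop
  · intro c
    refine ⟨by simp, fun P hP => ?_⟩
    simp only [List.mem_map, List.mem_range] at hP
    obtain ⟨r, hr, rfl⟩ := hP
    simp [size_nat]; omega
  · intro c i D b hb ⟨h1, h2⟩
    refine ⟨by simp [StackProgram.relax], fun P hP => ?_⟩
    have := size_relax (by nlinarith) h2 P hP
    refine this.trans ?_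
    rw [size_nat]
    nlinarith
  · intro c i D hi ⟨h1, h2⟩
    refine (size_list_le h2).trans ?_
    have h4 : k c ≤ size (k c) := by rw [size_nat]; omega
    have h5 : i ≤ size (k c) := by simp at hi; omega
    rw [h1]
    gcongr

theorem areShortest_relax {R : List Row} {k l : ℕ} (hw : IsOpt (weightVal R) k) (hl : 2 ≤ l)
    {D : List (List ℕ)} (hD : AreShortest (weightVal R) k l fun r => D.getD r []) :
    AreShortest (weightVal R) k (l + 1) fun r => (relax R k D).getD r [] := by
  have h0 : ∀ r < k, (relax R k D).getD r [] =
      argmin (pathFrac R) (extensions k r D) (D.getD r []) := by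
    intro r hr
    simp [relax, List.getD_eq_getElem?_getD, hr]
  have hext : ∀ r P, P ∈ extensions k r D ↔ ∃ h < k, r ∉ D.getD h [] ∧ r :: D.getD h [] = P := by
    intro r P
    simp only [extensions, List.mem_map, List.mem_filter, List.mem_range, Bool.not_eq_true',
      decide_eq_false_iff_not, and_assoc]
  refine hD.round hw hl ?_ ?_ ?_
  · intro r hr
    simp only [h0 r hr]
    rcases List.mem_cons.1 (argmin_mem (pathFrac R) (extensions k r D) (D.getD r [])) with h | h
    · exact Or.inl h
    · obtain ⟨i, hi, hri, e⟩ := (hext r _).1 h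
      exact Or.inr ⟨i, hi, hri, e.symm⟩
  · intro r hr
    simp only [h0 r hr, ← pathFrac_val]
    exact argmin_le _ _ _ _ (by simp)
  · intro r hr h hh hrh
    simp only [h0 r hr, ← pathFrac_val]
    exact argmin_le _ _ _ _ (List.mem_cons_of_mem _ ((hext r _).2 ⟨h, hh, hrh, rfl⟩))

theorem areShortest_shortestPaths {R : List Row} {k : ℕ} (hw : IsOpt (weightVal R) k) :
    AreShortest (weightVal R) k (k + 2) fun r => (shortestPaths R k).getD r [] := by
  have key : ∀ i, AreShortest (weightVal R) k (i + 2) fun r => ((List.range i).foldl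
      (fun D _ => relax R k D) ((List.range k).map fun r => [r, k])).getD r [] := by
    intro i
    induction i with
    | zero =>
      have h := areShortest_edges (weightVal R) k
      have e : ∀ r < k, ((List.range k).map fun r => [r, k]).getD r [] = [r, k] := by
        intro r hr
        simp [List.getD_eq_getElem?_getD, hr]
      simp only [List.range_zero, List.foldl_nil]
      constructor
      · intro r hr; rw [e r hr]; exact h.isPath r hr
      · intro r hr; rw [e r hr]; exact h.le r hr
      · intro r hr; rw [e r hr]; exact h.head r hr
      · intro r hr; rw [e r hr]; exact h.length_le r hr
      · intro r hr; rw [e r hr]; exact h.cost_le r hr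
    | succ i ih =>
      rw [List.range_succ, List.foldl_append]
      exact areShortest_relax hw (by omega) ih
  exact key k

/-- A cheapest cycle through `k` with smaller vertices otherwise. -/
def bestCycle (R : List Row) (k : ℕ) : List ℕ :=
  argmin (cycleFrac R k) (shortestPaths R k) [k]

@[fun_prop]
theorem PT.bestCycle {R : α → List Row} {k : α → ℕ} (hR : PT R) (hk : PT k) :
    PT (fun c => bestCycle (R c) (k c)) := by
  unfold StackProgram.bestCycle
  have h1 : PT (fun x : α × List ℕ => R x.1) := hR.comp (PT.fst PT.id)
  have h2 : PT (fun x : α × List ℕ => k x.1) := hk.comp (PT.fst PT.id)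
  fun_prop

theorem length_shortestPaths (R : List Row) (k : ℕ) : (shortestPaths R k).length = k := by
  rw [shortestPaths]
  generalize hl : List.range k = l
  have h0 : ((l.map fun r => [r, k]) : List (List ℕ)).length = k := by simp [← hl]
  generalize (l.map fun r => [r, k]) = D at h0 ⊢
  clear hl
  induction l generalizing D with
  | nil => simpa using h0
  | cons a l ih => exact ih _ (by simp [relax])

theorem bestCycle_spec {R : List Row} {k : ℕ} (hw : IsOpt (weightVal R) k) :
    IsPath k (bestCycle R k) ∧ (∀ x ∈ bestCycle R k, x ≤ k) ∧
      ∀ Q, IsPath k Q → (∀ x ∈ Q, x ≤ k) →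
        cycleCost (weightVal R) k (bestCycle R k) ≤ cycleCost (weightVal R) k Q := by
  have hD := areShortest_shortestPaths hw
  have hlen := length_shortestPaths R k
  have hmem : ∀ P ∈ shortestPaths R k, ∃ r < k, P = (shortestPaths R k).getD r [] := by
    intro P hP
    obtain ⟨r, hr, rfl⟩ := List.getElem_of_mem hP
    exact ⟨r, by omega, by simp [List.getD_eq_getElem?_getD, hr]⟩
  have hmem' : ∀ r < k, (shortestPaths R k).getD r [] ∈ shortestPaths R k := by
    intro r hr
    simp [List.getD_eq_getElem?_getD, hlen, hr]
  have h1 := argmin_mem (cycleFrac R k) (shortestPaths R k) [k]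
  have h2 := argmin_le (cycleFrac R k) (shortestPaths R k) [k]
  change bestCycle R k ∈ _ at h1
  simp only [cycleFrac_val] at h2
  refine ⟨?_, ?_, ?_⟩
  · rcases List.mem_cons.1 h1 with h | h
    · rw [h]; exact .base
    · obtain ⟨r, hr, e⟩ := hmem _ h
      rw [e]; exact hD.isPath r hr
  · rcases List.mem_cons.1 h1 with h | h
    · rw [h]; simp
    · obtain ⟨r, hr, e⟩ := hmem _ h
      rw [e]; exact hD.le r hr
  · intro Q hQ hQk
    have hl := hQ.length_le hQk
    cases hQ with
    | base => exact h2 _ (by simp)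
    | @step r h P h3 h4 =>
      have hrk : r < k := by
        refine lt_of_le_of_ne (hQk r (by simp)) ?_
        rintro rfl
        exact h4 h3.mem_base
      refine (h2 _ (List.mem_cons_of_mem _ (hmem' r hrk))).trans ?_
      have h5 := hD.cost_le r hrk _ (.step h3 h4) (fun x hx => hQk x (by simp [hx])) (by omega)
      have h6 := hD.head r hrk
      simp only [cycleCost, List.headD_eq_head?_getD] at h5 h6 ⊢
      rw [h6]
      simpa using h5

/-- Exchange two rows. -/
def swapRows (k r : ℕ) (R : List Row) : List Row :=
  (List.range R.length).map fun j =>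
    R.getD (if j = k then r else if j = r then k else j) ([], [])

@[fun_prop]
theorem PT.swapRows {k r : α → ℕ} {R : α → List Row} (hk : PT k) (hr : PT r) (hR : PT R) :
    PT (fun c => swapRows (k c) (r c) (R c)) := by
  unfold StackProgram.swapRows
  have h1 : PT (fun x : α × ℕ => R x.1) := hR.comp (PT.fst PT.id)
  have h2 : PT (fun x : α × ℕ => k x.1) := hk.comp (PT.fst PT.id)
  have h3 : PT (fun x : α × ℕ => r x.1) := hr.comp (PT.fst PT.id)
  refine PT.map (by fun_prop) (PT.getD (PT.ite ?_ ?_ (PT.ite ?_ ?_ ?_)) ?_ ?_) <;> fun_prop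

/-- Permute the rows along a cycle. -/
def rotateRows (k : ℕ) (P : List ℕ) (R : List Row) : List Row := P.foldr (swapRows k) R

theorem rotateRows_cons (k r : ℕ) (P : List ℕ) (R : List Row) :
    rotateRows k (r :: P) R = swapRows k r (rotateRows k P R) := rfl

theorem length_rotateRows (k : ℕ) (P : List ℕ) (R : List Row) :
    (rotateRows k P R).length = R.length := by
  induction P with
  | nil => rfl
  | cons r P ih => rw [rotateRows_cons, swapRows]; simpa using ih

theorem size_swapRows {k r b : ℕ} {R : List Row} (hb : 3 ≤ b) (h : ∀ x ∈ R, size x ≤ b) :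
    ∀ x ∈ swapRows k r R, size x ≤ b := by
  intro x hx
  simp only [swapRows, List.mem_map] at hx
  obtain ⟨j, _, rfl⟩ := hx
  exact size_getD_le (by simpa using hb) h

theorem size_rotateRows {k b : ℕ} {P : List ℕ} {R : List Row} (hb : 3 ≤ b)
    (h : ∀ x ∈ R, size x ≤ b) : ∀ x ∈ rotateRows k P R, size x ≤ b := by
  induction P with
  | nil => exact h
  | cons r P ih => exact size_swapRows hb ih

@[fun_prop]
theorem PT.rotateRows {k : α → ℕ} {P : α → List ℕ} {R : α → List Row} (hk : PT k) (hP : PT P)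
    (hR : PT R) : PT (fun c => rotateRows (k c) (P c) (R c)) := by
  refine PT.foldr_of_inv (F := fun c r R => StackProgram.swapRows (k c) r R) hP hR ?_
    (fun c _ R' => R'.length = (R c).length ∧ ∀ x ∈ R', size x ≤ size (R c) + 3)
    (fun c => size (R c) * (size (R c) + 3 + 1) + 1) (by fun_prop) ?_ ?_ ?_
  · have h2 : PT (fun x : α × ℕ × List Row => k x.1) := hk.comp (PT.fst PT.id)
    fun_prop
  · exact fun c => ⟨rfl, fun x hx => (size_le_of_mem hx).trans (by omega)⟩
  · intro c i R' r _ ⟨h1, h2⟩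
    exact ⟨by simp [StackProgram.swapRows, h1], size_swapRows (by omega) h2⟩
  · intro c i R' _ ⟨h1, h2⟩
    refine (size_list_le h2).trans ?_
    rw [h1]
    have := length_le_size (R c)
    gcongr

theorem getD_rotateRows {k : ℕ} {P : List ℕ} {R : List Row} (hk : k < R.length)
    (hP : ∀ x ∈ P, x < R.length) {j : ℕ} (hj : j < R.length) :
    (rotateRows k P R).getD j ([], []) = R.getD (cyclePerm k P j) ([], []) := by
  induction P generalizing j with
  | nil => rfl
  | cons r P ih =>
    have hr := hP r (by simp)
    have e : (if j = k then r else if j = r then k else j) = swap k r j := by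
      rw [swap_apply_def]
    have hs : swap k r j < R.length := by
      rw [← e]; split_ifs <;> assumption
    rw [rotateRows_cons, cyclePerm_cons, Perm.mul_apply, ← ih (fun x hx => hP x (by simp [hx])) hs,
      swapRows]
    simp [List.getD_eq_getElem?_getD, length_rotateRows, hj, swap_apply_def]

/-- An optimal assignment of the rows to the columns, as a permuted list of the rows. -/
def assign (R : List Row) : List Row :=
  (List.range R.length).foldl (fun R k => rotateRows k (bestCycle R k) R) R

theorem size_assign {b : ℕ} {R : List Row} (hb : 3 ≤ b) (h : ∀ x ∈ R, size x ≤ b) :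
    ∀ x ∈ assign R, size x ≤ b := by
  rw [assign]
  generalize List.range R.length = l
  induction l generalizing R with
  | nil => exact h
  | cons k l ih => exact ih (size_rotateRows hb h)

@[fun_prop]
theorem PT.assign {R : α → List Row} (hR : PT R) : PT (fun c => assign (R c)) := by
  refine PT.foldl_of_inv
    (F := fun _ R k => StackProgram.rotateRows k (StackProgram.bestCycle R k) R) (by fun_prop) hR
    (by fun_prop) (fun c _ R' => R'.length = (R c).length ∧ ∀ x ∈ R', size x ≤ size (R c) + 3)
    (fun c => size (R c) * (size (R c) + 3 + 1) + 1) (by fun_prop) ?_ ?_ ?_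
  · exact fun c => ⟨rfl, fun x hx => (size_le_of_mem hx).trans (by omega)⟩
  · intro c i R' r _ ⟨h1, h2⟩
    exact ⟨by simp [length_rotateRows, h1], size_rotateRows (by omega) h2⟩
  · intro c i R' _ ⟨h1, h2⟩
    refine (size_list_le h2).trans ?_
    rw [h1]
    have := length_le_size (R c)
    gcongr

/-- The rows are permuted such that the total weight becomes minimal. -/
theorem assign_spec (R : List Row) : (assign R).length = R.length ∧
    ∃ ν : Perm ℕ, (∀ j, R.length ≤ j → ν j = j) ∧
      (∀ j < R.length, (assign R).getD j ([], []) = R.getD (ν j) ([], [])) ∧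
      ∀ τ : Perm ℕ, (∀ j, R.length ≤ j → τ j = j) →
        ∑ j ∈ Finset.range R.length, weightVal R (ν j) j ≤
          ∑ j ∈ Finset.range R.length, weightVal R (τ j) j := by
  have key : ∀ m ≤ R.length, ∃ ν : Perm ℕ, (∀ j, R.length ≤ j → ν j = j) ∧
      ((List.range m).foldl (fun R k => rotateRows k (bestCycle R k) R) R).length = R.length ∧
      (∀ j < R.length, ((List.range m).foldl (fun R k => rotateRows k (bestCycle R k) R) R).getD j
        ([], []) = R.getD (ν j) ([], [])) ∧
      IsOpt (weightVal ((List.range m).foldl (fun R k => rotateRows k (bestCycle R k) R) R)) m := by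
    intro m
    induction m with
    | zero => exact fun _ => ⟨1, by simp, rfl, by simp, fun τ _ => by simp⟩
    | succ m ih =>
      intro hm
      obtain ⟨ν, h1, h2, h3, h4⟩ := ih (by omega)
      rw [List.range_succ, List.foldl_append]
      generalize (List.range m).foldl (fun R k => rotateRows k (bestCycle R k) R) R = R' at *
      simp only [List.foldl_cons, List.foldl_nil]
      obtain ⟨hP, hPm, hmin⟩ := bestCycle_spec h4
      have hPR : ∀ x ∈ bestCycle R' m, x < R'.length := fun x hx => by
        have := hPm x hx; omega
      have hget := fun j (hj : j < R.length) =>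
        getD_rotateRows (k := m) (P := bestCycle R' m) (R := R') (by omega) hPR (h2 ▸ hj)
      have hfix : ∀ j, R.length ≤ j → cyclePerm m (bestCycle R' m) j = j := fun j hj =>
        cyclePerm_fix (m := R'.length) (by omega) hPR (by omega)
      have hlt : ∀ ρ : Perm ℕ, (∀ j, R.length ≤ j → ρ j = j) → ∀ j < R.length, ρ j < R.length := by
        intro ρ hρ j hj
        by_contra hc
        have := ρ.injective (hρ _ (not_lt.1 hc))
        omega
      refine ⟨ν * cyclePerm m (bestCycle R' m), fun j hj => ?_, ?_, fun j hj => ?_, ?_⟩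
      · rw [Perm.mul_apply, hfix j hj, h1 j hj]
      · rw [length_rotateRows, h2]
      · rw [hget j hj, Perm.mul_apply, h3 _ (hlt _ hfix j hj)]
      · have h5 := h4.succ hP hPm hmin
        intro τ hτ
        have e : ∀ a < R.length, ∀ b, weightVal (rotateRows m (bestCycle R' m) R') a b =
            weightVal R' (cyclePerm m (bestCycle R' m) a) b := by
          intro a ha b
          rw [weightVal, weightVal, weight, weight, hget a ha]
        have h6 := h5 τ hτ
        have h7 : ∀ j ∈ Finset.range (m + 1), τ j < R.length := by
          intro j hj
          refine hlt τ (fun i hi => hτ i (by omega)) j ?_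
          have := Finset.mem_range.1 hj
          omega
        rw [Finset.sum_congr rfl fun j hj => e j (by
          have := Finset.mem_range.1 hj; omega) j,
          Finset.sum_congr rfl fun j hj => e (τ j) (h7 j hj) j]
        exact h6
  obtain ⟨ν, h1, h2, h3, h4⟩ := key R.length le_rfl
  refine ⟨h2, ν, h1, h3, fun τ hτ => ?_⟩
  have h5 := h4 (ν⁻¹ * τ) fun j hj => by
    rw [Perm.mul_apply, hτ j hj, Perm.inv_eq_iff_eq, h1 j hj]
  have hlt : ∀ ρ : Perm ℕ, (∀ j, R.length ≤ j → ρ j = j) → ∀ j < R.length, ρ j < R.length := by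
    intro ρ hρ j hj
    by_contra hc
    have := ρ.injective (hρ _ (not_lt.1 hc))
    omega
  have e : ∀ a < R.length, ∀ b, weightVal ((List.range R.length).foldl
      (fun R k => rotateRows k (bestCycle R k) R) R) a b = weightVal R (ν a) b := by
    intro a ha b
    rw [weightVal, weightVal, weight, weight, h3 a ha]
  rw [Finset.sum_congr rfl fun j hj => e j (Finset.mem_range.1 hj) j,
    Finset.sum_congr rfl fun j hj => e ((ν⁻¹ * τ) j) (by
      refine hlt _ (fun i hi => ?_) j (Finset.mem_range.1 hj)
      rw [Perm.mul_apply, hτ i hi, Perm.inv_eq_iff_eq, h1 i hi]) j] at h5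
  simpa using h5

end

end StackProgram

/-! ### Reading the input and running through the steps -/

namespace StackProgram

open Enc Equiv TracSymbol

section

variable {α β : Type} [Enc α] [Enc β]

/-- A function of a single symbol is computed by a table. -/
theorem PT.symbol_fun (g : TracSymbol → β) : PT g := by
  have h : PT symbolBits := PT.of_enc fun _ => rfl
  have : PT (fun x => bif (symbolBits x).1 then
      (bif (symbolBits x).2.1 then (bif (symbolBits x).2.2 then g hash else g bar)
        else (bif (symbolBits x).2.2 then g semicolon else g comma))
      else (bif (symbolBits x).2.1 then (bif (symbolBits x).2.2 then g slash else g minus)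
        else (bif (symbolBits x).2.2 then g (TracSymbol.bit true)
          else g (TracSymbol.bit false)))) := by
    refine PT.cond h.fst (PT.cond h.snd.fst (PT.cond h.snd.snd ?_ ?_) (PT.cond h.snd.snd ?_ ?_))
      (PT.cond h.snd.fst (PT.cond h.snd.snd ?_ ?_) (PT.cond h.snd.snd ?_ ?_)) <;>
    exact PT.const _
  convert this using 2 with x
  cases x with
  | bit b => cases b <;> rfl
  | _ => rfl

/-- Split a word into the pieces that are closed by the terminator `s`. -/
def pieces (s : TracSymbol) (u : List TracSymbol) : List (List TracSymbol) :=
  u.foldr (fun x acc => bif decide (x = s) then [] :: acc else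
    bif acc.isEmpty then [] else (x :: acc.headD []) :: acc.tail) []

theorem pieces_append {s : TracSymbol} {u : List TracSymbol} (hu : s ∉ u) (v : List TracSymbol) :
    pieces s (u ++ s :: v) = u :: pieces s v := by
  induction u with
  | nil => simp [pieces]
  | cons x u ih =>
    simp only [List.mem_cons, not_or] at hu
    have ih := ih hu.2
    rw [pieces] at ih
    rw [List.cons_append, pieces, List.foldr_cons, ih]
    simp [Ne.symm hu.1]

theorem pieces_encodeList {γ : Type} {s : TracSymbol} {e : γ → List TracSymbol}
    (h : ∀ x, s ∉ e x) (l : List γ) : pieces s (encodeList s e l) = l.map e := by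
  induction l with
  | nil => rfl
  | cons x l ih =>
    have : encodeList s e (x :: l) = e x ++ s :: encodeList s e l := by simp [encodeList]
    rw [this, pieces_append (h x), ih, List.map_cons]

@[fun_prop]
theorem PT.pieces (s : TracSymbol) {u : α → List TracSymbol} (hu : PT u) :
    PT (fun a => pieces s (u a)) := by
  have h : PT (fun x : TracSymbol => decide (x = s)) := PT.symbol_fun _
  refine PT.foldr (F := fun _ x acc => bif decide (x = s) then [] :: acc else
    bif acc.isEmpty then [] else (x :: acc.headD []) :: acc.tail) hu (PT.const []) ?_
    (fun a => size (u a) + 10) (by fun_prop) ?_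
  · have h' : PT (fun x : α × TracSymbol × List (List TracSymbol) => decide (x.2.1 = s)) :=
      h.comp (PT.fst (PT.snd PT.id))
    fun_prop
  · intro a acc x hx
    have := size_le_of_mem hx
    cases decide (x = s)
    · cases acc with
      | nil => simp
      | cons p acc => simp; omega
    · simp; omega

/-- The binary digit that a symbol stands for, if any. -/
def digit : TracSymbol → List Bool
  | bit b => [b]
  | _ => []

/-- The binary digits in a word. -/
def digits (u : List TracSymbol) : List Bool := u.flatMap digit

@[fun_prop]
theorem PT.digits {u : α → List TracSymbol} (hu : PT u) : PT (fun a => digits (u a)) :=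
  PT.flatMap (F := fun _ => digit) hu ((PT.symbol_fun digit).comp PT.snd')

theorem digits_map (l : List Bool) : digits (l.map bit) = l := by
  induction l with
  | nil => rfl
  | cons b l ih => simp only [digits] at ih; simp [digits, digit, ih]

/-- Whether a word starts with a minus sign. -/
def hasMinus (u : List TracSymbol) : Bool := decide (u.headD hash = minus)

@[fun_prop]
theorem PT.hasMinus {u : α → List TracSymbol} (hu : PT u) : PT (fun a => hasMinus (u a)) :=
  (PT.symbol_fun fun x => decide (x = minus)).comp (PT.headD hu (PT.const hash))

/-- The number with the given binary digits, but `1` instead of `0`: the value of a denominator has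
to be positive on words that do not encode a rational number, too. -/
def denominator (l : List Bool) : Bin :=
  bif (ofBits l).bits.isEmpty then ⟨1⟩ else ⟨ofBits l⟩

theorem denominator_pos (l : List Bool) : 0 < (denominator l).val := by
  rw [denominator]
  cases h : (ofBits l).bits.isEmpty
  · rw [cond_false]
    refine Nat.pos_of_ne_zero fun h0 => ?_
    simp only at h0
    rw [h0] at h
    simp at h
  · simp

theorem denominator_bits {n : ℕ} (hn : 0 < n) : (denominator n.bits).val = n := by
  rw [denominator, ofBits_bits]
  cases h : n.bits with
  | nil =>
    have := ofBits_bits n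
    rw [h] at this
    simp at this
    omega
  | cons => simp

@[fun_prop]
theorem PT.denominator {l : α → List Bool} (hl : PT l) : PT (fun a => denominator (l a)) :=
  PT.cond (PT.isEmpty (PT.bits (PT.ofBits hl))) (PT.const _) (PT.ofBits hl)

/-- The fraction that is written in a word. The slash that is appended closes the denominator, so
that both parts are found by `pieces`. -/
def readFrac (u : List TracSymbol) : Frac :=
  let n := (pieces slash (u ++ [slash])).getD 0 []
  let q := (pieces slash (u ++ [slash])).getD 1 []
  ⟨bif hasMinus n then 0 else ofBits (digits n), bif hasMinus n then ofBits (digits n) else 0,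
    (denominator (digits q)).val, denominator_pos _⟩

theorem readFrac_encodeRat (q : ℚ) : (readFrac (encodeRat q)).val = q := by
  have h1 : pieces slash (encodeRat q ++ [slash]) =
      [(if q < 0 then [minus] else []) ++ q.num.natAbs.bits.map bit, q.den.bits.map bit] := by
    rw [encodeRat, List.append_assoc, List.cons_append, pieces_append, pieces_append]
    · rfl
    · simp
    · split_ifs <;> simp
  have hden : (q.den : ℚ) ≠ 0 := Nat.cast_ne_zero.2 q.den_ne_zero
  simp only [readFrac, h1, Frac.val, List.getD_cons_zero, List.getD_cons_succ, digits_map,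
    denominator_bits q.den_pos]
  conv_rhs => rw [← Rat.num_div_den q]
  congr 1
  by_cases hq : q < 0
  · have h2 : digits ([minus] ++ q.num.natAbs.bits.map bit) = q.num.natAbs.bits := by
      have := digits_map q.num.natAbs.bits
      simpa [digits, digit] using this
    have h3 := Rat.num_neg.2 hq
    simp only [hq, if_true, h2, ofBits_bits]
    have h4 : ((q.num.natAbs : ℤ) : ℚ) = ((-q.num : ℤ) : ℚ) := by
      congr 1; omega
    simp only [hasMinus, List.singleton_append, List.headD_cons, decide_true, cond_true,
      Nat.cast_zero, zero_sub]
    rw [← Int.cast_natCast, h4]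
    push_cast
    ring
  · have h3 := Rat.num_nonneg.2 (not_lt.1 hq)
    have h4 : ((q.num.natAbs : ℤ) : ℚ) = ((q.num : ℤ) : ℚ) := by
      congr 1; omega
    have h5 : hasMinus (q.num.natAbs.bits.map bit) = false := by
      cases h : q.num.natAbs.bits <;> simp [hasMinus]
    simp only [hq, if_false, List.nil_append, h5, cond_false, digits_map, ofBits_bits,
      Nat.cast_zero, sub_zero]
    rw [← Int.cast_natCast, h4]

@[fun_prop]
theorem PT.readFrac {u : α → List TracSymbol} (hu : PT u) : PT (fun a => readFrac (u a)) := by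
  have h1 : PT (fun a => (StackProgram.pieces slash (u a ++ [slash])).getD 0 []) := by fun_prop
  have h2 : PT (fun a => (StackProgram.pieces slash (u a ++ [slash])).getD 1 []) := by fun_prop
  refine PT.congr_enc (g := fun a =>
    ((bif StackProgram.hasMinus ((StackProgram.pieces slash (u a ++ [slash])).getD 0 []) then
        Bin.mk 0 else Bin.mk (StackProgram.ofBits (StackProgram.digits
          ((StackProgram.pieces slash (u a ++ [slash])).getD 0 [])))),
      (bif StackProgram.hasMinus ((StackProgram.pieces slash (u a ++ [slash])).getD 0 []) then
        Bin.mk (StackProgram.ofBits (StackProgram.digits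
          ((StackProgram.pieces slash (u a ++ [slash])).getD 0 []))) else Bin.mk 0),
      StackProgram.denominator (StackProgram.digits
        ((StackProgram.pieces slash (u a ++ [slash])).getD 1 [])))) ?_ fun a => ?_
  · exact PT.prodMk (PT.cond h1.hasMinus (PT.const _) h1.digits.ofBits)
      (PT.prodMk (PT.cond h1.hasMinus h1.digits.ofBits (PT.const _)) h2.digits.denominator)
  · simp only [StackProgram.readFrac]
    cases StackProgram.hasMinus ((StackProgram.pieces slash (u a ++ [slash])).getD 0 []) <;> rfl

/-- The rows of the assignment problem for one step: the tracks so far with the weights. -/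
def mkRows (T : List (List TracSymbol)) (W : List (List Frac)) : List Row :=
  (List.range T.length).map fun i => (T.getD i [], W.getD i [])

/-- One step in time: solve the assignment problem and extend the tracks by the next points. The
tracks are ordered by their end points. -/
def extendTracks (T : List (List TracSymbol)) (p : List (List TracSymbol)) (W : List (List Frac)) :
    List (List TracSymbol) :=
  (List.range p.length).map fun j =>
    ((assign (mkRows T W)).getD j ([], [])).1 ++ (p.getD j [] ++ [semicolon])

@[fun_prop]
theorem PT.extendTracks {T p : α → List (List TracSymbol)} {W : α → List (List Frac)} (hT : PT T)
    (hp : PT p) (hW : PT W) : PT (fun a => extendTracks (T a) (p a) (W a)) := by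
  have h1 : PT (fun a => mkRows (T a) (W a)) := by
    unfold mkRows
    have h2 : PT (fun x : α × ℕ => T x.1) := hT.comp (PT.fst PT.id)
    have h3 : PT (fun x : α × ℕ => W x.1) := hW.comp (PT.fst PT.id)
    fun_prop
  have h2 : PT (fun x : α × ℕ => StackProgram.assign (mkRows (T x.1) (W x.1))) :=
    h1.assign.comp (PT.fst PT.id)
  have h3 : PT (fun x : α × ℕ => p x.1) := hp.comp (PT.fst PT.id)
  unfold StackProgram.extendTracks
  fun_prop

theorem size_extendTracks {T p : List (List TracSymbol)} {W : List (List Frac)} {b : ℕ}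
    (hb : 1 ≤ b) (hT : ∀ t ∈ T, size t ≤ b) :
    ∀ t ∈ extendTracks T p W, size t ≤ b + (size W + size p + 20) := by
  intro t ht
  simp only [extendTracks, List.mem_map] at ht
  obtain ⟨j, _, rfl⟩ := ht
  have h1 : ∀ x ∈ mkRows T W, size x ≤ b + size W + 3 := by
    intro x hx
    simp only [mkRows, List.mem_map] at hx
    obtain ⟨i, _, rfl⟩ := hx
    have h2 := size_getD_le (l := T) (i := i) (d := []) (by simpa using hb) hT
    have h3 := size_getD_le (l := W) (i := i) (d := []) (b := size W) (size_pos _)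
      fun x hx => size_le_of_mem hx
    simp only [size_pair]
    omega
  have h2 := size_getD_le (l := assign (mkRows T W)) (i := j) (d := ([], []))
    (b := b + size W + 3) (by simp only [size_pair, size_list_nil]; omega)
    (size_assign (by omega) h1)
  generalize (assign (mkRows T W)).getD j ([], []) = r at h2
  obtain ⟨u, v⟩ := r
  have h3 := size_getD_le (l := p) (i := j) (d := []) (b := size p) (size_pos _)
    fun x hx => size_le_of_mem hx
  have h4 := size_append_le u (p.getD j [] ++ [semicolon])
  have h5 := size_append_le (p.getD j []) [semicolon]
  have h6 : size [semicolon] = 11 := by decide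
  simp only [size_pair] at h2 ⊢
  omega

/-- The tracks of all particles: starting from the points at the first moment, one step is made for
each weight matrix. -/
def allTracks (p : List (List (List TracSymbol))) (W : List (List (List Frac))) :
    List (List TracSymbol) :=
  (List.range W.length).foldl (fun T τ => extendTracks T (p.getD (τ + 1) []) (W.getD τ []))
    ((p.headD []).map fun u => u ++ [semicolon])

@[fun_prop]
theorem PT.allTracks {p : α → List (List (List TracSymbol))} {W : α → List (List (List Frac))}
    (hp : PT p) (hW : PT W) : PT (fun a => allTracks (p a) (W a)) := by
  refine PT.foldl_of_inv (F := fun a T τ => StackProgram.extendTracks T ((p a).getD (τ + 1) [])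
    ((W a).getD τ [])) (by fun_prop) (by fun_prop) ?_
    (fun a i T => T.length ≤ size (p a) ∧
      ∀ t ∈ T, size t ≤ (i + 1) * (size (W a) + size (p a) + 20))
    (fun a => size (p a) * ((size (W a) + 1) * (size (W a) + size (p a) + 20) + 1) + 1)
    (by fun_prop) ?_ ?_ ?_
  · have h1 : PT (fun x : α × List (List TracSymbol) × ℕ => p x.1) := hp.comp (PT.fst PT.id)
    have h2 : PT (fun x : α × List (List TracSymbol) × ℕ => W x.1) := hW.comp (PT.fst PT.id)
    fun_prop
  · intro a
    have h0 : size ((p a).headD []) ≤ size (p a) := by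
      cases p a <;> simp; omega
    refine ⟨?_, fun t ht => ?_⟩
    · rw [List.length_map]
      exact (length_le_size _).trans h0
    · simp only [List.mem_map] at ht
      obtain ⟨u, hu, rfl⟩ := ht
      have h1 := size_le_of_mem hu
      have h5 := size_append_le u [semicolon]
      have h6 : size [semicolon] = 11 := by decide
      omega
  · intro a i T τ _ ⟨h1, h2⟩
    have h3 := size_getD_le (l := p a) (i := τ + 1) (d := []) (b := size (p a)) (size_pos _)
      fun x hx => size_le_of_mem hx
    have h4 := size_getD_le (l := W a) (i := τ) (d := []) (b := size (W a)) (size_pos _)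
      fun x hx => size_le_of_mem hx
    refine ⟨?_, fun t ht => ?_⟩
    · simp only [StackProgram.extendTracks, List.length_map, List.length_range]
      exact (length_le_size _).trans h3
    · have := size_extendTracks (by nlinarith) h2 t ht
      refine this.trans ?_
      rw [add_mul (i + 1)]
      omega
  · intro a i T hi ⟨h1, h2⟩
    refine (size_list_le h2).trans ?_
    have : i ≤ size (W a) := by
      rw [List.length_range] at hi
      exact hi.trans (length_le_size _)
    gcongr

/-- The points in the first part of the input, as unparsed words. -/
def readPoints (u : List TracSymbol) : List (List (List TracSymbol)) :=
  (pieces bar u).map fun v => pieces semicolon v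

/-- The weights in the second part of the input. -/
def readWeights (u : List TracSymbol) : List (List (List Frac)) :=
  (pieces bar u).map fun v => (pieces semicolon v).map fun r => (pieces comma r).map readFrac

/-- The complete algorithm, from the encoding of an instance to the encoding of the tracks. -/
def solve (u : List TracSymbol) : List TracSymbol :=
  (allTracks (readPoints ((pieces hash (u ++ [hash])).getD 0 []))
    (readWeights ((pieces hash (u ++ [hash])).getD 1 []))).flatMap fun t => t ++ [bar]

theorem PT.solve : PT solve := by
  have h1 : PT (fun u : List TracSymbol => readPoints ((StackProgram.pieces hash
      (u ++ [hash])).getD 0 [])) := by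
    unfold readPoints
    fun_prop
  have h2 : PT (fun u : List TracSymbol => readWeights ((StackProgram.pieces hash
      (u ++ [hash])).getD 1 [])) := by
    unfold readWeights
    fun_prop
  have h3 := PT.allTracks h1 h2
  exact PT.flatMap h3 (PT.append PT.snd' (PT.const _))

end

end StackProgram

/-! ### The algorithm finds an optimal coupling -/

namespace StackProgram

open Enc Equiv TracSymbol

theorem getD_ofFn {β : Type} {n : ℕ} (f : Fin n → β) (d : β) (i : Fin n) :
    (List.ofFn f).getD i d = f i := by
  simp [List.getD_eq_getElem?_getD]

/-- One step in time computes a cheapest way to match the ends of the tracks with the next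
points. -/
theorem extendTracks_spec {n : ℕ} (t p : Fin n → List TracSymbol) (x : Fin n → Fin n → Frac) :
    ∃ σ : Perm (Fin n),
      extendTracks (List.ofFn t) (List.ofFn p) (List.ofFn fun i => List.ofFn (x i)) =
        List.ofFn (fun j => t (σ j) ++ (p j ++ [semicolon])) ∧
      ∀ τ : Perm (Fin n), ∑ j, (x (σ j) j).val ≤ ∑ j, (x (τ j) j).val := by
  obtain ⟨-, ν, hν, hR, hopt⟩ :=
    assign_spec (mkRows (List.ofFn t) (List.ofFn fun i => List.ofFn (x i)))
  have hlen : (mkRows (List.ofFn t) (List.ofFn fun i => List.ofFn (x i))).length = n := by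
    simp [mkRows]
  have hget : ∀ i : Fin n, (mkRows (List.ofFn t) (List.ofFn fun i => List.ofFn (x i))).getD i
      ([], []) = (t i, List.ofFn (x i)) := by
    intro i
    have h1 := getD_ofFn t [] i
    have h2 := getD_ofFn (fun i => List.ofFn (x i)) [] i
    rw [List.getD_eq_getElem?_getD] at h1 h2 ⊢
    simp [mkRows]
  have hw : ∀ i j : Fin n, weightVal (mkRows (List.ofFn t) (List.ofFn fun i => List.ofFn (x i)))
      i j = (x i j).val := by
    intro i j
    rw [weightVal, weight, hget, getD_ofFn]
  rw [hlen] at hν hR hopt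
  unfold extendTracks
  generalize mkRows (List.ofFn t) (List.ofFn fun i => List.ofFn (x i)) = R at hν hR hopt hget hw ⊢
  have hlt : ∀ i : Fin n, ν i < n := fun i => by
    by_contra hc
    have := ν.injective (hν _ (not_lt.1 hc))
    omega
  let σ : Perm (Fin n) := Equiv.ofBijective (fun i => ⟨ν i, hlt i⟩)
    (Finite.injective_iff_bijective.1 fun i j h => Fin.ext (ν.injective (by simpa using h)))
  have hσ : ∀ i : Fin n, ν i = (σ i : ℕ) := fun _ => rfl
  refine ⟨σ, ?_, fun τ => ?_⟩
  · rw [List.length_ofFn, ← List.map_coe_finRange_eq_range, List.map_map]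
    refine (List.map_congr_left fun j _ => ?_).trans List.ofFn_eq_map.symm
    rw [Function.comp_apply, hR j j.2, hσ, hget, getD_ofFn]
  · have h1 := hopt (τ.extendDomain Fin.equivSubtype) fun j hj =>
      τ.extendDomain_apply_not_subtype _ (by omega)
    rw [← Fin.sum_univ_eq_sum_range (fun j => weightVal R (ν j) j),
      ← Fin.sum_univ_eq_sum_range (fun j => weightVal R (τ.extendDomain Fin.equivSubtype j) j)]
      at h1
    have h2 : ∀ j : Fin n, τ.extendDomain Fin.equivSubtype (j : ℕ) = (τ j : ℕ) := fun j =>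
      τ.extendDomain_apply_image Fin.equivSubtype j
    simpa only [hσ, h2, hw] using h1

/-- The fold over the steps in time produces tracks that are optimal in every single step. Here
`ρ s j` is the index of the position at time `s` of the particle that ends in position `j`. -/
theorem foldl_extendTracks {n : ℕ} (p : ℕ → Fin n → List TracSymbol)
    (x : ℕ → Fin n → Fin n → Frac) (m : ℕ) :
    ∃ ρ : ℕ → Perm (Fin n),
      (List.range m).foldl (fun T s => extendTracks T (List.ofFn (p (s + 1)))
          (List.ofFn fun i => List.ofFn (x s i))) (List.ofFn fun j => p 0 j ++ [semicolon]) =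
        List.ofFn (fun j => (List.range (m + 1)).flatMap fun s => p s (ρ s j) ++ [semicolon]) ∧
      ρ m = 1 ∧
      ∀ s < m, ∀ τ : Perm (Fin n),
        ∑ j, (x s (ρ s j) (ρ (s + 1) j)).val ≤ ∑ j, (x s (τ j) j).val := by
  induction m with
  | zero => exact ⟨fun _ => 1, by simp, rfl, by simp⟩
  | succ m ih =>
    obtain ⟨ρ, h1, h2, h3⟩ := ih
    obtain ⟨σ, hσ1, hσ2⟩ := extendTracks_spec
      (fun j => (List.range (m + 1)).flatMap fun s => p s (ρ s j) ++ [semicolon]) (p (m + 1)) (x m)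
    refine ⟨fun s => if s ≤ m then σ.trans (ρ s) else 1, ?_, by simp, fun s hs τ => ?_⟩
    · rw [List.range_succ, List.foldl_append, h1, List.foldl_cons, List.foldl_nil, hσ1]
      congr 1
      funext j
      rw [List.range_succ (n := m + 1), List.flatMap_append]
      congr 1
      · refine List.flatMap_congr fun s hs => ?_
        dsimp only
        rw [if_pos (by have := List.mem_range.1 hs; omega)]
        rfl
      · simp
    · rcases Nat.lt_succ_iff_lt_or_eq.1 hs with hs | rfl
      · refine le_trans (le_of_eq ?_) (h3 s hs τ)
        dsimp only
        rw [if_pos hs.le, if_pos (show s + 1 ≤ m by omega)]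
        exact Equiv.sum_comp σ fun j => (x s (ρ s j) (ρ (s + 1) j)).val
      · simpa [h2] using hσ2 τ

theorem range_flatMap {β : Type} (m : ℕ) (f : ℕ → List β) :
    (List.range m).flatMap f = (List.ofFn fun s : Fin m => f s).flatten := by
  rw [← List.map_coe_finRange_eq_range, List.flatMap_map, List.ofFn_eq_map]
  rfl

theorem cost_eq_sum_steps {d : ℕ} {I : TracInstance d} (π : I.Coupling) :
    π.cost = ∑ τ : Fin I.steps, ∑ k : Fin I.n, I.w τ (π τ.castSucc k) (π τ.succ k) :=
  Finset.sum_comm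

/-- The algorithm outputs the tracks of an optimal coupling. -/
theorem solve_encode {d : ℕ} (I : TracInstance d) :
    ∃ π : I.Coupling, π.IsOptimal ∧ solve I.encode = encodeLists π.tracks := by
  let raw : Fin (I.steps + 1) → Fin I.n → List TracSymbol := fun τ i =>
    encodeList comma encodeRat (List.ofFn (I.point τ i))
  obtain ⟨ρ, h1, -, h3⟩ := foldl_extendTracks
    (fun s i => if h : s < I.steps + 1 then raw ⟨s, h⟩ i else [])
    (fun s i j => if h : s < I.steps then readFrac (encodeRat (I.weight ⟨s, h⟩ i j)) else 0) I.steps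
  obtain ⟨π, hπ⟩ : ∃ π : I.Coupling, ∀ τ k, π τ k = I.numbering τ (ρ τ k) :=
    ⟨fun τ => (ρ τ).trans (I.numbering τ), fun _ _ => rfl⟩
  refine ⟨π, fun π' => ?_, ?_⟩
  · rw [cost_eq_sum_steps, cost_eq_sum_steps]
    refine Finset.sum_le_sum fun τ _ => ?_
    let a := (π' τ.castSucc).trans (I.numbering _).symm
    let b := (π' τ.succ).trans (I.numbering _).symm
    have h4 := h3 τ τ.2 (b.symm.trans a)
    rw [← Equiv.sum_comp b fun j => Frac.val (dite _ (fun h => readFrac (encodeRat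
      (I.weight ⟨τ, h⟩ ((b.symm.trans a) j) j))) _)] at h4
    simpa [TracInstance.w, a, b, readFrac_encodeRat, hπ] using h4
  · have hash1 : ∀ l, hash ∉ encodeLists l := fun l =>
      notMem_encodeList (by simp) (notMem_encodeList (by simp)
        (notMem_encodeList (by simp) (notMem_encodeRat (by simp)))) l
    have h5 : pieces hash (I.encode ++ [hash]) =
        [encodeLists (List.ofFn fun τ => List.ofFn fun i => List.ofFn (I.point τ i)),
          encodeLists (List.ofFn fun τ => List.ofFn fun i => List.ofFn (I.weight τ i))] := by
      rw [TracInstance.encode, List.append_assoc, List.cons_append, pieces_append (hash1 _),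
        pieces_append (hash1 _)]
      rfl
    have h6 : readPoints (encodeLists (List.ofFn fun τ => List.ofFn fun i =>
        List.ofFn (I.point τ i))) = List.ofFn fun τ => List.ofFn (raw τ) := by
      rw [readPoints, encodeLists, pieces_encodeList
        (notMem_encodeList (by simp) (notMem_encodeList (by simp) (notMem_encodeRat (by simp)))),
        List.map_map, List.map_ofFn]
      congr 1
      funext τ
      rw [Function.comp_apply, Function.comp_apply, pieces_encodeList
        (notMem_encodeList (by simp) (notMem_encodeRat (by simp))), List.map_ofFn]
      rfl
    have h7 : readWeights (encodeLists (List.ofFn fun τ => List.ofFn fun i =>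
        List.ofFn (I.weight τ i))) = List.ofFn fun τ => List.ofFn fun i => List.ofFn fun j =>
          readFrac (encodeRat (I.weight τ i j)) := by
      rw [readWeights, encodeLists, pieces_encodeList
        (notMem_encodeList (by simp) (notMem_encodeList (by simp) (notMem_encodeRat (by simp)))),
        List.map_map, List.map_ofFn]
      congr 1
      funext τ
      rw [Function.comp_apply, Function.comp_apply, pieces_encodeList
        (notMem_encodeList (by simp) (notMem_encodeRat (by simp))), List.map_map, List.map_ofFn]
      congr 1
      funext i
      rw [Function.comp_apply, Function.comp_apply, pieces_encodeList
        (notMem_encodeRat (by simp)), List.map_map, List.map_ofFn]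
      rfl
    have h8 : allTracks (List.ofFn fun τ => List.ofFn (raw τ))
        (List.ofFn fun τ => List.ofFn fun i => List.ofFn fun j =>
          readFrac (encodeRat (I.weight τ i j))) = List.ofFn fun j =>
          (List.ofFn fun τ : Fin (I.steps + 1) => raw τ (ρ τ j) ++ [semicolon]).flatten := by
      simp only [range_flatMap] at h1
      refine Eq.trans ?_ (h1.trans ?_)
      · rw [allTracks, List.length_ofFn]
        have h9 : ((List.ofFn fun τ => List.ofFn (raw τ)).headD []).map
            (fun u => u ++ [semicolon]) = List.ofFn fun j =>
              (if h : 0 < I.steps + 1 then raw ⟨0, h⟩ j else []) ++ [semicolon] := by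
          rw [List.ofFn_succ, List.headD_cons, List.map_ofFn]
          simp
          rfl
        rw [h9]
        refine List.foldl_ext _ _ _ fun T s hs => ?_
        rw [List.mem_range] at hs
        have e1 := getD_ofFn (fun τ => List.ofFn (raw τ)) [] ⟨s + 1, by omega⟩
        have e2 := getD_ofFn (fun τ => List.ofFn fun i => List.ofFn fun j =>
          readFrac (encodeRat (I.weight τ i j))) [] ⟨s, hs⟩
        rw [e1, e2]
        simp [hs]
      · simp
    rw [solve, h5]
    simp only [List.getD_cons_zero, List.getD_cons_succ]
    rw [h6, h7, h8, encodeLists, encodeList, TracInstance.Coupling.tracks, List.ofFn_eq_map,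
      List.ofFn_eq_map, List.flatMap_map, List.flatMap_map]
    refine List.flatMap_congr fun j _ => ?_
    rw [encodeList, List.ofFn_eq_map, List.ofFn_eq_map, List.flatMap_map, ← List.flatMap_def]
    simp only [hπ]
    rfl

end StackProgram

/-! ### The Turing machine -/

namespace StackProgram

open Turing Enc TracSymbol

instance : Fintype TracSymbol :=
  ⟨{.bit false, .bit true, .minus, .slash, .comma, .semicolon, .bar, .hash}, by
    rintro (⟨⟨⟩⟩ | _) <;> decide⟩

/-- Push a word on `main`, the last symbol first. -/
def pushWord {Λ : Type} : List TracSymbol → Code Λ → Code Λ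
  | [], s => s
  | b :: w, s => pushWord w (.push .main (fun _ => b) s)

theorem mapLabel_pushWord {Λ Λ' : Type} (g : Λ → Λ') (w : List TracSymbol) (s : Code Λ) :
    mapLabel g (pushWord w s) = pushWord w (mapLabel g s) := by
  induction w generalizing s <;> simp_all [pushWord, mapLabel]

theorem stepAux_pushWord {Λ : Type} (w : List TracSymbol) (s : Code Λ) (v : Option TracSymbol)
    (m a c t : List TracSymbol) :
    TM2.stepAux (pushWord w s) v (st m a c t) = TM2.stepAux s v (st (w ++ m) a c t) := by
  induction w generalizing s with
  | nil => rfl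
  | cons b w ih => simp [pushWord, ih, TM2.stepAux]

/-- Read the input from the stack `aux` and store it on `main` as the tree of a list, in reversed
order. -/
abbrev readF : Frag where
  L := Option TracSymbol
  fin := inferInstance
  entry := none
  body
    | none => .pop .aux (fun _ o => o) (.goto fun v => v.map some)
    | some x => pushWord (one :: (enc x).word) (.goto fun _ => some none)

theorem exec_readF (u l : List TracSymbol) (m : List TracSymbol) :
    Exec readF (st ((enc l).word ++ m) u [] []) (st ((enc (u.reverse ++ l)).word ++ m) [] [] [])
      (2 * u.length + 1) := by
  intro Λ M e x hM v
  induction u generalizing l v with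
  | nil =>
    refine ⟨none, ReachIn.step ?_⟩
    rw [hM]
    simp only [mapLabel, TM2.stepAux, st_aux, update_aux, List.head?_nil, List.tail_nil]
    exact ReachIn.refl _ _
  | cons b u ih =>
    obtain ⟨v', h⟩ := ih (b :: l) (some b)
    refine ⟨v', (ReachIn.step (k := 2 * u.length + 1 + 1) ?_).mono (by simp; omega)⟩
    rw [hM]
    simp only [mapLabel, TM2.stepAux, st_aux, update_aux, List.head?_cons, List.tail_cons,
      Option.map_some, Option.elim_some]
    refine ReachIn.step ?_
    rw [hM]
    simp only [mapLabel_pushWord, stepAux_pushWord, mapLabel, TM2.stepAux, Option.elim_some]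
    refine h.cast rfl ?_ rfl ?_
    · simp [BTree.word]
    · simp

/-- The successor of a symbol in a fixed cyclic order. -/
def nextSymbol : TracSymbol → TracSymbol
  | .bit false => .bit true
  | .bit true => .minus
  | .minus => .slash
  | .slash => .comma
  | .comma => .semicolon
  | .semicolon => .bar
  | .bar => .hash
  | .hash => .bit false

/-- The number of a symbol. -/
def symbolIndex : TracSymbol → ℕ
  | .bit false => 0
  | .bit true => 1
  | .minus => 2
  | .slash => 3
  | .comma => 4
  | .semicolon => 5
  | .bar => 6
  | .hash => 7

theorem iterate_nextSymbol (x : TracSymbol) : nextSymbol^[symbolIndex x] zero = x := by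
  rcases x with ⟨⟨⟩⟩ | _ <;> rfl

/-- Write a list of symbols, given by their numbers, on the stack `aux`, in reversed order. The
numbers are stored in unary. -/
abbrev writeF : Frag where
  L := Option TracSymbol
  fin := inferInstance
  entry := none
  body
    | none => .pop .main (fun _ o => o) (.branch (fun v => v = some one)
        (.goto fun _ => some (some zero)) (.goto fun _ => none))
    | some y => .pop .main (fun _ o => o) (.branch (fun v => v = some one)
        (.pop .main (fun _ o => o) (.goto fun _ => some (some (nextSymbol y))))
        (.push .aux (fun _ => y) (.goto fun _ => some none)))

theorem reachIn_writeF {Λ : Type} {M : Λ → Code Λ} {e : Option TracSymbol → Λ} {x : Λ}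
    (hM : ∀ l, M (e l) = mapLabel (fun o => o.elim x e) (writeF.body l)) (n : ℕ)
    (y : TracSymbol) (m a : List TracSymbol) (v : Option TracSymbol) :
    ∃ v', ReachIn M (size n) ⟨some (e (some y)), v, st ((enc n).word ++ m) a [] []⟩
      ⟨some (e none), v', st m (nextSymbol^[n] y :: a) [] []⟩ := by
  induction n generalizing y v with
  | zero =>
    have e0 : (enc 0).word ++ m = zero :: m := rfl
    refine ⟨some zero, ReachIn.step (k := 0) ?_⟩
    rw [hM, e0]
    simp only [mapLabel, TM2.stepAux, st_main, update_main, List.head?_cons, List.tail_cons,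
      Option.some.injEq, TracSymbol.bit.injEq, Bool.false_eq_true, decide_false, cond_false,
      update_aux, st_aux]
    exact ReachIn.refl _ _
  | succ n ih =>
    obtain ⟨v', h⟩ := ih (nextSymbol y) (some zero)
    have e0 : (enc (n + 1)).word ++ m = one :: zero :: ((enc n).word ++ m) := rfl
    refine ⟨v', (ReachIn.step (k := size n) ?_).mono (by simp [size_nat])⟩
    rw [hM, e0]
    simp only [mapLabel, TM2.stepAux, st_main, update_main, List.head?_cons, List.tail_cons,
      decide_true, cond_true]
    exact h

theorem exec_writeF (u a : List TracSymbol) (m : List TracSymbol) :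
    Exec writeF (st ((enc (u.map symbolIndex)).word ++ m) a [] []) (st m (u.reverse ++ a) [] [])
      (size (u.map symbolIndex)) := by
  intro Λ M e x hM v
  induction u generalizing a v with
  | nil =>
    have e0 : (enc (([] : List TracSymbol).map symbolIndex)).word ++ m = zero :: m := rfl
    refine ⟨some zero, ReachIn.step (k := 0) ?_⟩
    rw [hM, e0]
    simp only [mapLabel, TM2.stepAux, st_main, update_main, List.head?_cons, List.tail_cons,
      Option.some.injEq, TracSymbol.bit.injEq, Bool.false_eq_true, decide_false, cond_false]
    exact ReachIn.refl _ _
  | cons b u ih =>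
    obtain ⟨v1, h1⟩ := reachIn_writeF hM (symbolIndex b) zero
      ((enc (u.map symbolIndex)).word ++ m) a (some one)
    rw [iterate_nextSymbol] at h1
    obtain ⟨v2, h2⟩ := ih (b :: a) v1
    have e0 : (enc ((b :: u).map symbolIndex)).word ++ m =
        one :: ((enc (symbolIndex b)).word ++ ((enc (u.map symbolIndex)).word ++ m)) := by
      simp [BTree.word]
    refine ⟨v2, (ReachIn.step (k := size (symbolIndex b) + size (u.map symbolIndex)) ?_).mono
      (by simp)⟩
    rw [hM, e0]
    simp only [mapLabel, TM2.stepAux, st_main, update_main, List.head?_cons, List.tail_cons,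
      decide_true, cond_true]
    exact (h1.trans h2).cast rfl rfl rfl (by simp)

theorem size_symbols_le (u : List TracSymbol) : size u ≤ 12 * u.length + 1 := by
  induction u with
  | nil => simp
  | cons x u ih =>
    have : size x ≤ 11 := by rcases x with ⟨⟨⟩⟩ | _ <;> decide
    simp
    omega

/-- The machine that runs a fragment with the input and the output on the stack `aux`. -/
def machine (F : Frag) : FinTM2 where
  K := Stk
  kDecidableEq := inferInstance
  kFin := inferInstance
  k₀ := .aux
  k₁ := .aux
  Γ _ := TracSymbol
  Λ := Option F.L
  main := some F.entry
  ΛFin := haveI := F.fin; inferInstance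
  σ := Option TracSymbol
  initialState := none
  σFin := inferInstance
  Γk₀Fin := inferInstanceAs (Fintype TracSymbol)
  m
    | some l => mapLabel (fun o => o.elim none some) (F.body l)
    -- the final configuration has to have the initial value in the register
    | none => .load (fun _ => none) .halt

theorem machine_outputs {F : Frag} {u v : List TracSymbol} {k : ℕ}
    (h : Exec F (st [] u [] []) (st [] v [] []) k) :
    Nonempty (TM2OutputsInTime (machine F) u (some v) (k + 1)) := by
  obtain ⟨w, h1⟩ := h (Option F.L) (machine F).m some none (fun _ => rfl) none
  obtain ⟨j, hj, h2⟩ := h1.trans (ReachIn.step (k := 0) (c' := ⟨none, none, st [] v [] []⟩)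
    (ReachIn.refl 0 _))
  have e1 : initList (machine F) u = ⟨some (some F.entry), none, st [] u [] []⟩ := by
    unfold initList
    congr 1
    funext k
    cases k <;> rfl
  have e2 : haltList (machine F) v = ⟨none, none, st [] v [] []⟩ := by
    unfold haltList
    congr 1
    funext k
    cases k <;> rfl
  refine ⟨⟨⟨j, ?_⟩, hj⟩⟩
  rw [e1]
  exact h2.trans (congrArg some e2.symm)

/-- A function on words that is computed by program fragments is computed by a Turing machine in
polynomial time. -/
theorem PT.exists_machine {f : List TracSymbol → List TracSymbol} (hf : PT f) :
    ∃ (F : Frag) (p : Polynomial ℕ), ∀ u : List TracSymbol,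
      Nonempty (TM2OutputsInTime (machine F) u (some (f u)) (p.eval u.length)) := by
  have h1 : PT fun u : List TracSymbol => (f u.reverse).reverse := by
    have := hf.comp (PT.reverse (PT.id (α := List TracSymbol)))
    fun_prop
  have h2 : PT fun u : List TracSymbol => ((f u.reverse).reverse).map symbolIndex :=
    PT.map h1 ((PT.symbol_fun symbolIndex).comp PT.snd')
  obtain ⟨G, p, hG⟩ := h2
  refine ⟨seq (pushF zero) (seq readF (seq G writeF)),
    2 * .X + 3 + 2 * p.comp (12 * .X + 1), fun u => ?_⟩
  have e1 := exec_pushF zero [] u [] []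
  have e2 := exec_readF u [] []
  have e3 : Exec G (st (enc u.reverse).word [] [] [])
      (st (enc ((f u).reverse.map symbolIndex)).word [] [] []) (p.eval (size u.reverse)) := by
    simpa using (hG u.reverse).2 []
  have e4 := exec_writeF (f u).reverse [] []
  simp only [List.reverse_reverse, List.append_nil] at e2 e4
  obtain ⟨h⟩ := machine_outputs (e1.seq (e2.seq (e3.seq e4)))
  refine ⟨⟨h.toEvalsTo, h.steps_le_m.trans ?_⟩⟩
  have h3 := (hG u.reverse).1
  have h4 := p.eval_mono_nat (size_symbols_le u.reverse)
  simp only [List.reverse_reverse, List.length_reverse] at h3 h4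
  simp only [Polynomial.eval_add, Polynomial.eval_mul, Polynomial.eval_X, Polynomial.eval_ofNat,
    Polynomial.eval_comp, Polynomial.eval_one]
  omega

/-- The particle tracking problem is solved by a Turing machine in polynomial time. -/
theorem exists_optimal_computable (d : ℕ) : ∃ f : (I : TracInstance d) → I.Coupling,
    (∀ I, (f I).IsOptimal) ∧
    Nonempty (TM2ComputableInPolyTime TracInstance.encode encodeLists
      (fun I : TracInstance d => (f I).tracks)) := by
  choose f hf1 hf2 using solve_encode (d := d)
  obtain ⟨F, p, h⟩ := PT.solve.exists_machine
  refine ⟨f, hf1, ⟨⟨⟨machine F, Equiv.refl _, Equiv.refl _⟩, p, fun I => ?_⟩⟩⟩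
  have h1 := (h I.encode).some
  rw [hf2] at h1
  have e : ∀ u : List TracSymbol, u.map (Equiv.refl TracSymbol).invFun = u := fun u =>
    List.map_id u
  exact cast (congrArg₂ (fun a b => TM2OutputsInTime (machine F) a (some b)
    (p.eval I.encode.length)) (e _).symm (e _).symm) h1

end StackProgram

/-! ### The decomposition into matching problems -/

namespace TracInstance

variable {d : ℕ} {I : TracInstance d}

namespace Coupling

theorem stepEdges_adj (π : I.Coupling) (τ : Fin I.steps) (p : I.F τ.castSucc) (q : I.F τ.succ) :
    (π.stepEdges τ).Adj (Sum.inl p) (Sum.inr q) ↔ π τ.succ ((π τ.castSucc).symm p) = q := by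
  constructor
  · rintro ⟨k, ⟨h1, h2⟩ | ⟨h1, -⟩⟩
    · rw [Sum.inl.inj h1, Sum.inr.inj h2, Equiv.symm_apply_apply]
    · cases h1
  · rintro rfl
    exact ⟨(π τ.castSucc).symm p, Or.inl ⟨by simp, rfl⟩⟩

theorem stepEdges_isPerfectMatching (π : I.Coupling) (τ : Fin I.steps) :
    (π.stepEdges τ).IsPerfectMatching := by
  refine ⟨?_, fun v => Set.mem_univ v⟩
  rintro (p | q) -
  · refine ⟨Sum.inr (π τ.succ ((π τ.castSucc).symm p)), (π.stepEdges_adj τ _ _).2 rfl, ?_⟩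
    rintro (p' | q') h
    · exact absurd h.adj_sub (by simp)
    · rw [(π.stepEdges_adj τ _ _).1 h]
  · refine ⟨Sum.inl (π τ.castSucc ((π τ.succ).symm q)),
      ((π.stepEdges_adj τ _ _).2 (by simp)).symm, ?_⟩
    rintro (p' | q') h
    · rw [← (π.stepEdges_adj τ _ _).1 h.symm]
      simp
    · exact absurd h.adj_sub (by simp)

end Coupling

/-- A perfect matching of the complete bipartite graph is the graph of a bijection. -/
theorem exists_equiv_of_isPerfectMatching {τ : Fin I.steps} {M : (I.stepGraph τ).Subgraph}
    (hM : M.IsPerfectMatching) : ∃ e : I.F τ.castSucc ≃ I.F τ.succ, ∀ p q,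
      M.Adj (Sum.inl p) (Sum.inr q) ↔ e p = q := by
  have h1 : ∀ p, ∃ q, M.Adj (Sum.inl p) (Sum.inr q) := fun p => by
    obtain ⟨p' | q, h, -⟩ := hM.1 (hM.2 (Sum.inl p))
    · exact absurd h.adj_sub (by simp)
    · exact ⟨q, h⟩
  have h2 : ∀ q, ∃ p, M.Adj (Sum.inl p) (Sum.inr q) := fun q => by
    obtain ⟨p | q', h, -⟩ := hM.1 (hM.2 (Sum.inr q))
    · exact ⟨p, h.symm⟩
    · exact absurd h.adj_sub (by simp)
  have h3 : ∀ {p q q'}, M.Adj (Sum.inl p) (Sum.inr q) → M.Adj (Sum.inl p) (Sum.inr q') → q = q' :=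
    fun h h' => Sum.inr.inj ((hM.1 (hM.2 _)).unique h h')
  have h4 : ∀ {p p' q}, M.Adj (Sum.inl p) (Sum.inr q) → M.Adj (Sum.inl p') (Sum.inr q) → p = p' :=
    fun h h' => Sum.inl.inj ((hM.1 (hM.2 _)).unique h.symm h'.symm)
  choose f hf using h1
  choose g hg using h2
  exact ⟨⟨f, g, fun p => h4 (hg _) (hf p), fun q => h3 (hf _) (hg q)⟩,
    fun p q => ⟨fun h => h3 (hf p) h, fun h => h ▸ hf p⟩⟩

/-- Spanning subgraphs of a bipartite graph are equal if they have the same edges from the left to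
the right vertices. -/
theorem subgraph_ext {τ : Fin I.steps} {M M' : (I.stepGraph τ).Subgraph} (hM : M.IsSpanning)
    (hM' : M'.IsSpanning)
    (h : ∀ p q, M.Adj (Sum.inl p) (Sum.inr q) ↔ M'.Adj (Sum.inl p) (Sum.inr q)) : M = M' := by
  refine SimpleGraph.Subgraph.ext ?_ ?_
  · ext v
    exact ⟨fun _ => hM' v, fun _ => hM v⟩
  · funext x y
    refine propext ?_
    rcases x with p | q <;> rcases y with p' | q'
    · exact ⟨fun h => absurd h.adj_sub (by simp), fun h => absurd h.adj_sub (by simp)⟩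
    · exact h p q'
    · rw [M.adj_comm, M'.adj_comm]
      exact h p' q
    · exact ⟨fun h => absurd h.adj_sub (by simp), fun h => absurd h.adj_sub (by simp)⟩

/-- Every family of perfect matchings comes from a coupling: start with any numbering of the
particles and follow the matchings. -/
theorem exists_coupling (M : (τ : Fin I.steps) → (I.stepGraph τ).Subgraph)
    (hM : ∀ τ, (M τ).IsPerfectMatching) : ∃ π : I.Coupling, ∀ τ, π.stepEdges τ = M τ := by
  choose e he using fun τ => exists_equiv_of_isPerfectMatching (hM τ)
  let π : I.Coupling := fun τ =>
    Fin.induction (motive := fun τ => Fin I.n ≃ I.F τ) (I.numbering 0) (fun τ f => f.trans (e τ)) τ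
  have hπ : ∀ τ k, π τ.succ k = e τ (π τ.castSucc k) := fun τ k => rfl
  refine ⟨π, fun τ => subgraph_ext (π.stepEdges_isPerfectMatching τ).2 (hM τ).2 fun p q => ?_⟩
  rw [π.stepEdges_adj, he, hπ, Equiv.apply_symm_apply]

namespace Coupling

theorem stepEdges_eq_iff (π π' : I.Coupling) : (∀ τ, π.stepEdges τ = π'.stepEdges τ) ↔
    ∃ ρ : Equiv.Perm (Fin I.n), ∀ τ k, π' τ k = π τ (ρ k) := by
  constructor
  · intro h
    refine ⟨(π' 0).trans (π 0).symm, fun τ => ?_⟩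
    induction τ using Fin.induction with
    | zero => intro k; simp
    | succ τ ih =>
      intro k
      have h1 := (π'.stepEdges_adj τ (π' τ.castSucc k) (π' τ.succ k)).2 (by simp)
      rw [← h, stepEdges_adj, ih] at h1
      rw [← h1, Equiv.symm_apply_apply]
  · rintro ⟨ρ, h⟩ τ
    refine subgraph_ext (π.stepEdges_isPerfectMatching τ).2 (π'.stepEdges_isPerfectMatching τ).2
      fun p q => ?_
    have h1 : ρ ((π' τ.castSucc).symm p) = (π τ.castSucc).symm p := by
      rw [Equiv.eq_symm_apply, ← h, Equiv.apply_symm_apply]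
    rw [stepEdges_adj, stepEdges_adj, h, h1]

theorem subgraphWeight_stepEdges (π : I.Coupling) (τ : Fin I.steps) :
    I.subgraphWeight τ (π.stepEdges τ) = ∑ k, I.w τ (π τ.castSucc k) (π τ.succ k) := by
  rw [subgraphWeight, ← Equiv.sum_comp (π τ.castSucc)]
  refine Finset.sum_congr rfl fun k _ => ?_
  rw [Finset.sum_eq_single (π τ.succ k)]
  · rw [if_pos ((π.stepEdges_adj τ _ _).2 (by simp))]
  · intro q _ hq
    rw [if_neg]
    rw [π.stepEdges_adj, Equiv.symm_apply_apply]
    exact hq.symm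
  · simp

theorem cost_eq_sum_subgraphWeight (π : I.Coupling) :
    π.cost = ∑ τ : Fin I.steps, I.subgraphWeight τ (π.stepEdges τ) := by
  simp only [subgraphWeight_stepEdges]
  exact Finset.sum_comm

theorem isOptimal_iff (π : I.Coupling) :
    π.IsOptimal ↔ ∀ τ : Fin I.steps, I.IsMinWeightPerfectMatching τ (π.stepEdges τ) := by
  constructor
  · intro h τ
    refine ⟨π.stepEdges_isPerfectMatching τ, fun M' hM' => ?_⟩
    by_contra! hlt
    -- exchanging the matching of a single step would give a cheaper coupling
    obtain ⟨π', hπ'⟩ := exists_coupling (Function.update π.stepEdges τ M') fun σ => by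
      by_cases hσ : σ = τ
      · subst hσ; simpa using hM'
      · simpa [hσ] using π.stepEdges_isPerfectMatching σ
    refine (h π').not_gt ?_
    rw [cost_eq_sum_subgraphWeight, cost_eq_sum_subgraphWeight]
    refine Finset.sum_lt_sum (fun σ _ => ?_) ⟨τ, Finset.mem_univ τ, by simpa [hπ'] using hlt⟩
    rw [hπ']
    by_cases hσ : σ = τ
    · subst hσ; simpa using hlt.le
    · simp [hσ]
  · intro h π'
    rw [cost_eq_sum_subgraphWeight, cost_eq_sum_subgraphWeight]
    exact Finset.sum_le_sum fun τ _ => (h τ).2 _ (π'.stepEdges_isPerfectMatching τ)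

end Coupling

end TracInstance

theorem theorem3p1 (d : ℕ) (hd : 2 ≤ d) :
    -- decomposition into uncoupled minimum weight perfect bipartite matching problems
    (∀ I : TracInstance d,
      (∀ (π : I.Coupling) (τ : Fin I.steps), (π.stepEdges τ).IsPerfectMatching) ∧
      (∀ M : (τ : Fin I.steps) → (I.stepGraph τ).Subgraph,
        (∀ τ, (M τ).IsPerfectMatching) → ∃ π : I.Coupling, ∀ τ, π.stepEdges τ = M τ) ∧
      (∀ π π' : I.Coupling, (∀ τ, π.stepEdges τ = π'.stepEdges τ) ↔
        ∃ ρ : Equiv.Perm (Fin I.n), ∀ τ k, π' τ k = π τ (ρ k)) ∧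
      (∀ π : I.Coupling, π.cost = ∑ τ : Fin I.steps, I.subgraphWeight τ (π.stepEdges τ)) ∧
      (∀ π : I.Coupling, π.IsOptimal ↔
        ∀ τ : Fin I.steps, I.IsMinWeightPerfectMatching τ (π.stepEdges τ))) ∧
    -- a Turing machine finds an optimal solution in polynomial time
    (∃ f : (I : TracInstance d) → I.Coupling,
      (∀ I, (f I).IsOptimal) ∧
      Nonempty (Turing.TM2ComputableInPolyTime TracInstance.encode TracSymbol.encodeLists
        (fun I : TracInstance d => (f I).tracks))) :=
  ⟨fun _ => ⟨TracInstance.Coupling.stepEdges_isPerfectMatching, TracInstance.exists_coupling,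
    TracInstance.Coupling.stepEdges_eq_iff, TracInstance.Coupling.cost_eq_sum_subgraphWeight,
    TracInstance.Coupling.isOptimal_iff⟩, StackProgram.exists_optimal_computable d⟩
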